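/- Let $\Bbbk$ be a field of characteristic $0$ and $n\ge 0$. Let $\widehat Q$ be the quiver with vertices $1,\dots,n$, a loop $z$ at each vertex and, for all $i<j$, arrows $x,y:i\to j$ and $x^*,y^*:j\to i$ (put $x^{**}=x$, $y^{**}=y$; paths are composed from left to right, and $e_i$ is the trivial path at $i$). Let $\widehat A$ be the quotient of the path algebra $\Bbbk\widehat Q$ by the two-sided ideal generated by all paths of length two with distinct endpoints and by the elements $a^*b-\delta_{a,b}\,e_ize_i$, for all $a,b\in\{x,y,x^*,y^*\}$ and all paths $a^*b$ of length two from $i$ to $i$ through a vertex $j\ne i$; for $n=1$ put $\widehat A=\Bbbk[z]/(z^2)$. Put $P_i=\widehat Ae_i$. Consider $\widehat A$ either without grading, or with the path length grading ($\deg x=\deg y=\deg x^*=\deg y^*=1$, $\deg z=2$), or with the grading given by an orientation $o$ of the doubled complete graph (whose edges are the pairs $\{x,x^*\}$ and $\{y,y^*\}$): an arrow has degree $1$ if it is directed as in $o$ and degree $0$ otherwise, and $\deg z=1$. In particular, this includes the symmetric orientation $\widetilde o$, in which for $i<j$ the $x$-edge points from $i$ to $j$ and the $y$-edge from $j$ to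 $i$. In each case let $\mathcal D$ be the homotopy category of bounded complexes of finitely generated projective (graded) left $\widehat A$-modules, with morphisms of degree $0$, and let $M\langle s\rangle_m=M_{m+s}$. For $1\le i\le n$ let $\Sigma_i,\Sigma_i^{-1}:\mathcal D\to\mathcal D$ be given by tensoring over $\widehat A$ with the complexes of bimodules $$\widehat A\xrightarrow{\,g_i\,}(\widehat Ae_i\otimes_\Bbbk e_i\widehat A)\langle\deg z\rangle,\qquad \widehat Ae_i\otimes_\Bbbk e_i\widehat A\xrightarrow{\,f_i\,}\widehat A$$ with $\widehat A$ in homological degree $0$, where $f_i(p\otimes q)=pq$ and $g_i(1)=z\otimes e_i+e_i\otimes z+\sum_a a^*\otimes a$, the sum being over all arrows $a\neq z$ starting at $i$ (spherical twists in $P_i$; explicitly $(\widehat Ae_i\otimes_\Bbbk e_i\widehat A)\otimes_{\widehat A}Y=P_i\otimes_\Bbbk e_iY$). Then the $\Sigma_i$ are auto-equivalences of $\mathcal D$ with inverses $\Sigma_i^{-1}$, and the weak action $\sigma_i\mapsto\Sigma_i$ of the free group $F_n=\langle\sigma_1,\dots,\sigma_n\rangle$ on $\mathcal D$ is faithful: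 the induced homomorphism $F_n\to[\mathrm{Aut}(\mathcal D)]$ to the group of isomorphism classes of auto-equivalences of $\mathcal D$ is injective. This holds for $\widetilde o$, for every other orientation $o$, for the path length grading and for the ungraded category. Consequently $F_n$ is $2$-linear over $\Bbbk$: it has a weak action by $\Bbbk$-linear triangulated auto-equivalences, with injective induced map to the group of isomorphism classes of auto-equivalences, on a $\Bbbk$-linear triangulated category which has finite dimensional morphism spaces and which is the smallest full triangulated subcategory of itself containing some finite set of objects. -/

import Mathlib

universe u

noncomputable section

open CategoryTheory Limits CochainComplex HomComplex ZeroObject TensorProduct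

namespace ZigzagFree


section MapHomotopy

variable {C : Type*} [Category C] [Preadditive C] [HasBinaryBiproducts C]
  {K₁ L₁ K₂ L₂ : CochainComplex C ℤ} {φ₁ : K₁ ⟶ L₁} {φ₂ : K₂ ⟶ L₂}
  {a a' : K₁ ⟶ K₂} {b b' : L₁ ⟶ L₂}

/-- Compatible homotopies `a ∼ a'` and `b ∼ b'` induce a homotopy between maps of cones. -/
lemma mappingCone_map_homotopy (comm : φ₁ ≫ b = a ≫ φ₂) (comm' : φ₁ ≫ b' = a' ≫ φ₂)
    (hK : Homotopy a a') (hL : Homotopy b b')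
    (h : ∀ p q, hK.hom p q ≫ φ₂.f q = φ₁.f p ≫ hL.hom p q) :
    Nonempty (Homotopy (mappingCone.map φ₁ φ₂ a b comm) (mappingCone.map φ₁ φ₂ a' b' comm')) := by
  obtain ⟨zK, hzK, hK'⟩ : ∃ z : Cochain K₁ K₂ (-1),
      Cochain.ofHom a = δ (-1) 0 z + Cochain.ofHom a' ∧
      ∀ p q hpq, z.v p q hpq = hK.hom p q :=
    ⟨_, (Cochain.equivHomotopy _ _ hK).2, fun _ _ _ => rfl⟩
  obtain ⟨zL, hzL, hL'⟩ : ∃ z : Cochain L₁ L₂ (-1),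
      Cochain.ofHom b = δ (-1) 0 z + Cochain.ofHom b' ∧
      ∀ p q hpq, z.v p q hpq = hL.hom p q :=
    ⟨_, (Cochain.equivHomotopy _ _ hL).2, fun _ _ _ => rfl⟩
  have hc : zK.comp (Cochain.ofHom φ₂) (add_zero (-1)) =
      (Cochain.ofHom φ₁).comp zL (zero_add (-1)) := by
    ext p q hpq
    rw [Cochain.comp_zero_cochain_v, Cochain.zero_cochain_comp_v, hK', hL', Cochain.ofHom_v,
      Cochain.ofHom_v]
    exact h p q
  refine ⟨mappingCone.descHomotopy _ _ _
    (-(zK.comp (mappingCone.inl φ₂) (by norm_num)))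
    (zL.comp (Cochain.ofHom (mappingCone.inr φ₂)) (add_zero (-1))) ?_ ?_⟩
  · have e1 : δ (-2) (-1) (zK.comp (mappingCone.inl φ₂) (by norm_num : (-1 : ℤ) + -1 = -2))
        = _ := δ_comp zK (mappingCone.inl φ₂) (by norm_num) 0 0 (-1) (by norm_num)
          (by norm_num) (by norm_num)
    rw [δ_neg, e1, mappingCone.δ_inl, Cochain.ofHom_comp,
      ← Cochain.comp_assoc_of_second_is_zero_cochain, hc]
    simp [mappingCone.map, hzK]
  · simp [mappingCone.map, hzL]

end MapHomotopy

section Cone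

variable {C : Type*} [Category C] [Preadditive C] [HasBinaryBiproducts C]
  {F G : C ⥤ C} [F.Additive] [G.Additive] (τ : F ⟶ G)

/-- The chain map `F(K) ⟶ G(K)` given termwise by `τ`. -/
abbrev termwise (K : CochainComplex C ℤ) :
    (F.mapHomologicalComplex (ComplexShape.up ℤ)).obj K ⟶
      (G.mapHomologicalComplex (ComplexShape.up ℤ)).obj K :=
  (NatTrans.mapHomologicalComplex τ (ComplexShape.up ℤ)).app K

/-- The functor `K ↦ Cone(F(K) ⟶ G(K))` on cochain complexes. -/
def coneComplex : CochainComplex C ℤ ⥤ CochainComplex C ℤ where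
  obj K := mappingCone (termwise τ K)
  map {K L} f := mappingCone.map (termwise τ K) (termwise τ L)
    ((F.mapHomologicalComplex _).map f) ((G.mapHomologicalComplex _).map f)
    ((NatTrans.mapHomologicalComplex τ (ComplexShape.up ℤ)).naturality f).symm
  map_id K := by
    rw [← mappingCone.map_id (termwise τ K)]
    congr 1 <;> exact CategoryTheory.Functor.map_id _ _
  map_comp f g := by
    rw [← mappingCone.map_comp]
    congr 1 <;> exact CategoryTheory.Functor.map_comp _ _ _

lemma coneComplex_homotopy {K L : CochainComplex C ℤ} {f g : K ⟶ L} (h : Homotopy f g) :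
    Nonempty (Homotopy ((coneComplex τ).map f) ((coneComplex τ).map g)) :=
  mappingCone_map_homotopy
    ((NatTrans.mapHomologicalComplex τ (ComplexShape.up ℤ)).naturality f).symm
    ((NatTrans.mapHomologicalComplex τ (ComplexShape.up ℤ)).naturality g).symm (F.mapHomotopy h) (G.mapHomotopy h)
    (fun _ _ => τ.naturality _)

/-- The functor `K ↦ Cone(F(K) ⟶ G(K))` on the homotopy category. -/
def coneHomotopy : HomotopyCategory C (ComplexShape.up ℤ) ⥤ HomotopyCategory C (ComplexShape.up ℤ) :=
  CategoryTheory.Quotient.lift _ (coneComplex τ ⋙ HomotopyCategory.quotient _ _) (by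
    rintro K L f g ⟨h⟩
    exact HomotopyCategory.eq_of_homotopy _ _ (coneComplex_homotopy τ h).some)

end Cone

section Bounded

variable (C : Type*) [Category C] [Preadditive C]

/-- The bounded complexes in the homotopy category: `Kᵐ = 0` unless `a ≤ m ≤ b`. -/
def bounded : ObjectProperty (HomotopyCategory C (ComplexShape.up ℤ)) :=
  fun K => ∃ a b : ℤ, ∀ m : ℤ, (m < a ∨ b < m) → IsZero (K.as.X m)

instance [HasZeroObject C] : (bounded C).ContainsZero where
  exists_zero := ⟨(HomotopyCategory.quotient _ _).obj 0,
    Functor.map_isZero _ (isZero_zero _), 0, 0, fun m _ =>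
      (HomologicalComplex.eval C (ComplexShape.up ℤ) m).map_isZero (isZero_zero _)⟩

instance : (bounded C).IsStableUnderShift ℤ where
  isStableUnderShiftBy n :=
    { le_shift := by
        rintro K ⟨a, b, h⟩
        obtain ⟨K : CochainComplex _ _, rfl⟩ := K.quotient_obj_surjective
        rw [ObjectProperty.prop_shift_iff, HomotopyCategory.shift_quotient_obj]
        refine ⟨a - n, b - n, fun m hm => ?_⟩
        have := h (m + n) (by omega)
        exact this }

instance [HasZeroObject C] [HasBinaryBiproducts C] : (bounded C).IsTriangulatedClosed₃ where
  ext₃' T hT h₁ h₂ := by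
    obtain ⟨a₁, b₁, h₁⟩ := h₁
    obtain ⟨a₂, b₂, h₂⟩ := h₂
    obtain ⟨f : T.obj₁.as ⟶ T.obj₂.as, hf⟩ := (HomotopyCategory.quotient _ _).map_surjective T.mor₁
    refine ⟨_, ?_, ⟨Pretriangulated.Triangle.π₃.mapIso (Pretriangulated.isoTriangleOfIso₁₂ T _ hT
        (HomotopyCategory.mappingCone_triangleh_distinguished f)
        (Iso.refl _) (Iso.refl _) ?_)⟩⟩
    · refine ⟨min (a₁ - 1) a₂, max (b₁ - 1) b₂, fun m hm => ?_⟩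
      refine (mappingCone.isZero_X_iff f m).2 ⟨h₁ _ (by omega), h₂ _ (by omega)⟩
    · exact (Category.comp_id _).trans (hf.symm.trans (Category.id_comp _).symm)

instance [HasZeroObject C] [HasBinaryBiproducts C] : (bounded C).IsTriangulated where
  toIsTriangulatedClosed₂ := .of_isTriangulatedClosed₃

/-- The homotopy category of bounded complexes. -/
abbrev BoundedHomotopy := (bounded C).FullSubcategory

variable {C} [HasBinaryBiproducts C]
  {F G : C ⥤ C} [F.Additive] [G.Additive] (τ : F ⟶ G)

/-- The functor `K ↦ Cone(F(K) ⟶ G(K))` on the homotopy category of bounded complexes. -/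
def boundedCone : BoundedHomotopy C ⥤ BoundedHomotopy C :=
  (bounded C).lift ((bounded C).ι ⋙ coneHomotopy τ) (by
    rintro ⟨K, a, b, h⟩
    refine ⟨a - 1, b, fun m hm => (mappingCone.isZero_X_iff _ m).2 ⟨?_, ?_⟩⟩
    · exact F.map_isZero (h (m + 1) (by omega))
    · exact G.map_isZero (h m (by omega)))

end Bounded


/-- The two edges joining each pair of distinct vertices of the doubled complete graph. -/
inductive Edge
  | x
  | y
  deriving DecidableEq

instance : Fintype Edge := ⟨{Edge.x, Edge.y}, by rintro ⟨⟩ <;> simp⟩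

/-- Trivial paths, loops and arrows of the Ginzburg double of the doubled complete graph on `n`
vertices. For `i < j`, `arr .x i j`, `arr .y i j` are the arrows `x, y : i ⟶ j`, and
`arr .x j i`, `arr .y j i` are `x*, y* : j ⟶ i`. So `arr c i j` and `arr c j i` are always
dual to each other. -/
inductive Gen (n : ℕ)
  | e (i : Fin n)
  | z (i : Fin n)
  | arr (c : Edge) (i j : Fin n) (h : i ≠ j)

open FreeAlgebra in
/-- The defining relations of the zigzag algebra. The first group (down to `arr_e`) presents the
path algebra, paths being composed from left to right (`e_i a e_j = a` for `a : i ⟶ j`); the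
second group is the ideal of zigzag relations. The relation `z_z` follows from the others if
`2 ≤ n`, and makes the algebra `k[z]/z²` for `n = 1`. -/
inductive Rel (k : Type u) [Field k] (n : ℕ) :
    FreeAlgebra k (Gen n) → FreeAlgebra k (Gen n) → Prop
  | e_e (i : Fin n) : Rel k n (ι k (.e i) * ι k (.e i)) (ι k (.e i))
  | e_e_ne (i j : Fin n) (h : i ≠ j) : Rel k n (ι k (.e i) * ι k (.e j)) 0
  | sum_e : Rel k n (∑ i, ι k (.e i)) 1
  | e_z (i : Fin n) : Rel k n (ι k (.e i) * ι k (.z i)) (ι k (.z i))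
  | z_e (i : Fin n) : Rel k n (ι k (.z i) * ι k (.e i)) (ι k (.z i))
  | e_arr (c : Edge) (i j : Fin n) (h : i ≠ j) :
      Rel k n (ι k (.e i) * ι k (.arr c i j h)) (ι k (.arr c i j h))
  | arr_e (c : Edge) (i j : Fin n) (h : i ≠ j) :
      Rel k n (ι k (.arr c i j h) * ι k (.e j)) (ι k (.arr c i j h))
  | arr_arr_ne (c d : Edge) (i j l : Fin n) (h : i ≠ j) (h' : j ≠ l) (hil : i ≠ l) :
      Rel k n (ι k (.arr c i j h) * ι k (.arr d j l h')) 0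
  | z_arr (c : Edge) (i j : Fin n) (h : i ≠ j) : Rel k n (ι k (.z i) * ι k (.arr c i j h)) 0
  | arr_z (c : Edge) (i j : Fin n) (h : i ≠ j) : Rel k n (ι k (.arr c i j h) * ι k (.z j)) 0
  | arr_star (c : Edge) (i j : Fin n) (h : i ≠ j) :
      Rel k n (ι k (.arr c i j h) * ι k (.arr c j i h.symm)) (ι k (.z i))
  | arr_star_ne (c d : Edge) (i j : Fin n) (h : i ≠ j) (hcd : c ≠ d) :
      Rel k n (ι k (.arr c i j h) * ι k (.arr d j i h.symm)) 0
  | z_z (i : Fin n) : Rel k n (ι k (.z i) * ι k (.z i)) 0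

/-- The zigzag algebra of the doubled complete graph on `n` vertices. -/
def Zigzag (k : Type u) [Field k] (n : ℕ) : Type u := RingQuot (Rel k n)

instance (k : Type u) [Field k] (n : ℕ) : Ring (Zigzag k n) :=
  inferInstanceAs (Ring (RingQuot (Rel k n)))

instance (k : Type u) [Field k] (n : ℕ) : Algebra k (Zigzag k n) :=
  inferInstanceAs (Algebra k (RingQuot (Rel k n)))

section Algebra

variable (k : Type u) [Field k] {n : ℕ}

/-- The quotient homomorphism. -/
def quot : FreeAlgebra k (Gen n) →ₐ[k] Zigzag k n := RingQuot.mkAlgHom k (Rel k n)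

/-- The class of a generator in the zigzag algebra. -/
def gen (s : Gen n) : Zigzag k n := quot k (FreeAlgebra.ι k s)

/-- The idempotent `e_i`. -/
abbrev idem (i : Fin n) : Zigzag k n := gen k (.e i)

lemma rel_eq {a b : FreeAlgebra k (Gen n)} (h : Rel k n a b) :
    quot k a = quot k b :=
  RingQuot.mkAlgHom_rel k h

lemma idem_mul_idem (i : Fin n) : idem k i * idem k i = idem k i := by
  simpa [gen] using rel_eq k (.e_e i)

lemma idem_mul_idem_ne {i j : Fin n} (h : i ≠ j) : idem k i * idem k j = 0 := by
  simpa [gen] using rel_eq k (.e_e_ne i j h)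

lemma sum_idem : ∑ i : Fin n, idem k i = 1 := by
  simpa [gen] using rel_eq k (n := n) .sum_e

lemma idem_mul_z (i : Fin n) : idem k i * gen k (.z i) = gen k (.z i) := by
  simpa [gen] using rel_eq k (.e_z i)

lemma z_mul_idem (i : Fin n) : gen k (.z i) * idem k i = gen k (.z i) := by
  simpa [gen] using rel_eq k (.z_e i)

lemma idem_mul_arr (c : Edge) {i j : Fin n} (h : i ≠ j) :
    idem k i * gen k (.arr c i j h) = gen k (.arr c i j h) := by
  simpa [gen] using rel_eq k (.e_arr c i j h)

lemma arr_mul_idem (c : Edge) {i j : Fin n} (h : i ≠ j) :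
    gen k (.arr c i j h) * idem k j = gen k (.arr c i j h) := by
  simpa [gen] using rel_eq k (.arr_e c i j h)

lemma arr_mul_arr_ne (c d : Edge) {i j l : Fin n} (h : i ≠ j) (h' : j ≠ l) (hil : i ≠ l) :
    gen k (.arr c i j h) * gen k (.arr d j l h') = 0 := by
  simpa [gen] using rel_eq k (.arr_arr_ne c d i j l h h' hil)

lemma z_mul_arr (c : Edge) {i j : Fin n} (h : i ≠ j) :
    gen k (.z i) * gen k (.arr c i j h) = 0 := by
  simpa [gen] using rel_eq k (.z_arr c i j h)

lemma arr_mul_z (c : Edge) {i j : Fin n} (h : i ≠ j) :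
    gen k (.arr c i j h) * gen k (.z j) = 0 := by
  simpa [gen] using rel_eq k (.arr_z c i j h)

lemma arr_mul_star (c : Edge) {i j : Fin n} (h : i ≠ j) :
    gen k (.arr c i j h) * gen k (.arr c j i h.symm) = gen k (.z i) := by
  simpa [gen] using rel_eq k (.arr_star c i j h)

lemma arr_mul_star_ne {c d : Edge} {i j : Fin n} (h : i ≠ j) (hcd : c ≠ d) :
    gen k (.arr c i j h) * gen k (.arr d j i h.symm) = 0 := by
  simpa [gen] using rel_eq k (.arr_star_ne c d i j h hcd)

lemma z_mul_z (i : Fin n) : gen k (.z i) * gen k (.z i) = 0 := by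
  simpa [gen] using rel_eq k (.z_z i)

/-- Source and target of a generator. -/
def Gen.src : Gen n → Fin n
  | .e i => i
  | .z i => i
  | .arr _ i _ _ => i

/-- Source and target of a generator. -/
def Gen.tgt : Gen n → Fin n
  | .e i => i
  | .z i => i
  | .arr _ _ j _ => j

lemma idem_src_mul (s : Gen n) : idem k s.src * gen k s = gen k s := by
  cases s with
  | e i => exact idem_mul_idem k i
  | z i => exact idem_mul_z k i
  | arr c i j h => exact idem_mul_arr k c h

lemma mul_idem_tgt (s : Gen n) : gen k s * idem k s.tgt = gen k s := by
  cases s with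
  | e i => exact idem_mul_idem k i
  | z i => exact z_mul_idem k i
  | arr c i j h => exact arr_mul_idem k c h

lemma gen_mul_gen_of_ne {s t : Gen n} (h : s.tgt ≠ t.src) : gen k s * gen k t = 0 := by
  rw [← mul_idem_tgt k s, ← idem_src_mul k t, mul_assoc, ← mul_assoc (idem k s.tgt),
    idem_mul_idem_ne k h, zero_mul, mul_zero]

lemma gen_mul_gen (s t : Gen n) :
    gen k s * gen k t = 0 ∨ ∃ r, gen k s * gen k t = gen k r := by
  by_cases hst : s.tgt = t.src
  swap
  · exact Or.inl (gen_mul_gen_of_ne k hst)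
  cases t with
  | e j => exact Or.inr ⟨s, by rw [show j = s.tgt from hst.symm]; exact mul_idem_tgt k s⟩
  | z j =>
    cases s with
    | e i => obtain rfl : i = j := hst; exact Or.inr ⟨_, idem_mul_z k i⟩
    | z i => obtain rfl : i = j := hst; exact Or.inl (z_mul_z k i)
    | arr c i l h => obtain rfl : l = j := hst; exact Or.inl (arr_mul_z k c h)
  | arr d j l h' =>
    cases s with
    | e i => obtain rfl : i = j := hst; exact Or.inr ⟨_, idem_mul_arr k d h'⟩
    | z i => obtain rfl : i = j := hst; exact Or.inl (z_mul_arr k d h')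
    | arr c i m h =>
      obtain rfl : m = j := hst
      by_cases hil : i = l
      · subst hil
        by_cases hcd : c = d
        · subst hcd; exact Or.inr ⟨_, arr_mul_star k c h⟩
        · exact Or.inl (arr_mul_star_ne k h hcd)
      · exact Or.inl (arr_mul_arr_ne k c d h h' hil)

lemma adjoin_gen : Algebra.adjoin k (Set.range (gen k : Gen n → Zigzag k n)) = ⊤ := by
  rw [show (gen k : Gen n → Zigzag k n) = quot k ∘ FreeAlgebra.ι k from rfl,
    Set.range_comp, ← AlgHom.map_adjoin, FreeAlgebra.adjoin_range_ι, Algebra.map_top,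
    AlgHom.range_eq_top]
  exact RingQuot.mkAlgHom_surjective k _

lemma span_gen : Submodule.span k (Set.range (gen k : Gen n → Zigzag k n)) = ⊤ := by
  set S := Submodule.span k (Set.range (gen k : Gen n → Zigzag k n)) with hS
  have h1 : (1 : Zigzag k n) ∈ S := by
    rw [← sum_idem k]
    exact Submodule.sum_mem _ fun i _ => Submodule.subset_span ⟨_, rfl⟩
  have hmul : S * S ≤ S := by
    rw [hS, Submodule.span_mul_span, Submodule.span_le]
    rintro _ ⟨_, ⟨s, rfl⟩, _, ⟨t, rfl⟩, rfl⟩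
    rcases gen_mul_gen k s t with h | ⟨r, h⟩
    · simp only [h]; exact Submodule.zero_mem _
    · simp only [h]; exact Submodule.subset_span ⟨r, rfl⟩
  have : Algebra.adjoin k (Set.range (gen k : Gen n → Zigzag k n)) ≤
      S.toSubalgebra h1 (fun a b ha hb => hmul (Submodule.mul_mem_mul ha hb)) :=
    Algebra.adjoin_le Submodule.subset_span
  rw [adjoin_gen] at this
  exact eq_top_iff.2 fun a _ => this trivial

instance : Finite (Gen n) := by
  let f : Gen n → Fin n ⊕ Fin n ⊕ (Edge × Fin n × Fin n) := fun s => match s with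
    | .e i => .inl i
    | .z i => .inr (.inl i)
    | .arr c i j _ => .inr (.inr (c, i, j))
  refine Finite.of_injective f ?_
  rintro (_ | _ | _) (_ | _ | _) h <;> simp_all [f]

instance : Module.Finite k (Zigzag k n) :=
  ⟨Submodule.fg_def.2 ⟨_, Set.finite_range _, span_gen k⟩⟩

end Algebra

/-- Degrees in an abelian group `G` for the arrows and loops, such that the relations of the
zigzag algebra are homogeneous. -/
structure Weight (n : ℕ) (G : Type*) [AddCommGroup G] where
  /-- the degree of `arr c i j` -/
  arr : Edge → Fin n → Fin n → G
  /-- the degree of the loops -/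
  z : G
  arr_add : ∀ (c : Edge) (i j : Fin n), i ≠ j → arr c i j + arr c j i = z

section Grading

variable {n : ℕ} {G : Type*} [AddCommGroup G] (w : Weight n G)

/-- The degree of a generator. -/
def Weight.deg : Gen n → G
  | .e _ => 0
  | .z _ => w.z
  | .arr c i j _ => w.arr c i j

variable (k : Type u) [Field k]

/-- The homogeneous component of degree `g` of the zigzag algebra: the span of the products of
generators of total degree `g`. -/
def Weight.piece (g : G) : Submodule k (Zigzag k n) :=
  Submodule.span k {a | ∃ l : List (Gen n), (l.map w.deg).sum = g ∧ a = (l.map (gen k)).prod}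

lemma gen_mem_piece (s : Gen n) : gen k s ∈ w.piece k (w.deg s) :=
  Submodule.subset_span ⟨[s], by simp, by simp⟩

lemma one_mem_piece : (1 : Zigzag k n) ∈ w.piece k 0 :=
  Submodule.subset_span ⟨[], by simp, by simp⟩

lemma mul_mem_piece {g h : G} {a b : Zigzag k n} (ha : a ∈ w.piece k g) (hb : b ∈ w.piece k h) :
    a * b ∈ w.piece k (g + h) := by
  refine (?_ : w.piece k g * w.piece k h ≤ w.piece k (g + h)) (Submodule.mul_mem_mul ha hb)
  rw [Weight.piece, Weight.piece, Submodule.span_mul_span, Submodule.span_le]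
  rintro _ ⟨_, ⟨l, hl, rfl⟩, _, ⟨m, hm, rfl⟩, rfl⟩
  exact Submodule.subset_span ⟨l ++ m, by simp [hl, hm], by simp⟩

/-- The algebra homomorphism sending each generator `s` to `s` times its degree. -/
def Weight.coact : Zigzag k n →ₐ[k] AddMonoidAlgebra (Zigzag k n) G :=
  RingQuot.liftAlgHom k ⟨FreeAlgebra.lift k fun s => AddMonoidAlgebra.single (w.deg s) (gen k s), by
    intro a b h
    cases h with
    | e_e i => simp [AddMonoidAlgebra.single_mul_single, Weight.deg, idem_mul_idem]
    | e_e_ne i j h => simp [AddMonoidAlgebra.single_mul_single, Weight.deg, idem_mul_idem_ne k h]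
    | sum_e =>
      simp only [map_sum, FreeAlgebra.lift_ι_apply, Weight.deg, map_one]
      rw [AddMonoidAlgebra.one_def, ← sum_idem k]
      exact (map_sum (AddMonoidAlgebra.singleAddHom (R := Zigzag k n) (0 : G)) _ _).symm
    | e_z i => simp [AddMonoidAlgebra.single_mul_single, Weight.deg, idem_mul_z]
    | z_e i => simp [AddMonoidAlgebra.single_mul_single, Weight.deg, z_mul_idem]
    | e_arr c i j h => simp [AddMonoidAlgebra.single_mul_single, Weight.deg, idem_mul_arr]
    | arr_e c i j h => simp [AddMonoidAlgebra.single_mul_single, Weight.deg, arr_mul_idem]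
    | arr_arr_ne c d i j l h h' hil =>
      simp [AddMonoidAlgebra.single_mul_single, arr_mul_arr_ne k c d h h' hil]
    | z_arr c i j h => simp [AddMonoidAlgebra.single_mul_single, z_mul_arr]
    | arr_z c i j h => simp [AddMonoidAlgebra.single_mul_single, arr_mul_z]
    | arr_star c i j h =>
      simp [AddMonoidAlgebra.single_mul_single, Weight.deg, arr_mul_star, w.arr_add c i j h]
    | arr_star_ne c d i j h hcd =>
      simp [AddMonoidAlgebra.single_mul_single, arr_mul_star_ne k h hcd]
    | z_z i => simp [AddMonoidAlgebra.single_mul_single, z_mul_z]⟩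

lemma coact_gen (s : Gen n) :
    w.coact k (gen k s) = AddMonoidAlgebra.single (w.deg s) (gen k s) := by
  have : w.coact k (quot k (FreeAlgebra.ι k s)) =
      FreeAlgebra.lift k (fun s => AddMonoidAlgebra.single (w.deg s) (gen k s))
        (FreeAlgebra.ι k s) := RingQuot.liftAlgHom_mkAlgHom_apply _ _ _ _
  rw [FreeAlgebra.lift_ι_apply] at this
  exact this

lemma coact_of_mem {g : G} {a : Zigzag k n} (ha : a ∈ w.piece k g) :
    w.coact k a = AddMonoidAlgebra.single g a := by
  induction ha using Submodule.span_induction with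
  | mem a h =>
    obtain ⟨l, rfl, rfl⟩ := h
    induction l with
    | nil => simp [AddMonoidAlgebra.one_def]
    | cons s l ih =>
      simp [ih, coact_gen, AddMonoidAlgebra.single_mul_single]
  | zero => simp
  | add a b _ _ ha hb => simp [ha, hb]
  | smul c a _ ha => simp [ha]

lemma iSup_piece : ⨆ g, w.piece k g = ⊤ := by
  rw [eq_top_iff, ← span_gen k, Submodule.span_le]
  rintro _ ⟨s, rfl⟩
  exact Submodule.mem_iSup_of_mem _ (gen_mem_piece w k s)

end Grading

section Internal

variable (k : Type u) [Field k] {G : Type*}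

/-- A family of subspaces spanning `M` is a grading as soon as some linear map `M ⟶ M ⊗ k[G]`
separates its members. -/
lemma isInternal_of_coact {M : Type*} [AddCommGroup M] [Module k M] [DecidableEq G]
    (p : G → Submodule k M) (hp : ⨆ g, p g = ⊤) (ρ : M →ₗ[k] G →₀ M)
    (hρ : ∀ g, ∀ m ∈ p g, ρ m = Finsupp.single g m) : DirectSum.IsInternal p := by
  refine ⟨?_, ?_⟩
  · rw [injective_iff_map_eq_zero]
    intro a ha
    have key : ∀ (b : DirectSum G fun g => p g) (g : G),
        ρ (DirectSum.coeAddMonoidHom p b) g = b g := by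
      intro b g
      induction b using DirectSum.induction_on with
      | zero => simp
      | of h x =>
        rw [DirectSum.coeAddMonoidHom_of, hρ h x x.2, DirectSum.coe_of_apply, Finsupp.single_apply]
        split_ifs <;> rfl
      | add x y hx hy => simp [hx, hy]
    ext g
    rw [← key a g, ha]
    simp
  · intro m
    have hm : m ∈ ⨆ g, p g := hp ▸ Submodule.mem_top
    rw [Submodule.iSup_eq_range_dfinsupp_lsum] at hm
    obtain ⟨f, rfl⟩ := hm
    exact ⟨f, rfl⟩

/-- The linear map recording the homogeneous components of a vector. -/
lemma exists_coact {M : Type*} [AddCommGroup M] [Module k M] [DecidableEq G]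
    {p : G → Submodule k M} (hp : DirectSum.IsInternal p) :
    ∃ ρ : M →ₗ[k] G →₀ M, ∀ g, ∀ m ∈ p g, ρ m = Finsupp.single g m := by
  let e := LinearEquiv.ofBijective (DirectSum.coeLinearMap p) hp
  refine ⟨(DirectSum.toModule k G (G →₀ M) fun g =>
    (Finsupp.lsingle g).comp (p g).subtype) ∘ₗ e.symm.toLinearMap, fun g m hm => ?_⟩
  have : e.symm m = DirectSum.lof k G (fun g => p g) g ⟨m, hm⟩ := by
    rw [LinearEquiv.symm_apply_eq]
    exact (DirectSum.coeLinearMap_lof p g ⟨m, hm⟩).symm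
  simp [this]

end Internal

section Modules

variable {n : ℕ} {G : Type} [AddCommGroup G] [DecidableEq G]

/-- A finitely generated projective left module over the zigzag algebra, graded by `G` compatibly
with the grading `w` of the algebra. -/
structure GrProj (k : Type u) [Field k] (w : Weight n G) where
  /-- the underlying module -/
  carrier : Type u
  [addCommGroup : AddCommGroup carrier]
  [moduleBase : Module k carrier]
  [module : Module (Zigzag k n) carrier]
  [tower : IsScalarTower k (Zigzag k n) carrier]
  /-- the homogeneous components -/
  piece : G → Submodule k carrier
  isInternal : DirectSum.IsInternal piece
  smul_mem : ∀ {g h : G} {a : Zigzag k n} {m : carrier},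
    a ∈ w.piece k g → m ∈ piece h → a • m ∈ piece (g + h)
  [finite : Module.Finite (Zigzag k n) carrier]
  [projective : Module.Projective (Zigzag k n) carrier]

attribute [instance] GrProj.addCommGroup GrProj.moduleBase GrProj.module GrProj.tower
  GrProj.finite GrProj.projective

variable {k : Type u} [Field k] {w : Weight n G}

namespace GrProj

instance : CoeSort (GrProj k w) (Type u) := ⟨GrProj.carrier⟩

lemma iSup_piece (M : GrProj k w) : ⨆ g, M.piece g = ⊤ :=
  M.isInternal.submodule_iSup_eq_top

/-- A morphism of graded modules: a module homomorphism of degree `0`. -/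
@[ext]
structure Hom (M N : GrProj k w) where
  /-- the underlying homomorphism -/
  lin : M →ₗ[Zigzag k n] N
  map_mem : ∀ {g : G} {m : M}, m ∈ M.piece g → lin m ∈ N.piece g

instance : Category.{u} (GrProj k w) where
  Hom M N := Hom M N
  id M := ⟨LinearMap.id, fun h => h⟩
  comp f g := ⟨g.lin ∘ₗ f.lin, fun h => g.map_mem (f.map_mem h)⟩

variable {M N L : GrProj k w}

/-- The underlying homomorphism of a morphism. -/
def toLin (f : M ⟶ N) : M →ₗ[Zigzag k n] N := Hom.lin f

lemma toLin_mem (f : M ⟶ N) {g : G} {m : M} (hm : m ∈ M.piece g) : toLin f m ∈ N.piece g :=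
  Hom.map_mem f hm

/-- Morphisms from homomorphisms of degree `0`. -/
def ofLin (f : M →ₗ[Zigzag k n] N) (hf : ∀ {g : G} {m : M}, m ∈ M.piece g → f m ∈ N.piece g) :
    M ⟶ N := Hom.mk f hf

@[simp] lemma toLin_ofLin (f : M →ₗ[Zigzag k n] N)
    (hf : ∀ {g : G} {m : M}, m ∈ M.piece g → f m ∈ N.piece g) : toLin (ofLin f hf) = f := rfl

@[simp] lemma toLin_id : toLin (𝟙 M) = LinearMap.id := rfl

@[simp] lemma toLin_comp (f : M ⟶ N) (g : N ⟶ L) : toLin (f ≫ g) = toLin g ∘ₗ toLin f := rfl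

@[ext] lemma hom_ext {f g : M ⟶ N} (h : ∀ m, toLin f m = toLin g m) : f = g :=
  Hom.ext (LinearMap.ext h)

lemma toLin_injective : Function.Injective (toLin : (M ⟶ N) → _) := fun _ _ h => Hom.ext h

instance : Zero (M ⟶ N) := ⟨ofLin 0 fun _ => Submodule.zero_mem _⟩
instance : Add (M ⟶ N) := ⟨fun f g => ofLin (toLin f + toLin g) fun h =>
  Submodule.add_mem _ (toLin_mem f h) (toLin_mem g h)⟩
instance : Neg (M ⟶ N) := ⟨fun f => ofLin (-toLin f) fun h =>
  Submodule.neg_mem _ (toLin_mem f h)⟩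
instance : Sub (M ⟶ N) := ⟨fun f g => ofLin (toLin f - toLin g) fun h =>
  Submodule.sub_mem _ (toLin_mem f h) (toLin_mem g h)⟩

lemma smul_comm_base (c : k) (a : Zigzag k n) (m : M) : c • a • m = a • c • m := by
  rw [← smul_assoc, ← one_smul (Zigzag k n) m, ← smul_assoc c (1 : Zigzag k n) m, smul_smul,
    smul_smul]
  simp

instance (M : GrProj k w) : SMulCommClass (Zigzag k n) k M :=
  ⟨fun a c m => (smul_comm_base c a m).symm⟩

lemma toLin_smul (f : M ⟶ N) (c : k) (m : M) : toLin f (c • m) = c • toLin f m :=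
  (toLin f).map_smul_of_tower c m

instance : SMul k (M ⟶ N) := ⟨fun c f => ofLin (c • toLin f) fun h =>
  Submodule.smul_mem _ c (toLin_mem f h)⟩
instance : SMul ℕ (M ⟶ N) := ⟨fun c f => ofLin (c • toLin f) fun h =>
  Submodule.smul_of_tower_mem _ c (toLin_mem f h)⟩
instance : SMul ℤ (M ⟶ N) := ⟨fun c f => ofLin (c • toLin f) fun h =>
  Submodule.smul_of_tower_mem _ c (toLin_mem f h)⟩

instance : AddCommGroup (M ⟶ N) :=
  Function.Injective.addCommGroup toLin toLin_injective rfl (fun _ _ => rfl) (fun _ => rfl)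
    (fun _ _ => rfl) (fun _ _ => rfl) (fun _ _ => rfl)

@[simp] lemma toLin_zero : toLin (0 : M ⟶ N) = 0 := rfl
@[simp] lemma toLin_add (f g : M ⟶ N) : toLin (f + g) = toLin f + toLin g := rfl
@[simp] lemma toLin_smul_hom (c : k) (f : M ⟶ N) : toLin (c • f) = c • toLin f := rfl

instance : Module k (M ⟶ N) :=
  Function.Injective.module k ⟨⟨toLin, rfl⟩, fun _ _ => rfl⟩ toLin_injective (fun _ _ => rfl)

instance : Preadditive (GrProj k w) where
  add_comp _ _ _ f f' g := by ext m; simp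
  comp_add _ _ _ f g g' := by ext m; simp

instance : Linear k (GrProj k w) where
  smul_comp _ _ _ c f g := by ext m; simp
  comp_smul _ _ _ f c g := by ext m; simp

/-- The zero module. -/
def zeroObj (k : Type u) [Field k] (w : Weight n G) : GrProj k w where
  carrier := PUnit
  piece _ := ⊤
  isInternal := isInternal_of_coact k _ (by simp) 0 (fun _ _ _ => by ext)
  smul_mem _ _ := trivial

instance : HasZeroObject (GrProj k w) :=
  ⟨zeroObj k w, (IsZero.iff_id_eq_zero _).2 (by ext m; rfl)⟩

/-- The direct sum of two graded modules. -/
def prod (M N : GrProj k w) : GrProj k w where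
  carrier := M × N
  piece g := (M.piece g).prod (N.piece g)
  isInternal := by
    obtain ⟨ρ, hρ⟩ := exists_coact k M.isInternal
    obtain ⟨σ, hσ⟩ := exists_coact k N.isInternal
    refine isInternal_of_coact k _ ?_
      ((Finsupp.mapRange.linearMap (LinearMap.inl k M N)) ∘ₗ ρ ∘ₗ LinearMap.fst k M N +
        (Finsupp.mapRange.linearMap (LinearMap.inr k M N)) ∘ₗ σ ∘ₗ LinearMap.snd k M N) ?_
    · have h₁ : (⊤ : Submodule k M) ≤
          (⨆ g, (M.piece g).prod (N.piece g)).comap (LinearMap.inl k M N) := by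
        rw [← M.iSup_piece]
        exact iSup_le fun g m hm => Submodule.mem_iSup_of_mem g ⟨hm, Submodule.zero_mem _⟩
      have h₂ : (⊤ : Submodule k N) ≤
          (⨆ g, (M.piece g).prod (N.piece g)).comap (LinearMap.inr k M N) := by
        rw [← N.iSup_piece]
        exact iSup_le fun g m hm => Submodule.mem_iSup_of_mem g ⟨Submodule.zero_mem _, hm⟩
      rw [eq_top_iff]
      rintro ⟨a, b⟩ -
      have := Submodule.add_mem (⨆ g, (M.piece g).prod (N.piece g))
        (h₁ (x := a) trivial) (h₂ (x := b) trivial)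
      simpa using this
    · rintro g ⟨a, b⟩ ⟨ha, hb⟩
      simp [hρ g a ha, hσ g b hb, ← Finsupp.single_add]
  smul_mem ha hm := ⟨M.smul_mem ha hm.1, N.smul_mem ha hm.2⟩

instance : HasBinaryBiproducts (GrProj k w) where
  has_binary_biproduct M N := hasBinaryBiproduct_of_total
    { pt := prod M N
      fst := ofLin (LinearMap.fst _ M N) fun h => h.1
      snd := ofLin (LinearMap.snd _ M N) fun h => h.2
      inl := ofLin (LinearMap.inl _ M N) fun h => ⟨h, Submodule.zero_mem _⟩
      inr := ofLin (LinearMap.inr _ M N) fun h => ⟨Submodule.zero_mem _, h⟩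
      inl_fst := by ext; rfl
      inl_snd := by ext; rfl
      inr_fst := by ext; rfl
      inr_snd := by ext; rfl } (by
      ext m
      exact Prod.ext (add_zero _) (zero_add _))

/-- If the grading group is trivial, a grading is no extra datum. -/
lemma piece_eq_top [Subsingleton G] (M : GrProj k w) (g : G) : M.piece g = ⊤ := by
  rw [eq_top_iff, ← M.iSup_piece]
  exact iSup_le fun h => by rw [Subsingleton.elim h g]

/-- The graded module `M⟨s⟩`, with `M⟨s⟩_g = M_{g + s}`. -/
def shiftObj (s : G) (M : GrProj k w) : GrProj k w where
  carrier := M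
  piece g := M.piece (g + s)
  isInternal := by
    obtain ⟨ρ, hρ⟩ := exists_coact k M.isInternal
    refine isInternal_of_coact k _ ?_ (Finsupp.lmapDomain M k (fun g => g - s) ∘ₗ ρ) ?_
    · rw [← M.iSup_piece]
      exact (Equiv.addRight s).iSup_comp (g := M.piece)
    · intro g m hm
      simp [hρ _ m hm]
  smul_mem {g h a m} ha hm := by
    rw [add_assoc]; exact M.smul_mem ha hm

/-- The grading shift functor `⟨s⟩`. -/
def shift (s : G) : GrProj k w ⥤ GrProj k w where
  obj M := shiftObj s M
  map {M N} f := ofLin (M := shiftObj s M) (N := shiftObj s N) 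
    (toLin (M := M) (N := N) f) (toLin_mem (M := M) (N := N) f)

instance (s : G) : (shift (k := k) (w := w) s).Additive where
  map_add := rfl

/-- The indecomposable projective module `P_i = A e_i`, as a left ideal. -/
abbrev leftIdeal (k : Type u) [Field k] (i : Fin n) : Submodule (Zigzag k n) (Zigzag k n) :=
  Submodule.span (Zigzag k n) {idem k i}

/-- The subspace `e_i M = {m | e_i m = m}` of a module `M`. -/
def corner (M : GrProj k w) (i : Fin n) : Submodule k M where
  carrier := {m | idem k i • m = m}
  zero_mem' := smul_zero _
  add_mem' ha hb := (smul_add _ _ _).trans (congrArg₂ _ ha hb)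
  smul_mem' _ _ hm := (smul_comm _ _ _).trans (congrArg _ hm)

lemma mem_corner {M : GrProj k w} {i : Fin n} {m : M} : m ∈ M.corner i ↔ idem k i • m = m :=
  Iff.rfl

instance (M : GrProj k w) : Module.Finite k M := Module.Finite.trans (Zigzag k n) M

lemma mem_leftIdeal {i : Fin n} {a : Zigzag k n} : a ∈ leftIdeal k i ↔ a * idem k i = a := by
  rw [Submodule.mem_span_singleton]
  constructor
  · rintro ⟨b, rfl⟩
    rw [smul_eq_mul, mul_assoc, idem_mul_idem]
  · intro h
    exact ⟨a, h⟩

/-- The projection `A ⟶ A e_i`, `a ↦ a e_i`. -/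
def inP (k : Type u) [Field k] (i : Fin n) : Zigzag k n →ₗ[Zigzag k n] leftIdeal k i :=
  (LinearMap.toSpanSingleton (Zigzag k n) (Zigzag k n) (idem k i)).codRestrict _
    (fun a => Submodule.mem_span_singleton.2 ⟨a, rfl⟩)

/-- The projection `M ⟶ e_i M`, `m ↦ e_i m`. -/
def inC (M : GrProj k w) (i : Fin n) : M →ₗ[k] M.corner i where
  toFun m := ⟨idem k i • m, by rw [mem_corner, smul_smul, idem_mul_idem]⟩
  map_add' a b := Subtype.ext (smul_add _ _ _)
  map_smul' c m := Subtype.ext (smul_comm _ _ _)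

lemma coe_inP (i : Fin n) (a : Zigzag k n) : (inP k i a : Zigzag k n) = a * idem k i := rfl

lemma coe_inC (M : GrProj k w) (i : Fin n) (m : M) : (inC M i m : M) = idem k i • m := rfl

lemma inP_coe (i : Fin n) (p : leftIdeal k i) : inP k i p = p :=
  Subtype.ext (mem_leftIdeal.1 p.2)

lemma inC_coe (M : GrProj k w) (i : Fin n) (v : M.corner i) : inC M i v = v :=
  Subtype.ext v.2

instance (i : Fin n) : Module.Projective (Zigzag k n) (leftIdeal k i) :=
  Module.Projective.of_split (leftIdeal k i).subtype (inP k i) (LinearMap.ext (inP_coe i))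

instance (i : Fin n) : Module.Finite k (leftIdeal k i) :=
  Module.Finite.of_injective ((leftIdeal k i).subtype.restrictScalars k) Subtype.val_injective

instance (M : GrProj k w) (i : Fin n) :
    Module.Finite (Zigzag k n) (leftIdeal k i ⊗[k] M.corner i) :=
  Module.Finite.of_restrictScalars_finite k _ _

/-- The component of degree `g` of `A e_i ⊗ e_i M`. -/
def tensorPiece (M : GrProj k w) (i : Fin n) (g : G) :
    Submodule k (leftIdeal k i ⊗[k] M.corner i) :=
  Submodule.span k {t | ∃ (a b : G) (p : leftIdeal k i) (v : M.corner i), a + b = g ∧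
    (p : Zigzag k n) ∈ w.piece k a ∧ (v : M) ∈ M.piece b ∧ t = p ⊗ₜ v}

lemma tmul_mem_tensorPiece (M : GrProj k w) (i : Fin n) {a b : G} {p : Zigzag k n} {v : M}
    (hp : p ∈ w.piece k a) (hv : v ∈ M.piece b) :
    inP k i p ⊗ₜ inC M i v ∈ tensorPiece M i (a + b) := by
  refine Submodule.subset_span ⟨a, b, _, _, rfl, ?_, ?_, rfl⟩
  · have := mul_mem_piece w k hp (gen_mem_piece w k (.e i))
    rwa [show w.deg (.e i) = 0 from rfl, add_zero] at this
  · have := M.smul_mem (gen_mem_piece w k (.e i)) hv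
    rwa [show w.deg (.e i) = 0 from rfl, zero_add] at this

lemma iSup_tensorPiece (M : GrProj k w) (i : Fin n) : ⨆ g, tensorPiece M i g = ⊤ := by
  have key : ∀ (a : Zigzag k n) (m : M), inP k i a ⊗ₜ inC M i m ∈ ⨆ g, tensorPiece M i g := by
    intro a m
    have ha : a ∈ ⨆ g, w.piece k g := by rw [ZigzagFree.iSup_piece]; trivial
    have hm : m ∈ ⨆ g, M.piece g := by rw [M.iSup_piece]; trivial
    induction ha using Submodule.iSup_induction' with
    | mem g a ha =>
      induction hm using Submodule.iSup_induction' with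
      | mem h m hm => exact Submodule.mem_iSup_of_mem _ (tmul_mem_tensorPiece M i ha hm)
      | zero => simp
      | add x y _ _ hx hy => rw [map_add, tmul_add]; exact Submodule.add_mem _ hx hy
    | zero => simp
    | add x y _ _ hx hy => rw [map_add, add_tmul]; exact Submodule.add_mem _ hx hy
  rw [eq_top_iff]
  rintro t -
  induction t using TensorProduct.induction_on with
  | zero => exact Submodule.zero_mem _
  | tmul p v => rw [← inP_coe i p, ← inC_coe M i v]; exact key _ _
  | add x y hx hy => exact Submodule.add_mem _ hx hy

/-- The component projections of the zigzag algebra, as a linear map. -/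
def coactLin (k : Type u) [Field k] (w : Weight n G) : Zigzag k n →ₗ[k] G →₀ Zigzag k n where
  toFun a := (w.coact k a).coeff
  map_add' a b := by simp
  map_smul' c a := by simp

/-- The homogeneous components do form a grading of the zigzag algebra. -/
lemma isInternal_piece (k : Type u) [Field k] (w : Weight n G) :
    DirectSum.IsInternal (w.piece k) :=
  isInternal_of_coact k _ (ZigzagFree.iSup_piece w k) (coactLin k w) fun g a ha => by
    simp [coactLin, coact_of_mem w k ha]

lemma isInternal_tensorPiece (M : GrProj k w) (i : Fin n) :
    DirectSum.IsInternal (tensorPiece M i) := by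
  obtain ⟨ρ, hρ⟩ := exists_coact k M.isInternal
  let σ : (leftIdeal k i ⊗[k] M.corner i) →ₗ[k] G →₀ (leftIdeal k i ⊗[k] M.corner i) :=
    Finsupp.lmapDomain _ k (fun x : G × G => x.1 + x.2) ∘ₗ
      Finsupp.mapRange.linearMap
        (TensorProduct.map ((inP k i).restrictScalars k) (inC M i)) ∘ₗ
      (finsuppTensorFinsupp k k (Zigzag k n) M G G).toLinearMap ∘ₗ
      TensorProduct.map (coactLin k w ∘ₗ (leftIdeal k i).subtype.restrictScalars k)
        (ρ ∘ₗ (M.corner i).subtype)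
  refine isInternal_of_coact k _ (iSup_tensorPiece M i) σ ?_
  intro g t ht
  induction ht using Submodule.span_induction with
  | mem t h =>
    obtain ⟨a, b, p, v, rfl, hp, hv, rfl⟩ := h
    have h₁ : coactLin k w p = Finsupp.single a (p : Zigzag k n) := by
      simp [coactLin, coact_of_mem w k hp]
    simp [σ, h₁, hρ b v hv, inP_coe, inC_coe]
  | zero => simp
  | add x y _ _ hx hy => rw [map_add, hx, hy, Finsupp.single_add]
  | smul c x _ hx => rw [map_smul, hx, Finsupp.smul_single]

/-- The graded module `A e_i ⊗_k e_i M = (A e_i ⊗_k e_i A) ⊗_A M`. -/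
def tensorObj (i : Fin n) (M : GrProj k w) : GrProj k w where
  carrier := leftIdeal k i ⊗[k] M.corner i
  piece := tensorPiece M i
  isInternal := isInternal_tensorPiece M i
  smul_mem {g h a m} ha hm := by
    induction hm using Submodule.span_induction with
    | mem t ht =>
      obtain ⟨c, d, p, v, rfl, hp, hv, rfl⟩ := ht
      rw [TensorProduct.smul_tmul', ← add_assoc]
      exact Submodule.subset_span ⟨g + c, d, a • p, v, rfl, mul_mem_piece w k ha hp, hv, rfl⟩
    | zero => rw [smul_zero]; exact Submodule.zero_mem _
    | add x y _ _ hx hy => rw [smul_add]; exact Submodule.add_mem _ hx hy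
    | smul c x _ hx => rw [smul_comm]; exact Submodule.smul_mem _ _ hx

/-- The map `e_i M ⟶ e_i N` induced by a morphism. -/
def cornerMap (i : Fin n) (f : M ⟶ N) : M.corner i →ₗ[k] N.corner i :=
  ((toLin f).restrictScalars k).restrict fun m hm => by
    rw [mem_corner] at *
    rw [LinearMap.restrictScalars_apply, ← map_smul, hm]

/-- The module homomorphism `A e_i ⊗ e_i M ⟶ A e_i ⊗ e_i N` induced by a morphism. -/
def tensorLin (i : Fin n) (f : M ⟶ N) :
    leftIdeal k i ⊗[k] M.corner i →ₗ[Zigzag k n] leftIdeal k i ⊗[k] N.corner i :=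
  TensorProduct.AlgebraTensorModule.map LinearMap.id (cornerMap i f)

lemma tensorLin_mem (i : Fin n) (f : M ⟶ N) (g : G) :
    tensorPiece M i g ≤ (tensorPiece N i g).comap ((tensorLin i f).restrictScalars k) := by
  refine Submodule.span_le.2 ?_
  rintro _ ⟨c, d, p, v, rfl, hp, hv, rfl⟩
  exact Submodule.subset_span ⟨c, d, p, cornerMap i f v, rfl, hp, toLin_mem f hv, rfl⟩

/-- The morphism `A e_i ⊗ e_i M ⟶ A e_i ⊗ e_i N` induced by a morphism. -/
def tensorMap (i : Fin n) (f : M ⟶ N) : tensorObj i M ⟶ tensorObj i N :=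
  ofLin (M := tensorObj i M) (N := tensorObj i N) (tensorLin i f)
    (fun {g _} hm => tensorLin_mem i f g hm)

lemma tensorMap_tmul (i : Fin n) (f : M ⟶ N) (p : leftIdeal k i) (v : M.corner i) :
    toLin (tensorMap i f) (p ⊗ₜ v : leftIdeal k i ⊗[k] M.corner i) =
      (p ⊗ₜ cornerMap i f v : leftIdeal k i ⊗[k] N.corner i) := rfl

/-- Morphisms out of `A e_i ⊗ e_i M` are determined on pure tensors. -/
lemma tensor_hom_ext (i : Fin n) {f g : tensorObj i M ⟶ N}
    (h : ∀ (p : leftIdeal k i) (v : M.corner i),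
      toLin f (p ⊗ₜ v : leftIdeal k i ⊗[k] M.corner i) =
        toLin g (p ⊗ₜ v : leftIdeal k i ⊗[k] M.corner i)) : f = g := by
  refine hom_ext fun t => ?_
  change leftIdeal k i ⊗[k] M.corner i at t
  induction t using TensorProduct.induction_on with
  | zero => exact (map_zero (toLin f)).trans (map_zero (toLin g)).symm
  | tmul p v => exact h p v
  | add x y hx hy =>
    exact (map_add (toLin f) x y).trans ((congrArg₂ _ hx hy).trans (map_add (toLin g) x y).symm)

/-- The functor `M ↦ (A e_i ⊗_k e_i A) ⊗_A M = A e_i ⊗_k e_i M`. -/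
def tensor (i : Fin n) : GrProj k w ⥤ GrProj k w where
  obj M := tensorObj i M
  map f := tensorMap i f
  map_id _ := tensor_hom_ext i fun _ _ => rfl
  map_comp _ _ := tensor_hom_ext i fun _ _ => rfl

instance (i : Fin n) : (tensor (k := k) (w := w) i).Additive where
  map_add {_ _ f g} := tensor_hom_ext i fun p v =>
    TensorProduct.tmul_add p (cornerMap i f v) (cornerMap i g v)

/-- The module homomorphism `f_i : A e_i ⊗ e_i M ⟶ M`, `p ⊗ v ↦ p v`. -/
def evalLin (i : Fin n) (M : GrProj k w) : leftIdeal k i ⊗[k] M.corner i →ₗ[Zigzag k n] M :=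
  TensorProduct.AlgebraTensorModule.lift
    { toFun := fun p =>
        { toFun := fun v => (p : Zigzag k n) • (v : M)
          map_add' := fun _ _ => smul_add _ _ _
          map_smul' := fun _ _ => smul_comm _ _ _ }
      map_add' := fun _ _ => LinearMap.ext fun _ => add_smul _ _ _
      map_smul' := fun _ _ => LinearMap.ext fun _ => mul_smul _ _ _ }

lemma evalLin_mem (i : Fin n) (M : GrProj k w) (g : G) :
    tensorPiece M i g ≤ (M.piece g).comap ((evalLin i M).restrictScalars k) := by
  refine Submodule.span_le.2 ?_
  rintro _ ⟨c, d, p, v, rfl, hp, hv, rfl⟩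
  exact M.smul_mem hp hv

/-- The morphism `f_i : A e_i ⊗ e_i M ⟶ M`, `p ⊗ v ↦ p v`. -/
def evalHom (i : Fin n) (M : GrProj k w) : tensorObj i M ⟶ M :=
  ofLin (M := tensorObj i M) (evalLin i M) (fun {g _} hm => evalLin_mem i M g hm)

lemma evalHom_tmul (i : Fin n) (M : GrProj k w) (p : leftIdeal k i) (v : M.corner i) :
    toLin (evalHom i M) (p ⊗ₜ v : leftIdeal k i ⊗[k] M.corner i) = (p : Zigzag k n) • (v : M) :=
  rfl

/-- The natural transformation `f_i`. -/
def evalNat (i : Fin n) : tensor (k := k) (w := w) i ⟶ 𝟭 _ where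
  app M := evalHom i M
  naturality _ _ f := tensor_hom_ext i fun p v => (map_smul (toLin f) p.1 v.1).symm

/-- The arrow `arr c i j`, extended by `0` to `i = j`. -/
def arrow (k : Type u) [Field k] (c : Edge) (i j : Fin n) : Zigzag k n :=
  if h : i ≠ j then gen k (.arr c i j h) else 0

/-- The linear map underlying `g_i`:
`m ↦ z ⊗ e_i m + e_i ⊗ z m + ∑ a* ⊗ a m`, the sum over all arrows `a` out of the vertex `i`. -/
def coevLin (i : Fin n) (M : GrProj k w) : M →ₗ[k] leftIdeal k i ⊗[k] M.corner i where
  toFun m := inP k i (gen k (.z i)) ⊗ₜ inC M i m + inP k i (idem k i) ⊗ₜ inC M i (gen k (.z i) • m) +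
    ∑ c : Edge, ∑ j : Fin n, inP k i (arrow k c j i) ⊗ₜ inC M i (arrow k c i j • m)
  map_add' a b := by
    simp only [map_add, smul_add, tmul_add, Finset.sum_add_distrib]
    abel
  map_smul' r a := by
    simp only [map_smul, smul_comm _ r, tmul_smul, Finset.smul_sum, smul_add, RingHom.id_apply]

lemma coevLin_apply (i : Fin n) (M : GrProj k w) (m : M) : coevLin i M m =
    inP k i (gen k (.z i)) ⊗ₜ inC M i m + inP k i (idem k i) ⊗ₜ inC M i (gen k (.z i) • m) +
    ∑ c : Edge, ∑ j : Fin n, inP k i (arrow k c j i) ⊗ₜ inC M i (arrow k c i j • m) := rfl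

lemma inC_idem_smul (i j : Fin n) (M : GrProj k w) (m : M) :
    inC M i (idem k j • m) = if j = i then inC M i m else 0 := by
  refine Subtype.ext ?_
  rw [coe_inC, smul_smul]
  split_ifs with h
  · rw [h, idem_mul_idem, coe_inC]
  · rw [idem_mul_idem_ne k (Ne.symm h), zero_smul]; rfl

lemma inC_gen_smul (s : Gen n) (i : Fin n) (hs : s.src ≠ i) (M : GrProj k w) (m : M) :
    inC M i (gen k s • m) = 0 := by
  rw [← idem_src_mul k s, mul_smul, inC_idem_smul, if_neg hs]

lemma inP_gen (s : Gen n) (i : Fin n) (hs : s.tgt ≠ i) : inP k i (gen k s) = 0 := by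
  refine Subtype.ext ?_
  rw [coe_inP, ← mul_idem_tgt k s, mul_assoc, idem_mul_idem_ne k hs, mul_zero]; rfl

lemma coevLin_smul_gen (i : Fin n) (M : GrProj k w) (s : Gen n) (m : M) :
    coevLin i M (gen k s • m) = gen k s • coevLin i M m := by
  rw [coevLin_apply, coevLin_apply]
  simp only [smul_add, Finset.smul_sum, TensorProduct.smul_tmul', ← map_smul, smul_smul,
    smul_eq_mul]
  cases s with
  | e l =>
    congr 1
    · congr 1
      · rw [inC_idem_smul]
        split_ifs with h
        · rw [h, idem_mul_z]
        · rw [gen_mul_gen_of_ne k (s := .e l) (t := .z i) h]; simp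
      · by_cases h : l = i
        · rw [h, z_mul_idem, idem_mul_idem]
        · rw [gen_mul_gen_of_ne k (s := .z i) (t := .e l) (Ne.symm h), idem_mul_idem_ne k h]; simp
    · refine Finset.sum_congr rfl fun c _ => Finset.sum_congr rfl fun j _ => ?_
      unfold arrow
      split_ifs with h h'
      · by_cases hl : l = j
        · subst hl
          rw [arr_mul_idem, idem_mul_arr]
        · rw [gen_mul_gen_of_ne k (s := .arr c i j h') (t := .e l) (Ne.symm hl),
            gen_mul_gen_of_ne k (s := .e l) (t := .arr c j i h) hl]
          simp
      · exact absurd h.symm h'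
      · simp
      · simp
  | z l =>
    have h₁ : ∀ (c : Edge) (j : Fin n), gen k (.z l) * arrow k c j i = 0 := by
      intro c j
      unfold arrow
      split_ifs with h
      · by_cases hl : l = j
        · subst hl; exact z_mul_arr k c h
        · exact gen_mul_gen_of_ne k (s := .z l) (t := .arr c j i h) hl
      · simp
    have h₂ : ∀ (c : Edge) (j : Fin n), arrow k c i j * gen k (.z l) = 0 := by
      intro c j
      unfold arrow
      split_ifs with h
      · by_cases hl : l = j
        · subst hl; exact arr_mul_z k c h
        · exact gen_mul_gen_of_ne k (s := .arr c i j h) (t := .z l) (Ne.symm hl)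
      · simp
    simp only [h₁, h₂, zero_smul, map_zero, tmul_zero, zero_tmul, Finset.sum_const_zero, add_zero]
    by_cases hl : l = i
    · subst hl
      rw [z_mul_z, z_mul_idem]
      simp
    · rw [gen_mul_gen_of_ne k (s := .z l) (t := .z i) hl,
        gen_mul_gen_of_ne k (s := .z i) (t := .z l) (Ne.symm hl),
        gen_mul_gen_of_ne k (s := .z l) (t := .e i) hl, inC_gen_smul (.z l) i hl]
      simp
  | arr d p q h =>
    have h₁ : gen k (.arr d p q h) * gen k (.z i) = 0 := by
      by_cases hq : q = i
      · subst hq; exact arr_mul_z k d h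
      · exact gen_mul_gen_of_ne k (s := .arr d p q h) (t := .z i) hq
    have h₂ : gen k (.z i) * gen k (.arr d p q h) = 0 := by
      by_cases hp : i = p
      · subst hp; exact z_mul_arr k d h
      · exact gen_mul_gen_of_ne k (s := .z i) (t := .arr d p q h) hp
    have hL : ∑ c : Edge, ∑ j : Fin n, inP k i (arrow k c j i) ⊗ₜ[k]
        inC M i ((arrow k c i j * gen k (.arr d p q h)) • m) =
        inP k i (gen k (.arr d p q h)) ⊗ₜ[k] inC M i (gen k (.z i) • m) := by
      have key : ∀ (c : Edge) (j : Fin n), arrow k c i j * gen k (.arr d p q h) =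
          if c = d ∧ j = p ∧ q = i then gen k (.z i) else 0 := by
        intro c j
        unfold arrow
        split_ifs with hij hc hc
        · obtain ⟨rfl, rfl, rfl⟩ := hc
          exact arr_mul_star k c hij
        · by_cases hj : j = p
          · subst hj
            by_cases hq : q = i
            · subst hq
              exact arr_mul_star_ne k hij fun hcd => hc ⟨hcd, rfl, rfl⟩
            · exact arr_mul_arr_ne k c d hij h (Ne.symm hq)
          · exact gen_mul_gen_of_ne k (s := .arr c i j hij) (t := .arr d p q h) hj
        · obtain ⟨rfl, rfl, rfl⟩ := hc
          exact absurd (not_not.1 hij).symm h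
        · simp
      by_cases hq : q = i
      · subst hq
        rw [Finset.sum_eq_single d, Finset.sum_eq_single p]
        · rw [key, if_pos ⟨rfl, rfl, rfl⟩]
          unfold arrow
          rw [dif_pos h]
        · intro j _ hj
          rw [key, if_neg (by tauto)]; simp
        · simp
        · intro c _ hc
          refine Finset.sum_eq_zero fun j _ => ?_
          rw [key, if_neg (by tauto)]; simp
        · simp
      · rw [inP_gen (.arr d p q h) i hq, zero_tmul]
        refine Finset.sum_eq_zero fun c _ => Finset.sum_eq_zero fun j _ => ?_
        rw [key, if_neg (by tauto)]; simp
    have hR : ∑ c : Edge, ∑ j : Fin n, inP k i (gen k (.arr d p q h) * arrow k c j i) ⊗ₜ[k]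
        inC M i (arrow k c i j • m) =
        inP k i (gen k (.z i)) ⊗ₜ[k] inC M i (gen k (.arr d p q h) • m) := by
      have key : ∀ (c : Edge) (j : Fin n), gen k (.arr d p q h) * arrow k c j i =
          if c = d ∧ j = q ∧ p = i then gen k (.z i) else 0 := by
        intro c j
        unfold arrow
        split_ifs with hji hc hc
        · obtain ⟨rfl, rfl, rfl⟩ := hc
          exact arr_mul_star k c h
        · by_cases hj : q = j
          · subst hj
            by_cases hp : p = i
            · subst hp
              exact arr_mul_star_ne k h fun hcd => hc ⟨hcd.symm, rfl, rfl⟩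
            · exact arr_mul_arr_ne k d c h hji hp
          · exact gen_mul_gen_of_ne k (s := .arr d p q h) (t := .arr c j i hji) hj
        · obtain ⟨rfl, rfl, rfl⟩ := hc
          exact absurd (not_not.1 hji).symm h
        · simp
      by_cases hp : p = i
      · subst hp
        rw [Finset.sum_eq_single d, Finset.sum_eq_single q]
        · rw [key, if_pos ⟨rfl, rfl, rfl⟩]
          unfold arrow
          rw [dif_pos h]
        · intro j _ hj
          rw [key, if_neg (by tauto)]; simp
        · simp
        · intro c _ hc
          refine Finset.sum_eq_zero fun j _ => ?_
          rw [key, if_neg (by tauto)]; simp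
        · simp
      · rw [inC_gen_smul (.arr d p q h) i hp, tmul_zero]
        refine Finset.sum_eq_zero fun c _ => Finset.sum_eq_zero fun j _ => ?_
        rw [key, if_neg (by tauto)]; simp
    have h₃ : inP k i (gen k (.arr d p q h) * idem k i) = inP k i (gen k (.arr d p q h)) := by
      refine Subtype.ext ?_
      rw [coe_inP, coe_inP, mul_assoc, idem_mul_idem]
    rw [h₁, h₂, hL, hR, h₃]
    simp [add_comm]

/-- The module homomorphism `g_i : M ⟶ A e_i ⊗ e_i M`. -/
def coevALin (i : Fin n) (M : GrProj k w) : M →ₗ[Zigzag k n] leftIdeal k i ⊗[k] M.corner i where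
  toFun := coevLin i M
  map_add' := map_add _
  map_smul' a m := by
    have ha : a ∈ Submodule.span k (Set.range (gen k : Gen n → Zigzag k n)) := by
      rw [span_gen]; trivial
    rw [RingHom.id_apply]
    induction ha using Submodule.span_induction with
    | mem a h => obtain ⟨s, rfl⟩ := h; exact coevLin_smul_gen i M s m
    | zero => simp
    | add a b _ _ ha hb => rw [add_smul, map_add, ha, hb, add_smul]
    | smul c a _ ha => rw [smul_assoc, map_smul, ha, smul_assoc]

lemma arrow_mem_piece (c : Edge) (i j : Fin n) : arrow k c i j ∈ w.piece k (w.arr c i j) := by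
  unfold arrow
  split_ifs with h
  · exact gen_mem_piece w k (.arr c i j h)
  · exact Submodule.zero_mem _

lemma coevLin_mem (i : Fin n) (M : GrProj k w) {g : G} {m : M} (hm : m ∈ M.piece g) :
    coevLin i M m ∈ tensorPiece M i (g + w.z) := by
  rw [coevLin_apply]
  refine Submodule.add_mem _ (Submodule.add_mem _ ?_ ?_)
    (Submodule.sum_mem _ fun c _ => Submodule.sum_mem _ fun j _ => ?_)
  · rw [add_comm]
    exact tmul_mem_tensorPiece M i (gen_mem_piece w k (.z i)) hm
  · have := tmul_mem_tensorPiece M i (gen_mem_piece w k (.e i))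
      (M.smul_mem (gen_mem_piece w k (.z i)) hm)
    rwa [show w.deg (.e i) = 0 from rfl, zero_add, add_comm] at this
  · by_cases h : i = j
    · simp [arrow, h]
    · have := tmul_mem_tensorPiece M i (arrow_mem_piece (w := w) (k := k) c j i)
        (M.smul_mem (arrow_mem_piece (w := w) (k := k) c i j) hm)
      rwa [← add_assoc, w.arr_add c j i (Ne.symm h), add_comm] at this

/-- The morphism `g_i : M ⟶ (A e_i ⊗ e_i M)⟨deg z⟩`. -/
def coevHom (i : Fin n) (M : GrProj k w) : M ⟶ shiftObj w.z (tensorObj i M) :=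
  ofLin (N := shiftObj w.z (tensorObj i M)) (coevALin i M) (fun hm => coevLin_mem i M hm)

lemma cornerMap_inC (i : Fin n) (f : M ⟶ N) (m : M) :
    cornerMap i f (inC M i m) = inC N i (toLin f m) :=
  Subtype.ext (map_smul (toLin f) _ _)

lemma tensorLin_coevLin (i : Fin n) (f : M ⟶ N) (m : M) :
    tensorLin i f (coevLin i M m) = coevLin i N (toLin f m) := by
  rw [coevLin_apply, coevLin_apply]
  simp only [map_add, map_sum, tensorLin, AlgebraTensorModule.map_tmul, LinearMap.id_apply,
    cornerMap_inC, map_smul]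

/-- The natural transformation `g_i`. -/
def coevNat (i : Fin n) : 𝟭 (GrProj k w) ⟶ tensor i ⋙ shift w.z where
  app M := coevHom i M
  naturality _ _ f := hom_ext fun m => (tensorLin_coevLin i f m).symm

end GrProj

end Modules

section Aut

variable (D : Type*) [Category D]

instance autSetoid : Setoid (D ≌ D) where
  r e f := Nonempty (e.functor ≅ f.functor)
  iseqv := ⟨fun _ => ⟨Iso.refl _⟩, fun ⟨a⟩ => ⟨a.symm⟩, fun ⟨a⟩ ⟨b⟩ => ⟨a.trans b⟩⟩

/-- The isomorphism classes of auto-equivalences of `D`. -/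
def AutClass := Quotient (autSetoid D)

variable {D}

/-- The isomorphism class of an auto-equivalence. -/
def AutClass.mk (e : D ≌ D) : AutClass D := Quotient.mk _ e

/-- The class `c` contains (an auto-equivalence isomorphic to) the functor `F`. -/
def AutClass.Contains (c : AutClass D) (F : D ⥤ D) : Prop :=
  ∃ e : D ≌ D, AutClass.mk e = c ∧ Nonempty (e.functor ≅ F)

/-- The group structure given by composition, `[E] * [F] = [E ∘ F]`. -/
instance : Group (AutClass D) where
  mul := Quotient.map₂ (fun e f => f.trans e)
    fun _ _ ⟨a⟩ _ _ ⟨b⟩ => ⟨NatIso.hcomp b a⟩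
  one := AutClass.mk CategoryTheory.Equivalence.refl
  inv := Quotient.map (fun e => e.symm) fun _ _ ⟨a⟩ => ⟨Iso.isoInverseOfIsoFunctor a⟩
  mul_assoc := by
    rintro ⟨a⟩ ⟨b⟩ ⟨c⟩
    exact Quotient.sound ⟨Iso.refl _⟩
  one_mul := by
    rintro ⟨a⟩
    exact Quotient.sound ⟨Functor.rightUnitor _⟩
  mul_one := by
    rintro ⟨a⟩
    exact Quotient.sound ⟨Functor.leftUnitor _⟩
  inv_mul_cancel := by
    rintro ⟨a⟩
    exact Quotient.sound ⟨a.unitIso.symm⟩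

end Aut

section Action

variable {n : ℕ} {G : Type} [AddCommGroup G] [DecidableEq G]

/-- The homotopy category `𝒟` of bounded complexes of finitely generated projective graded
modules over the zigzag algebra. -/
abbrev DCat (k : Type u) [Field k] (w : Weight n G) := BoundedHomotopy (GrProj k w)

variable {k : Type u} [Field k] {w : Weight n G}

/-- The functor `Σ_i`: tensoring with the complex of bimodules
`A ⟶ (A e_i ⊗ e_i A)⟨deg z⟩`, with `A` in degree `0`. -/
def twist (i : Fin n) : DCat k w ⥤ DCat k w :=
  boundedCone (GrProj.coevNat i) ⋙ CategoryTheory.shiftFunctor (DCat k w) (-1 : ℤ)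

/-- The functor `Σ_i⁻¹`: tensoring with the complex of bimodules `A e_i ⊗ e_i A ⟶ A`, with `A`
in degree `0`. -/
def twistInv (i : Fin n) : DCat k w ⥤ DCat k w :=
  boundedCone (GrProj.evalNat i)

variable (k w) in
/-- The functors `Σ_i` are auto-equivalences of `𝒟` with inverses `Σ_i⁻¹`, and the weak action
`σ_i ↦ Σ_i` of the free group on `𝒟` that they define is faithful. -/
def ActsFaithfully : Prop :=
  ∃ ψ : FreeGroup (Fin n) →* AutClass (DCat k w),
    (∀ i, (ψ (FreeGroup.of i)).Contains (twist i) ∧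
      (ψ (FreeGroup.of i)⁻¹).Contains (twistInv i)) ∧
    Function.Injective ψ

end Action

section Gradings

/-- An orientation of the doubled complete graph: for `i < j`, the edge `c` between `i` and `j`
points from `i` to `j` if and only if `o c i j = true`. (The other values of `o` are irrelevant.) -/
abbrev Orientation (n : ℕ) := Edge → Fin n → Fin n → Bool

variable (n : ℕ)

/-- The symmetric orientation: for `i < j`, the `x` edge points from `i` to `j` and the `y` edge
from `j` to `i`. -/
def symmetricOrientation : Orientation n
  | .x => fun _ _ => true
  | .y => fun _ _ => false

variable {n}

/-- The grading of an orientation: an arrow of the double has degree `1` if it agrees with the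
orientation, and `0` otherwise; the loops have degree `1`. -/
def Weight.ofOrientation (o : Orientation n) : Weight n ℤ where
  arr c i j := if i < j then (if o c i j then 1 else 0) else 1 - (if o c j i then 1 else 0)
  z := 1
  arr_add c i j h := by
    rcases lt_or_gt_of_ne h with h | h
    · rw [if_pos h, if_neg h.asymm]; ring
    · rw [if_neg h.asymm, if_pos h]; ring

variable (n)

/-- The grading by path length. -/
def Weight.pathLength : Weight n ℤ where
  arr _ _ _ := 1
  z := 2
  arr_add _ _ _ _ := rfl

/-- The trivial grading, by the trivial group: graded modules and their morphisms are just modules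
and module homomorphisms (see `GrProj.piece_eq_top`). -/
def Weight.ungraded : Weight n PUnit.{1} where
  arr _ _ _ := 0
  z := 0
  arr_add _ _ _ _ := rfl

end Gradings

section TwoLinear

/-- A triangulated category is finitely generated if for some finite set of objects, it is itself
the smallest full triangulated subcategory containing them. -/
def IsFinitelyGenerated (D : Type*) [Category D] [Preadditive D] [HasZeroObject D] [HasShift D ℤ]
    [∀ m : ℤ, (CategoryTheory.shiftFunctor D m).Additive] [Pretriangulated D] : Prop :=
  ∃ S : Set D, S.Finite ∧ ∀ P : ObjectProperty D, P.IsClosedUnderIsomorphisms → P.IsTriangulated →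
    (∀ X ∈ S, P X) → ∀ X, P X

/-- A group is 2-linear over `k` if it has a faithful weak action by `k`-linear triangulated
auto-equivalences on a finitely generated `k`-linear triangulated category with finite dimensional
morphism spaces. -/
def IsTwoLinear (k : Type u) [Field k] (Γ : Type*) [Group Γ] : Prop :=
  ∃ (D : Type (u + 1)) (_ : Category.{u} D) (_ : Preadditive D) (_ : Linear k D)
    (_ : HasZeroObject D) (_ : HasShift D ℤ) (_ : ∀ m : ℤ, (CategoryTheory.shiftFunctor D m).Additive)
    (_ : ∀ m : ℤ, (CategoryTheory.shiftFunctor D m).Linear k) (_ : Pretriangulated D) (_ : IsTriangulated D),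
    (∀ X Y : D, Module.Finite k (X ⟶ Y)) ∧ IsFinitelyGenerated D ∧
    ∃ ψ : Γ →* AutClass D,
      (∀ γ, ∃ e : D ≌ D, AutClass.mk e = ψ γ ∧ e.functor.Linear k ∧
        ∃ _ : e.functor.CommShift ℤ, e.functor.IsTriangulated) ∧
      Function.Injective ψ

end TwoLinear

end ZigzagFree

end

noncomputable section

open CategoryTheory Limits CochainComplex HomComplex ZeroObject TensorProduct

namespace ZigzagFree

/-! ### Components of the cone of a natural transformation -/

section ConeComponents

section

variable {C : Type*} [Category C] [Preadditive C] [HasBinaryBiproducts C]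
  {K₁ L₁ K₂ L₂ : CochainComplex C ℤ} {φ₁ : K₁ ⟶ L₁} {φ₂ : K₂ ⟶ L₂}
  {a : K₁ ⟶ K₂} {b : L₁ ⟶ L₂} (comm : φ₁ ≫ b = a ≫ φ₂)

/-! Write `F` for `M ↦ A e_i ⊗ e_i M` and `G` for `F⟨deg z⟩`, so that `Σ_i⁻¹` is the cone of `F ⟶ 𝟭`
and `Σ_i` is the cone of `𝟭 ⟶ G`, shifted by `-1`.

Equivalences. Either composite of the two cones is the total complex of a square with vertices `F`,
`𝟭`, `GF` (or `FG`) and `G`. As `e_i A e_i` has basis `e_i`, `z_i`, the vertex `GF` is naturally the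
sum of `F` and `G` (`GrProj.leftSplitting`, `GrProj.rightSplitting`). Gaussian elimination of these
summands against the vertices `F` and `G` leaves the identity functor in a single degree
(`SquareTotal.isIso_quotient_map_proj`).

Faithfulness. This is a ping-pong argument on the numbers `ztot j X`, the total dimension of the
cohomology of `z_j X`. On a complex whose differential is radical, the number counts the summands
`P_j`. The functors `Σ_i` and `Σ_i⁻¹` change only the number at `i`, because `z_j P_i = 0` for `j ≠
i`. At `i` two inequalities hold, with `R` the sum of `ztot j X` over `j ≠ i`: (a) `2 * ztot i X ≤
ztot i (Σ_i X) + ztot i (Σ_i⁻¹ X)`, that is `ztot_add_ztot_le`; (b) `2 * R ≤ ztot i (Σ_i^{±1} X) +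
ztot i X`, that is `sum_ztot_le_twistInv` and `sum_ztot_le_twist`. Both come from long exact
sequences: `z_i (A e_i ⊗ e_i M)` is `e_i M`, the composite `z_i M ⟶ e_i M ⟶ z_i M` vanishes, the
kernel of `z_i` on `e_i M` contains `z_i M`, and for projective `M` the quotient is the sum of the
`z_j M` over the arrows between `i` and the other vertices `j`. The two edges between `i` and `j`
produce the factor 2 in (b).

If `ztot i X < R`, then by (b) a letter at `i` makes the number at `i` larger than `R`. Repeating
the letter increases it further by (a), and a letter at another vertex meets the hypothesis of (b)
again (`attracted_of_lt`, `attracted_of_attracted`). A non-empty reduced word therefore strictly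
increases the sum of all numbers of `P_j`, as soon as `j` is not the vertex of the letter that acts
first, and the word does not act as the identity. If there is only one vertex, `Σ_i⁻¹` merely shifts
the degree of the cohomology of `z_i X`, and the exponent sum of a reduced word is non-zero
(`zhom_act`, `expSum_ne_zero`). The grading plays no role in the counting, so all gradings are
treated at once.

2-linearity. In the ungraded category, brutal truncation reduces generation to modules in degree
`0`. Each non-zero module splits off some `P_i`, because the Frobenius form given by the coefficient
of `z_i` turns a vector not killed by `z_i` into a split embedding (`exists_retraction`). The twists
are linear and triangulated because cones of natural transformations commute with shifts and mapping
cones. -/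

lemma inl_v_mappingCone_map_f (p q : ℤ) (h : p + (-1) = q) :
    (mappingCone.inl φ₁).v p q h ≫ (mappingCone.map φ₁ φ₂ a b comm).f q =
      a.f p ≫ (mappingCone.inl φ₂).v p q h := by
  simp [mappingCone.map]

lemma inr_f_mappingCone_map_f (p : ℤ) :
    (mappingCone.inr φ₁).f p ≫ (mappingCone.map φ₁ φ₂ a b comm).f p =
      b.f p ≫ (mappingCone.inr φ₂).f p := by
  simp [mappingCone.map]

end

variable {C : Type*} [Category C] [Preadditive C] [HasBinaryBiproducts C]
  {F G : C ⥤ C} [F.Additive] [G.Additive] (τ : F ⟶ G)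

namespace coneComplex

variable (K : CochainComplex C ℤ)

/-- The projection of the cone of `F(K) ⟶ G(K)` to the shift of `F(K)`. -/
def fst (p q : ℤ) (h : p + 1 = q) : ((coneComplex τ).obj K).X p ⟶ F.obj (K.X q) :=
  (mappingCone.fst (termwise τ K)).1.v p q h

/-- The projection of the cone of `F(K) ⟶ G(K)` to `G(K)`. -/
def snd (p : ℤ) : ((coneComplex τ).obj K).X p ⟶ G.obj (K.X p) :=
  (mappingCone.snd (termwise τ K)).v p p (add_zero p)

/-- The inclusion of the shift of `F(K)` into the cone of `F(K) ⟶ G(K)`. -/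
def inl (p q : ℤ) (h : p + 1 = q) : F.obj (K.X q) ⟶ ((coneComplex τ).obj K).X p :=
  (mappingCone.inl (termwise τ K)).v q p (by omega)

/-- The inclusion of `G(K)` into the cone of `F(K) ⟶ G(K)`. -/
def inr (p : ℤ) : G.obj (K.X p) ⟶ ((coneComplex τ).obj K).X p :=
  (mappingCone.inr (termwise τ K)).f p

variable {K}

@[simp] lemma inl_fst (p q : ℤ) (h : p + 1 = q) : inl τ K p q h ≫ fst τ K p q h = 𝟙 _ :=
  mappingCone.inl_v_fst_v _ _ _ _

@[simp] lemma inl_snd (p q : ℤ) (h : p + 1 = q) : inl τ K p q h ≫ snd τ K p = 0 :=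
  mappingCone.inl_v_snd_v _ _ _ _

@[simp] lemma inr_fst (p q : ℤ) (h : p + 1 = q) : inr τ K p ≫ fst τ K p q h = 0 :=
  mappingCone.inr_f_fst_v _ _ _ _

@[simp] lemma inr_snd (p : ℤ) : inr τ K p ≫ snd τ K p = 𝟙 _ :=
  mappingCone.inr_f_snd_v _ _

@[simp] lemma inl_fst_assoc (p q : ℤ) (h : p + 1 = q) {A : C} (k : F.obj (K.X q) ⟶ A) :
    inl τ K p q h ≫ fst τ K p q h ≫ k = k := by
  rw [← Category.assoc, inl_fst, Category.id_comp]

@[simp] lemma inl_snd_assoc (p q : ℤ) (h : p + 1 = q) {A : C} (k : G.obj (K.X p) ⟶ A) :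
    inl τ K p q h ≫ snd τ K p ≫ k = 0 := by
  rw [← Category.assoc, inl_snd, zero_comp]

@[simp] lemma inr_fst_assoc (p q : ℤ) (h : p + 1 = q) {A : C} (k : F.obj (K.X q) ⟶ A) :
    inr τ K p ≫ fst τ K p q h ≫ k = 0 := by
  rw [← Category.assoc, inr_fst, zero_comp]

@[simp] lemma inr_snd_assoc (p : ℤ) {A : C} (k : G.obj (K.X p) ⟶ A) :
    inr τ K p ≫ snd τ K p ≫ k = k := by
  rw [← Category.assoc, inr_snd, Category.id_comp]

lemma ext_from (p q : ℤ) (h : p + 1 = q) {A : C} {f g : ((coneComplex τ).obj K).X p ⟶ A}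
    (h₁ : inl τ K p q h ≫ f = inl τ K p q h ≫ g) (h₂ : inr τ K p ≫ f = inr τ K p ≫ g) : f = g :=
  mappingCone.ext_from _ q p h h₁ h₂

lemma inl_d (p q r : ℤ) (h : p + 1 = q) (h' : q + 1 = r) :
    inl τ K p q h ≫ ((coneComplex τ).obj K).d p q =
      τ.app _ ≫ inr τ K q - F.map (K.d q r) ≫ inl τ K q r h' :=
  mappingCone.inl_v_d _ q p r (by omega) (by omega)

lemma inr_d (p q : ℤ) :
    inr τ K p ≫ ((coneComplex τ).obj K).d p q = G.map (K.d p q) ≫ inr τ K q :=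
  mappingCone.inr_f_d _ p q

variable {L : CochainComplex C ℤ} (f : K ⟶ L)

@[simp] lemma inl_map (p q : ℤ) (h : p + 1 = q) :
    inl τ K p q h ≫ ((coneComplex τ).map f).f p = F.map (f.f q) ≫ inl τ L p q h :=
  inl_v_mappingCone_map_f
    ((NatTrans.mapHomologicalComplex τ (ComplexShape.up ℤ)).naturality f).symm _ _ _

@[simp] lemma inr_map (p : ℤ) :
    inr τ K p ≫ ((coneComplex τ).map f).f p = G.map (f.f p) ≫ inr τ L p :=
  inr_f_mappingCone_map_f
    ((NatTrans.mapHomologicalComplex τ (ComplexShape.up ℤ)).naturality f).symm _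

@[simp] lemma inl_map_assoc (p q : ℤ) (h : p + 1 = q) {A : C}
    (k : ((coneComplex τ).obj L).X p ⟶ A) :
    inl τ K p q h ≫ ((coneComplex τ).map f).f p ≫ k = F.map (f.f q) ≫ inl τ L p q h ≫ k := by
  rw [← Category.assoc, inl_map, Category.assoc]

@[simp] lemma inr_map_assoc (p : ℤ) {A : C} (k : ((coneComplex τ).obj L).X p ⟶ A) :
    inr τ K p ≫ ((coneComplex τ).map f).f p ≫ k = G.map (f.f p) ≫ inr τ L p ≫ k := by
  rw [← Category.assoc, inr_map, Category.assoc]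

lemma map_fst (p q : ℤ) (h : p + 1 = q) :
    ((coneComplex τ).map f).f p ≫ fst τ L p q h = fst τ K p q h ≫ F.map (f.f q) := by
  apply ext_from τ p q h <;> simp

lemma map_snd (p : ℤ) :
    ((coneComplex τ).map f).f p ≫ snd τ L p = snd τ K p ≫ G.map (f.f p) := by
  apply ext_from τ p _ rfl <;> simp

end coneComplex

end ConeComponents

/-! ### Gaussian elimination in the total complex of a split square -/

section SquareTotal

open Preadditive

variable {C : Type*} [Category C] [Preadditive C]

/-- A morphism of complexes to a shift, from its components. -/
def homToShift {N K : CochainComplex C ℤ} (f : ∀ p : ℤ, N.X p ⟶ K.X (p + 1))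
    (hf : ∀ p : ℤ, N.d p (p + 1) ≫ f (p + 1) = -(f p ≫ K.d (p + 1) (p + 1 + 1))) :
    N ⟶ K⟦(1 : ℤ)⟧ where
  f := f
  comm' p q h := by
    obtain rfl : p + 1 = q := h
    refine Eq.trans ?_ (hf p).symm
    rw [CochainComplex.shiftFunctor_obj_d', Int.negOnePow_one, Units.neg_smul, one_smul]
    exact comp_neg _ _

/-- A morphism of complexes from a shift, from its components. -/
def homFromShift {N K : CochainComplex C ℤ} (f : ∀ p : ℤ, K.X (p + 1) ⟶ N.X p)
    (hf : ∀ p : ℤ, f p ≫ N.d p (p + 1) = -(K.d (p + 1) (p + 1 + 1) ≫ f (p + 1))) :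
    K⟦(1 : ℤ)⟧ ⟶ N where
  f := f
  comm' p q h := by
    obtain rfl : p + 1 = q := h
    refine (hf p).trans ?_
    rw [CochainComplex.shiftFunctor_obj_d', Int.negOnePow_one, Units.neg_smul, one_smul]
    exact (neg_comp _ _).symm

/-- Naming the degrees `q + 1` and `q` lets the homotopy be an honest family of maps; the only
transport between equal degrees is the `eqToHom` inside the proof. -/
lemma nonempty_homotopy_of_components {M N : CochainComplex C ℤ} (f g : M ⟶ N)
    (h : ∀ q : ℤ, M.X (q + 1) ⟶ N.X q)
    (hh : ∀ q : ℤ, f.f (q + 1) = h q ≫ N.d q (q + 1) +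
      M.d (q + 1) (q + 1 + 1) ≫ h (q + 1) + g.f (q + 1)) : Nonempty (Homotopy f g) :=
  ⟨(Cochain.equivHomotopy _ _).symm ⟨Cochain.mk fun p q hpq =>
      eqToHom (by rw [show p = q + 1 by omega]) ≫ h q, by
    ext p
    obtain ⟨q, rfl⟩ : ∃ q, p = q + 1 := ⟨p - 1, by omega⟩
    rw [Cochain.add_v, δ_v (-1) 0 (by norm_num) _ (q + 1) (q + 1) (by omega) q (q + 1 + 1)
      (by omega) (by omega)]
    simp [hh q]⟩⟩

/-- A square of graded objects with vertices `A`, `K`, `W` and `D`, with edges `e : A ⟶ K`,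
`a : A ⟶ W`, `b : W ⟶ D` and `h : K ⟶ D`, and with splittings `r` and `s` of `a` and `b`. -/
structure SplitSquare (K : CochainComplex C ℤ) where
  (A W D : ℤ → C)
  dA (p : ℤ) : A p ⟶ A (p + 1)
  dW (p : ℤ) : W p ⟶ W (p + 1)
  dD (p : ℤ) : D p ⟶ D (p + 1)
  e (p : ℤ) : A p ⟶ K.X p
  a (p : ℤ) : A p ⟶ W p
  b (p : ℤ) : W p ⟶ D p
  h (p : ℤ) : K.X p ⟶ D p
  r (p : ℤ) : W p ⟶ A p
  s (p : ℤ) : D p ⟶ W p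
  dA_e (p : ℤ) : dA p ≫ e (p + 1) = e p ≫ K.d p (p + 1)
  dW_r (p : ℤ) : dW p ≫ r (p + 1) = r p ≫ dA p
  dD_s (p : ℤ) : dD p ≫ s (p + 1) = s p ≫ dW p
  d_h (p : ℤ) : K.d p (p + 1) ≫ h (p + 1) = h p ≫ dD p
  a_r (p : ℤ) : a p ≫ r p = 𝟙 (A p)
  s_b (p : ℤ) : s p ≫ b p = 𝟙 (D p)
  s_r (p : ℤ) : s p ≫ r p = 0
  -- `W` is the sum of `A` and `D`, included by `a` and `s`, with coordinates `r` and `b - r ≫ e ≫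
  -- h`. Precomposing with `a` and cancelling `s` by `s_b` yields `a ≫ b = e ≫ h`, so commutativity
  -- of the square is no separate field.
  total (p : ℤ) : r p ≫ a p + b p ≫ s p - r p ≫ e p ≫ h p ≫ s p = 𝟙 (W p)

/-- `N` is the total complex of the square `Q`. -/
structure SquareTotal {K : CochainComplex C ℤ} (Q : SplitSquare K) (N : CochainComplex C ℤ) where
  it (p : ℤ) : Q.A (p + 1 + 1) ⟶ N.X p
  ix (p : ℤ) : K.X (p + 1) ⟶ N.X p
  iu (p : ℤ) : Q.W (p + 1) ⟶ N.X p
  iy (p : ℤ) : Q.D p ⟶ N.X p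
  px (p : ℤ) : N.X p ⟶ K.X (p + 1)
  pu (p : ℤ) : N.X p ⟶ Q.W (p + 1)
  py (p : ℤ) : N.X p ⟶ Q.D p
  hom_ext (p : ℤ) {Y : C} (f g : N.X p ⟶ Y) : it p ≫ f = it p ≫ g → ix p ≫ f = ix p ≫ g →
    iu p ≫ f = iu p ≫ g → iy p ≫ f = iy p ≫ g → f = g
  it_px (p : ℤ) : it p ≫ px p = 0
  ix_px (p : ℤ) : ix p ≫ px p = 𝟙 _
  iu_px (p : ℤ) : iu p ≫ px p = 0
  iy_px (p : ℤ) : iy p ≫ px p = 0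
  it_pu (p : ℤ) : it p ≫ pu p = 0
  ix_pu (p : ℤ) : ix p ≫ pu p = 0
  iu_pu (p : ℤ) : iu p ≫ pu p = 𝟙 _
  iy_pu (p : ℤ) : iy p ≫ pu p = 0
  it_py (p : ℤ) : it p ≫ py p = 0
  ix_py (p : ℤ) : ix p ≫ py p = 0
  iu_py (p : ℤ) : iu p ≫ py p = 0
  iy_py (p : ℤ) : iy p ≫ py p = 𝟙 _
  it_d (p : ℤ) : it p ≫ N.d p (p + 1) =
    Q.a _ ≫ iu (p + 1) - Q.e _ ≫ ix (p + 1) + Q.dA _ ≫ it (p + 1)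
  ix_d (p : ℤ) : ix p ≫ N.d p (p + 1) = Q.h _ ≫ iy (p + 1) - K.d _ _ ≫ ix (p + 1)
  iu_d (p : ℤ) : iu p ≫ N.d p (p + 1) = Q.b _ ≫ iy (p + 1) - Q.dW _ ≫ iu (p + 1)
  iy_d (p : ℤ) : iy p ≫ N.d p (p + 1) = Q.dD _ ≫ iy (p + 1)

/-- Makes any relation usable in the middle of a longer composite. -/
lemma comp_comp_of_eq {C : Type*} [Category C] {X Y Z A : C} {f : X ⟶ Y} {g : Y ⟶ Z} {l : X ⟶ Z}
    (h : f ≫ g = l) (k : Z ⟶ A) : f ≫ g ≫ k = l ≫ k := by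
  rw [← Category.assoc, h]

namespace SquareTotal

variable {K : CochainComplex C ℤ} {Q : SplitSquare K} {N : CochainComplex C ℤ}
  (T : SquareTotal Q N)

/-- The projection of the total complex of a split square to `K⟦1⟧`. -/
def proj : N ⟶ K⟦(1 : ℤ)⟧ := homToShift (fun p => T.px p + T.pu p ≫ Q.r _ ≫ Q.e _) fun p => by
  apply T.hom_ext
  · simp [comp_comp_of_eq (T.it_d p), T.iu_px, T.ix_px, T.it_px, comp_comp_of_eq (T.it_px _),
      comp_comp_of_eq (T.iu_pu _), comp_comp_of_eq (T.ix_pu _), comp_comp_of_eq (T.it_pu _),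
      comp_comp_of_eq (Q.a_r _)]
  · simp [comp_comp_of_eq (T.ix_d p), comp_comp_of_eq (T.ix_pu _), comp_comp_of_eq (T.iy_pu _),
      T.iy_px, T.ix_px, comp_comp_of_eq (T.ix_px _)]
  · simp [comp_comp_of_eq (T.iu_d p), comp_comp_of_eq (T.iu_pu _), comp_comp_of_eq (T.iy_pu _),
      T.iy_px, T.iu_px, comp_comp_of_eq (T.iu_px _), comp_comp_of_eq (Q.dW_r _), Q.dA_e]
  · simp [comp_comp_of_eq (T.iy_d p), comp_comp_of_eq (T.iy_pu _), T.iy_px,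
      comp_comp_of_eq (T.iy_px _)]

/-- The inclusion of `K⟦1⟧` into the total complex of a split square. -/
def inc : K⟦(1 : ℤ)⟧ ⟶ N := homFromShift (fun p => T.ix p - Q.h _ ≫ Q.s _ ≫ T.iu p) fun p => by
  simp [T.ix_d, T.iu_d, comp_comp_of_eq (Q.s_b _), comp_comp_of_eq (Q.d_h _),
    comp_comp_of_eq (Q.dD_s _)]

/-- Strict on this side: the mixed term contains `s ≫ r = 0`. -/
lemma inc_proj : T.inc ≫ T.proj = 𝟙 _ := by
  ext p
  change (T.ix p - Q.h _ ≫ Q.s _ ≫ T.iu p) ≫ (T.px p + T.pu p ≫ Q.r _ ≫ Q.e _) = 𝟙 _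
  simp [T.ix_px, T.iu_px, comp_comp_of_eq (T.ix_pu p), comp_comp_of_eq (T.iu_pu p),
    comp_comp_of_eq (Q.s_r _)]

/-- The homotopy contracts the eliminated summands. It runs backwards along `a` by means of `r` and
backwards along `b` by means of `s`. -/
lemma proj_inc_homotopy : Nonempty (Homotopy (T.proj ≫ T.inc) (𝟙 N)) := by
  refine nonempty_homotopy_of_components _ _
    (fun q => -(T.pu (q + 1) ≫ Q.r _ ≫ T.it q) - T.py (q + 1) ≫ Q.s _ ≫ T.iu q) fun q => ?_
  change (T.px _ + T.pu _ ≫ Q.r _ ≫ Q.e _) ≫ (T.ix _ - Q.h _ ≫ Q.s _ ≫ T.iu _) = _ + 𝟙 _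
  apply T.hom_ext
  · simp [comp_comp_of_eq (T.it_d _), comp_comp_of_eq (T.it_px _), comp_comp_of_eq (T.it_pu _),
      comp_comp_of_eq (T.it_py _), comp_comp_of_eq (T.iu_pu _), comp_comp_of_eq (T.iu_py _),
      comp_comp_of_eq (T.ix_pu _), comp_comp_of_eq (T.ix_py _), comp_comp_of_eq (Q.a_r _)]
  · simp [comp_comp_of_eq (T.ix_d _), comp_comp_of_eq (T.ix_px _), comp_comp_of_eq (T.ix_pu _),
      comp_comp_of_eq (T.ix_py _), comp_comp_of_eq (T.iy_pu _), comp_comp_of_eq (T.iy_py _)]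
    abel
  · have h₄ : T.iu (q + 1) = (Q.r _ ≫ Q.a _ + Q.b _ ≫ Q.s _ -
      Q.r _ ≫ Q.e _ ≫ Q.h _ ≫ Q.s _) ≫ T.iu (q + 1) := by rw [Q.total, Category.id_comp]
    simp [comp_comp_of_eq (T.iu_d _), comp_comp_of_eq (T.iu_px _), comp_comp_of_eq (T.iu_pu _),
      comp_comp_of_eq (T.iu_py _), comp_comp_of_eq (T.iy_pu _), comp_comp_of_eq (T.iy_py _),
      T.it_d, comp_comp_of_eq (Q.dW_r _)]
    -- Only the bare `T.iu (q + 1)`, the contribution of the identity of `N`, is to be expanded by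
    -- `total`; the other occurrences then cancel its terms.
    nth_rewrite 4 [h₄]
    simp
    abel
  · simp [comp_comp_of_eq (T.iy_d _), comp_comp_of_eq (T.iy_px _), comp_comp_of_eq (T.iy_pu _),
      comp_comp_of_eq (T.iy_py _), T.iu_d, comp_comp_of_eq (Q.s_b _), comp_comp_of_eq (Q.dD_s _)]
    abel

/-- The projection of the total complex of a split square to `K⟦1⟧` is a homotopy equivalence. -/
lemma isIso_quotient_map_proj :
    IsIso ((HomotopyCategory.quotient C (ComplexShape.up ℤ)).map T.proj) :=
  ⟨(HomotopyCategory.quotient C (ComplexShape.up ℤ)).map T.inc, by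
    rw [← Functor.map_comp, ← CategoryTheory.Functor.map_id]
    exact HomotopyCategory.eq_of_homotopy _ _ T.proj_inc_homotopy.some, by
    rw [← Functor.map_comp, T.inc_proj, CategoryTheory.Functor.map_id]⟩

lemma proj_naturality {K' : CochainComplex C ℤ} {Q' : SplitSquare K'} {N' : CochainComplex C ℤ}
    (T' : SquareTotal Q' N') (ν : N ⟶ N') (f : K ⟶ K') (fA : ∀ p, Q.A p ⟶ Q'.A p)
    (fW : ∀ p, Q.W p ⟶ Q'.W p)
    (hx : ∀ p, ν.f p ≫ T'.px p = T.px p ≫ f.f _) (hu : ∀ p, ν.f p ≫ T'.pu p = T.pu p ≫ fW _)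
    (hr : ∀ p, fW p ≫ Q'.r p = Q.r p ≫ fA p) (he : ∀ p, fA p ≫ Q'.e p = Q.e p ≫ f.f p) :
    ν ≫ T'.proj = T.proj ≫ f⟦(1 : ℤ)⟧' := by
  ext p
  change ν.f p ≫ (T'.px p + T'.pu p ≫ Q'.r _ ≫ Q'.e _) =
    (T.px p + T.pu p ≫ Q.r _ ≫ Q.e _) ≫ f.f _
  simp [hx, comp_comp_of_eq (hu p), comp_comp_of_eq (hr _), he]

end SquareTotal

end SquareTotal

/-! ### The two composites of the cones as total complexes of split squares -/

section Elimination

open Preadditive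

section

variable {C : Type*} [Category C] {F G : C ⥤ C} (ε : F ⟶ 𝟭 C) (η : 𝟭 C ⟶ G)

/-- The components of a natural transformation `F ⟶ 𝟭`. -/
def toId (X : C) : F.obj X ⟶ X := ε.app X

/-- The components of a natural transformation `𝟭 ⟶ G`. -/
def fromId (X : C) : X ⟶ G.obj X := η.app X

/-- Naturality with the identity functor erased from the types, so that rewriting never meets `(𝟭
C).obj` or `(𝟭 C).map`. -/
lemma map_toId {X Y : C} (f : X ⟶ Y) : F.map f ≫ toId ε Y = toId ε X ≫ f := ε.naturality f

lemma fromId_map {X Y : C} (f : X ⟶ Y) : fromId η X ≫ G.map f = f ≫ fromId η Y :=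
  (η.naturality f).symm

end

variable {C : Type*} [Category C] [Preadditive C] [HasBinaryBiproducts C]
  {F G : C ⥤ C} [F.Additive] [G.Additive] (ε : F ⟶ 𝟭 C) (η : 𝟭 C ⟶ G)

namespace coneComplex

variable (K : CochainComplex C ℤ)

/-- The projection of the cone of `F(K) ⟶ K` to `K`. -/
def sndId (p : ℤ) : ((coneComplex ε).obj K).X p ⟶ K.X p := snd ε K p

/-- The inclusion of `K` into the cone of `F(K) ⟶ K`. -/
def inrId (p : ℤ) : K.X p ⟶ ((coneComplex ε).obj K).X p := inr ε K p

/-- The projection of the cone of `K ⟶ G(K)` to the shift of `K`. -/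
def fstId (p q : ℤ) (h : p + 1 = q) : ((coneComplex η).obj K).X p ⟶ K.X q := fst η K p q h

/-- The inclusion of the shift of `K` into the cone of `K ⟶ G(K)`. -/
def inlId (p q : ℤ) (h : p + 1 = q) : K.X q ⟶ ((coneComplex η).obj K).X p := inl η K p q h

variable {K}

@[simp] lemma inl_sndId (p q : ℤ) (h : p + 1 = q) : inl ε K p q h ≫ sndId ε K p = 0 :=
  inl_snd _ _ _ _
@[simp] lemma inrId_fst (p q : ℤ) (h : p + 1 = q) : inrId ε K p ≫ fst ε K p q h = 0 :=
  inr_fst _ _ _ _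
@[simp] lemma inrId_sndId (p : ℤ) : inrId ε K p ≫ sndId ε K p = 𝟙 _ := inr_snd _ _

lemma ext_fromId (p q : ℤ) (h : p + 1 = q) {A : C} {f g : ((coneComplex ε).obj K).X p ⟶ A}
    (h₁ : inl ε K p q h ≫ f = inl ε K p q h ≫ g)
    (h₂ : inrId ε K p ≫ f = inrId ε K p ≫ g) : f = g := ext_from ε p q h h₁ h₂

lemma inl_dId (p q r : ℤ) (h : p + 1 = q) (h' : q + 1 = r) :
    inl ε K p q h ≫ ((coneComplex ε).obj K).d p q =
      toId ε _ ≫ inrId ε K q - F.map (K.d q r) ≫ inl ε K q r h' := inl_d ε p q r h h'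

lemma inrId_d (p q : ℤ) :
    inrId ε K p ≫ ((coneComplex ε).obj K).d p q = K.d p q ≫ inrId ε K q := inr_d ε p q

@[simp] lemma inlId_fstId (p q : ℤ) (h : p + 1 = q) : inlId η K p q h ≫ fstId η K p q h = 𝟙 _ :=
  inl_fst _ _ _ _
@[simp] lemma inlId_snd (p q : ℤ) (h : p + 1 = q) : inlId η K p q h ≫ snd η K p = 0 :=
  inl_snd _ _ _ _
@[simp] lemma inr_fstId (p q : ℤ) (h : p + 1 = q) : inr η K p ≫ fstId η K p q h = 0 :=
  inr_fst _ _ _ _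

lemma ext_fromId' (p q : ℤ) (h : p + 1 = q) {A : C} {f g : ((coneComplex η).obj K).X p ⟶ A}
    (h₁ : inlId η K p q h ≫ f = inlId η K p q h ≫ g)
    (h₂ : inr η K p ≫ f = inr η K p ≫ g) : f = g := ext_from η p q h h₁ h₂

lemma inlId_d (p q r : ℤ) (h : p + 1 = q) (h' : q + 1 = r) :
    inlId η K p q h ≫ ((coneComplex η).obj K).d p q =
      fromId η _ ≫ inr η K q - K.d q r ≫ inlId η K q r h' := inl_d η p q r h h'

lemma id_eq_fst_sndId (p q : ℤ) (h : p + 1 = q) :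
    fst ε K p q h ≫ inl ε K p q h + sndId ε K p ≫ inrId ε K p = 𝟙 _ :=
  mappingCone.id_X _ p q h

lemma id_eq_fstId_snd (p q : ℤ) (h : p + 1 = q) :
    fstId η K p q h ≫ inlId η K p q h + snd η K p ≫ inr η K p = 𝟙 _ :=
  mappingCone.id_X _ p q h

variable {L : CochainComplex C ℤ} (f : K ⟶ L)

lemma map_sndId (p : ℤ) :
    ((coneComplex ε).map f).f p ≫ sndId ε L p = sndId ε K p ≫ f.f p := map_snd ε f p

lemma map_fstId (p q : ℤ) (h : p + 1 = q) :
    ((coneComplex η).map f).f p ≫ fstId η L p q h = fstId η K p q h ≫ f.f q := map_fst η f p q h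

end coneComplex

/-- Natural splittings `r` and `s` of `F ⟶ GF` and of `GF ⟶ G`. -/
structure LeftSplitting where
  r (X : C) : G.obj (F.obj X) ⟶ F.obj X
  s (X : C) : G.obj X ⟶ G.obj (F.obj X)
  map_r {X Y : C} (f : X ⟶ Y) : G.map (F.map f) ≫ r Y = r X ≫ F.map f
  map_s {X Y : C} (f : X ⟶ Y) : G.map f ≫ s Y = s X ≫ G.map (F.map f)
  unit_r (X : C) : fromId η (F.obj X) ≫ r X = 𝟙 (F.obj X)
  s_counit (X : C) : s X ≫ G.map (toId ε X) = 𝟙 (G.obj X)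
  s_r (X : C) : s X ≫ r X = 0
  total (X : C) : r X ≫ fromId η (F.obj X) + G.map (toId ε X) ≫ s X -
    r X ≫ toId ε X ≫ fromId η X ≫ s X = 𝟙 (G.obj (F.obj X))

/-- Natural splittings `r` and `s` of `F ⟶ FG` and of `FG ⟶ G`. -/
structure RightSplitting where
  r (X : C) : F.obj (G.obj X) ⟶ F.obj X
  s (X : C) : G.obj X ⟶ F.obj (G.obj X)
  map_r {X Y : C} (f : X ⟶ Y) : F.map (G.map f) ≫ r Y = r X ≫ F.map f
  map_s {X Y : C} (f : X ⟶ Y) : G.map f ≫ s Y = s X ≫ F.map (G.map f)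
  unit_r (X : C) : F.map (fromId η X) ≫ r X = 𝟙 (F.obj X)
  s_counit (X : C) : s X ≫ toId ε (G.obj X) = 𝟙 (G.obj X)
  s_r (X : C) : s X ≫ r X = 0
  total (X : C) : r X ≫ F.map (fromId η X) + toId ε (G.obj X) ≫ s X -
    r X ≫ toId ε X ≫ fromId η X ≫ s X = 𝟙 (F.obj (G.obj X))

open coneComplex

variable {ε η} (K : CochainComplex C ℤ)

namespace LeftSplitting

variable (S : LeftSplitting ε η)

/-- The square of the cone of `η` on the cone of `ε`. -/
def square : SplitSquare K where
  A p := F.obj (K.X p)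
  W p := G.obj (F.obj (K.X p))
  D p := G.obj (K.X p)
  dA _ := F.map (K.d _ _)
  dW _ := G.map (F.map (K.d _ _))
  dD _ := G.map (K.d _ _)
  e _ := toId ε _
  a _ := fromId η _
  b _ := G.map (toId ε _)
  h _ := fromId η _
  r _ := S.r _
  s _ := S.s _
  dA_e _ := map_toId ε _
  dW_r _ := S.map_r _
  dD_s _ := S.map_s _
  d_h _ := (fromId_map η _).symm
  a_r _ := S.unit_r _
  s_b _ := S.s_counit _
  s_r _ := S.s_r _
  total _ := S.total _

/-- The cone of `η` on the cone of `ε` as a total complex. -/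
def squareTotal : SquareTotal (S.square K) ((coneComplex η).obj ((coneComplex ε).obj K)) where
  it p := inl ε K (p + 1) (p + 1 + 1) rfl ≫ inlId η _ p (p + 1) rfl
  ix p := inrId ε K (p + 1) ≫ inlId η _ p (p + 1) rfl
  iu p := G.map (inl ε K p (p + 1) rfl) ≫ inr η _ p
  iy p := G.map (inrId ε K p) ≫ inr η _ p
  px p := fstId η _ p (p + 1) rfl ≫ sndId ε K (p + 1)
  pu p := snd η _ p ≫ G.map (fst ε K p (p + 1) rfl)
  py p := snd η _ p ≫ G.map (sndId ε K p)
  hom_ext p Y f g h₁ h₂ h₃ h₄ := by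
    dsimp only [square] at h₁ h₂ h₃ h₄
    apply ext_fromId' η p (p + 1) rfl
    · apply ext_fromId ε (p + 1) (p + 1 + 1) rfl
      · simpa using h₁
      · simpa using h₂
    · rw [← Category.id_comp (inr η _ p ≫ f), ← Category.id_comp (inr η _ p ≫ g),
        ← G.map_id, ← id_eq_fst_sndId ε p (p + 1) rfl]
      simp only [G.map_add, G.map_comp, add_comp, Category.assoc] at h₃ h₄ ⊢
      rw [h₃, h₄]
  it_px p := by dsimp only [square]; simp [comp_comp_of_eq (inlId_fstId _ _ _ _)]; rfl
  ix_px p := by simp [comp_comp_of_eq (inlId_fstId _ _ _ _)]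
  iu_px p := by dsimp only [square]; simp [comp_comp_of_eq (inr_fstId _ _ _ _)]; rfl
  iy_px p := by dsimp only [square]; simp [comp_comp_of_eq (inr_fstId _ _ _ _)]; rfl
  it_pu p := by dsimp only [square]; simp [comp_comp_of_eq (inlId_snd η p (p + 1) rfl)]; rfl
  ix_pu p := by dsimp only [square]; simp [comp_comp_of_eq (inlId_snd η p (p + 1) rfl)]; rfl
  iu_pu p := by dsimp only [square]; simp [← G.map_comp]
  iy_pu p := by dsimp only [square]; simp [← G.map_comp]; rfl
  it_py p := by dsimp only [square]; simp [comp_comp_of_eq (inlId_snd η p (p + 1) rfl)]; rfl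
  ix_py p := by dsimp only [square]; simp [comp_comp_of_eq (inlId_snd η p (p + 1) rfl)]; rfl
  iu_py p := by dsimp only [square]; simp [← G.map_comp]; rfl
  iy_py p := by dsimp only [square]; simp [← G.map_comp]
  it_d p := by
    dsimp only [square]
    rw [Category.assoc, inlId_d η p (p + 1) (p + 1 + 1) rfl rfl, comp_sub,
      comp_comp_of_eq (inl_dId ε _ _ _ rfl rfl), comp_comp_of_eq (fromId_map η _).symm]
    simp only [sub_comp, Category.assoc]
    abel
  ix_d p := by
    dsimp only [square]
    rw [Category.assoc, inlId_d η p (p + 1) (p + 1 + 1) rfl rfl, comp_sub,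
      comp_comp_of_eq (inrId_d ε _ _), comp_comp_of_eq (fromId_map η _).symm]
    simp only [Category.assoc]
  iu_d p := by
    dsimp only [square]
    rw [Category.assoc, inr_d, ← Category.assoc, ← G.map_comp,
      inl_dId ε _ _ (p + 1 + 1) rfl rfl]
    simp only [G.map_sub, G.map_comp, sub_comp, Category.assoc]
    rfl
  iy_d p := by
    dsimp only [square]
    rw [Category.assoc, inr_d, ← Category.assoc, ← G.map_comp, inrId_d]
    simp only [G.map_comp, Category.assoc]

end LeftSplitting

namespace RightSplitting

variable (S : RightSplitting ε η)

/-- The square of the cone of `ε` on the cone of `η`. -/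
def square : SplitSquare K where
  A p := F.obj (K.X p)
  W p := F.obj (G.obj (K.X p))
  D p := G.obj (K.X p)
  dA _ := F.map (K.d _ _)
  dW _ := F.map (G.map (K.d _ _))
  dD _ := G.map (K.d _ _)
  e _ := toId ε _
  a _ := F.map (fromId η _)
  b _ := toId ε _
  h _ := fromId η _
  r _ := S.r _
  s _ := S.s _
  dA_e _ := map_toId ε _
  dW_r _ := S.map_r _
  dD_s _ := S.map_s _
  d_h _ := (fromId_map η _).symm
  a_r _ := S.unit_r _
  s_b _ := S.s_counit _
  s_r _ := S.s_r _
  total _ := S.total _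

/-- The cone of `ε` on the cone of `η` as a total complex. -/
def squareTotal : SquareTotal (S.square K) ((coneComplex ε).obj ((coneComplex η).obj K)) where
  -- In this order the differential of the inner cone acquires the sign of the outer one. The sign
  -- on this corner restores the conventions of `SquareTotal`, which the opposite composite
  -- satisfies without any sign.
  it p := -F.map (inlId η K (p + 1) (p + 1 + 1) rfl) ≫ inl ε _ p (p + 1) rfl
  ix p := inlId η K p (p + 1) rfl ≫ inrId ε _ p
  iu p := F.map (inr η K (p + 1)) ≫ inl ε _ p (p + 1) rfl
  iy p := inr η K p ≫ inrId ε _ p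
  px p := sndId ε _ p ≫ fstId η K p (p + 1) rfl
  pu p := fst ε _ p (p + 1) rfl ≫ F.map (snd η K (p + 1))
  py p := sndId ε _ p ≫ snd η K p
  hom_ext p Y f g h₁ h₂ h₃ h₄ := by
    dsimp only [square] at h₁ h₂ h₃ h₄
    apply ext_fromId ε p (p + 1) rfl
    · rw [← Category.id_comp (inl ε _ p _ _ ≫ f), ← Category.id_comp (inl ε _ p _ _ ≫ g),
        ← F.map_id, ← id_eq_fstId_snd η (p + 1) (p + 1 + 1) rfl]
      simp only [F.map_add, F.map_comp, add_comp, Category.assoc, neg_comp, neg_inj] at h₁ h₃ ⊢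
      rw [h₁, h₃]
    · apply ext_fromId' η p (p + 1) rfl
      · simpa using h₂
      · simpa using h₄
  it_px p := by dsimp only [square]; simp [comp_comp_of_eq (inl_sndId ε p (p + 1) rfl)]; rfl
  ix_px p := by simp [comp_comp_of_eq (inrId_sndId _ _)]
  iu_px p := by dsimp only [square]; simp [comp_comp_of_eq (inl_sndId ε p (p + 1) rfl)]; rfl
  iy_px p := by dsimp only [square]; simp [comp_comp_of_eq (inrId_sndId _ _)]; rfl
  it_pu p := by dsimp only [square]; simp [← F.map_comp]; rfl
  ix_pu p := by dsimp only [square]; simp [comp_comp_of_eq (inrId_fst ε p (p + 1) rfl)]; rfl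
  iu_pu p := by dsimp only [square]; simp [← F.map_comp]
  iy_pu p := by dsimp only [square]; simp [comp_comp_of_eq (inrId_fst ε p (p + 1) rfl)]; rfl
  it_py p := by dsimp only [square]; simp [comp_comp_of_eq (inl_sndId ε p (p + 1) rfl)]; rfl
  ix_py p := by dsimp only [square]; simp [comp_comp_of_eq (inrId_sndId _ _)]; rfl
  iu_py p := by dsimp only [square]; simp [comp_comp_of_eq (inl_sndId ε p (p + 1) rfl)]; rfl
  iy_py p := by dsimp only [square]; simp [comp_comp_of_eq (inrId_sndId _ _)]
  it_d p := by
    dsimp only [square]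
    rw [neg_comp, Category.assoc, inl_dId ε p (p + 1) (p + 1 + 1) rfl rfl, comp_sub,
      comp_comp_of_eq (map_toId ε _), ← Category.assoc (F.map _) (F.map _), ← F.map_comp,
      inlId_d η (p + 1) (p + 1 + 1) (p + 1 + 1 + 1) rfl rfl]
    simp only [F.map_sub, F.map_comp, sub_comp, Category.assoc, comp_neg, neg_comp]
    abel
  ix_d p := by
    dsimp only [square]
    rw [Category.assoc, inrId_d, ← Category.assoc, inlId_d η _ _ (p + 1 + 1) rfl rfl]
    simp only [sub_comp, Category.assoc]
  iu_d p := by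
    dsimp only [square]
    rw [Category.assoc, inl_dId ε p (p + 1) (p + 1 + 1) rfl rfl, comp_sub,
      comp_comp_of_eq (map_toId ε _), ← Category.assoc (F.map _) (F.map _), ← F.map_comp, inr_d]
    simp only [F.map_comp, Category.assoc]
    rfl
  iy_d p := by
    dsimp only [square]
    rw [Category.assoc, inrId_d, ← Category.assoc, inr_d, Category.assoc]

end RightSplitting

end Elimination

/-! ### The composites of the two cones are the shift -/

section ShiftIso

open coneComplex

variable {C : Type*} [Category C] [Preadditive C] [HasBinaryBiproducts C]
  {F G : C ⥤ C} [F.Additive] [G.Additive] {ε : F ⟶ 𝟭 C} {η : 𝟭 C ⟶ G}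

lemma LeftSplitting.proj_naturality (S : LeftSplitting ε η) {K L : CochainComplex C ℤ}
    (f : K ⟶ L) : (coneComplex η).map ((coneComplex ε).map f) ≫ (S.squareTotal L).proj =
      (S.squareTotal K).proj ≫ f⟦(1 : ℤ)⟧' := by
  refine SquareTotal.proj_naturality _ _ _ f (fun p => F.map (f.f p))
    (fun p => G.map (F.map (f.f p))) (fun p => ?_) (fun p => ?_) (fun p => S.map_r _)
    (fun p => map_toId ε _)
  · simp only [squareTotal, comp_comp_of_eq (map_fstId η _ p _ rfl), map_sndId, Category.assoc]
  · change _ ≫ snd η _ p ≫ G.map (fst ε L p (p + 1) rfl) =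
      (snd η _ p ≫ G.map (fst ε K p (p + 1) rfl)) ≫ G.map (F.map (f.f (p + 1)))
    rw [comp_comp_of_eq (map_snd η _ p), Category.assoc, Category.assoc, ← G.map_comp,
      ← G.map_comp, map_fst]

lemma RightSplitting.proj_naturality (S : RightSplitting ε η) {K L : CochainComplex C ℤ}
    (f : K ⟶ L) : (coneComplex ε).map ((coneComplex η).map f) ≫ (S.squareTotal L).proj =
      (S.squareTotal K).proj ≫ f⟦(1 : ℤ)⟧' := by
  refine SquareTotal.proj_naturality _ _ _ f (fun p => F.map (f.f p))
    (fun p => F.map (G.map (f.f p))) (fun p => ?_) (fun p => ?_) (fun p => S.map_r _)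
    (fun p => map_toId ε _)
  · simp only [squareTotal, comp_comp_of_eq (map_sndId ε _ p), map_fstId, Category.assoc]
  · change _ ≫ fst ε _ p _ rfl ≫ F.map (snd η L (p + 1)) =
      (fst ε _ p _ rfl ≫ F.map (snd η K (p + 1))) ≫ F.map (G.map (f.f (p + 1)))
    rw [comp_comp_of_eq (map_fst ε _ p _ rfl), Category.assoc, Category.assoc, ← F.map_comp,
      ← F.map_comp, map_snd]

/-- A natural homotopy equivalence between a functor on complexes and the shift, as an isomorphism
of functors on the homotopy category. -/
def quotientShiftIso (H : HomotopyCategory C (ComplexShape.up ℤ) ⥤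
      HomotopyCategory C (ComplexShape.up ℤ))
    (H' : CochainComplex C ℤ ⥤ CochainComplex C ℤ)
    (e : HomotopyCategory.quotient _ _ ⋙ H ≅ H' ⋙ HomotopyCategory.quotient _ _)
    (π : H' ⟶ CategoryTheory.shiftFunctor _ (1 : ℤ))
    (hπ : ∀ K, IsIso ((HomotopyCategory.quotient C (ComplexShape.up ℤ)).map (π.app K))) :
    H ≅ CategoryTheory.shiftFunctor _ (1 : ℤ) :=
  Quotient.natIsoLift _ (e ≪≫
    (have : IsIso (Functor.whiskerRight π (HomotopyCategory.quotient _ _)) :=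
      (NatTrans.isIso_iff_isIso_app _).2 fun K => hπ K
     asIso (Functor.whiskerRight π (HomotopyCategory.quotient _ _))) ≪≫
    (HomotopyCategory.quotient _ _).commShiftIso (1 : ℤ))

/-- The composition of the cones of `ε` and `η` is the shift. -/
def LeftSplitting.coneHomotopyIso (S : LeftSplitting ε η) :
    coneHomotopy ε ⋙ coneHomotopy η ≅ CategoryTheory.shiftFunctor _ (1 : ℤ) :=
  -- The cone functors on the homotopy category are lifts along the quotient functor, so the
  -- comparison with complexes holds definitionally.
  quotientShiftIso _ (coneComplex ε ⋙ coneComplex η) (Iso.refl _)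
    { app := fun K => (S.squareTotal K).proj
      naturality := fun _ _ f => S.proj_naturality f }
    fun K => (S.squareTotal K).isIso_quotient_map_proj

/-- The composition of the cones of `η` and `ε` is the shift. -/
def RightSplitting.coneHomotopyIso (S : RightSplitting ε η) :
    coneHomotopy η ⋙ coneHomotopy ε ≅ CategoryTheory.shiftFunctor _ (1 : ℤ) :=
  quotientShiftIso _ (coneComplex η ⋙ coneComplex ε) (Iso.refl _)
    { app := fun K => (S.squareTotal K).proj
      naturality := fun _ _ f => S.proj_naturality f }
    fun K => (S.squareTotal K).isIso_quotient_map_proj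

/-- The composition of the cones of `ε` and `η` is the shift. -/
def LeftSplitting.boundedConeIso (S : LeftSplitting ε η) :
    boundedCone ε ⋙ boundedCone η ≅ CategoryTheory.shiftFunctor (BoundedHomotopy C) (1 : ℤ) :=
  Functor.fullyFaithfulCancelRight (bounded C).ι
    (Functor.isoWhiskerLeft (bounded C).ι S.coneHomotopyIso ≪≫ ((bounded C).ι.commShiftIso (1 : ℤ)).symm)

/-- The composition of the cones of `η` and `ε` is the shift. -/
def RightSplitting.boundedConeIso (S : RightSplitting ε η) :
    boundedCone η ⋙ boundedCone ε ≅ CategoryTheory.shiftFunctor (BoundedHomotopy C) (1 : ℤ) :=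
  Functor.fullyFaithfulCancelRight (bounded C).ι
    (Functor.isoWhiskerLeft (bounded C).ι S.coneHomotopyIso ≪≫ ((bounded C).ι.commShiftIso (1 : ℤ)).symm)

end ShiftIso

/-! ### The cone of a natural transformation commutes with shifts -/

section ConeShift

open Preadditive

variable {C : Type*} [Category C] [Preadditive C] [HasBinaryBiproducts C]
  {F G : C ⥤ C} [F.Additive] [G.Additive] (τ : F ⟶ G)

namespace coneComplex

variable (K : CochainComplex C ℤ) (n : ℤ)

/-- The first projection of the cone on a shift. -/
def fstShift (p : ℤ) : ((coneComplex τ).obj (K⟦n⟧)).X p ⟶ F.obj (K.X (p + 1 + n)) :=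
  fst τ (K⟦n⟧) p (p + 1) rfl

/-- The second projection of the cone on a shift. -/
def sndShift (p : ℤ) : ((coneComplex τ).obj (K⟦n⟧)).X p ⟶ G.obj (K.X (p + n)) :=
  snd τ (K⟦n⟧) p

/-- The first inclusion into the cone on a shift. -/
def inlShift (p : ℤ) : F.obj (K.X (p + 1 + n)) ⟶ ((coneComplex τ).obj (K⟦n⟧)).X p :=
  inl τ (K⟦n⟧) p (p + 1) rfl

/-- The second inclusion into the cone on a shift. -/
def inrShift (p : ℤ) : G.obj (K.X (p + n)) ⟶ ((coneComplex τ).obj (K⟦n⟧)).X p :=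
  inr τ (K⟦n⟧) p

variable {K}

@[simp] lemma inlShift_fstShift (p : ℤ) : inlShift τ K n p ≫ fstShift τ K n p = 𝟙 _ :=
  inl_fst _ _ _ _
@[simp] lemma inlShift_sndShift (p : ℤ) : inlShift τ K n p ≫ sndShift τ K n p = 0 :=
  inl_snd _ _ _ _
@[simp] lemma inrShift_fstShift (p : ℤ) : inrShift τ K n p ≫ fstShift τ K n p = 0 :=
  inr_fst _ _ _ _
@[simp] lemma inrShift_sndShift (p : ℤ) : inrShift τ K n p ≫ sndShift τ K n p = 𝟙 _ :=
  inr_snd _ _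

lemma ext_fromShift (p : ℤ) {A : C} {f g : ((coneComplex τ).obj (K⟦n⟧)).X p ⟶ A}
    (h₁ : inlShift τ K n p ≫ f = inlShift τ K n p ≫ g)
    (h₂ : inrShift τ K n p ≫ f = inrShift τ K n p ≫ g) : f = g :=
  ext_from τ p (p + 1) rfl h₁ h₂

lemma inlShift_d (p : ℤ) :
    inlShift τ K n p ≫ ((coneComplex τ).obj (K⟦n⟧)).d p (p + 1) =
      τ.app _ ≫ inrShift τ K n (p + 1) -
        n.negOnePow • (F.map (K.d (p + 1 + n) (p + 1 + 1 + n)) ≫ inlShift τ K n (p + 1)) := by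
  refine (inl_d τ p (p + 1) (p + 1 + 1) rfl rfl).trans ?_
  rw [CochainComplex.shiftFunctor_obj_d']
  congr 1
  rw [← Linear.units_smul_comp, ← Functor.map_units_smul]
  rfl

lemma inrShift_d (p : ℤ) :
    inrShift τ K n p ≫ ((coneComplex τ).obj (K⟦n⟧)).d p (p + 1) =
      n.negOnePow • (G.map (K.d (p + n) (p + 1 + n)) ≫ inrShift τ K n (p + 1)) := by
  refine (inr_d τ p (p + 1)).trans ?_
  rw [CochainComplex.shiftFunctor_obj_d', ← Linear.units_smul_comp, ← Functor.map_units_smul]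
  rfl

/-- The components of the isomorphism between the cone on a shift and the shift of the cone. -/
def shiftXIso (K : CochainComplex C ℤ) (n p : ℤ) :
    ((coneComplex τ).obj (K⟦n⟧)).X p ≅ ((coneComplex τ).obj K).X (p + n) where
  -- The shift by `n` multiplies the whole differential of a cone by `(-1)^n`, including the part
  -- given by `τ`, whereas in the cone on `K⟦n⟧` this part has no sign. The sign on the summand of
  -- `F` corrects this.
  hom := n.negOnePow • (fstShift τ K n p ≫ inl τ K (p + n) (p + 1 + n) (by omega)) +
    sndShift τ K n p ≫ inr τ K (p + n)
  inv := n.negOnePow • (fst τ K (p + n) (p + 1 + n) (by omega) ≫ inlShift τ K n p) +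
    snd τ K (p + n) ≫ inrShift τ K n p
  hom_inv_id := by
    apply ext_fromShift <;>
    simp [smul_smul, comp_comp_of_eq (inlShift_fstShift τ n p),
      comp_comp_of_eq (inlShift_sndShift τ n p), comp_comp_of_eq (inrShift_fstShift τ n p),
      comp_comp_of_eq (inrShift_sndShift τ n p)]
  inv_hom_id := by
    apply ext_from τ (p + n) (p + 1 + n) (by omega) <;>
    simp [smul_smul, comp_comp_of_eq (inlShift_fstShift τ n p),
      comp_comp_of_eq (inlShift_sndShift τ n p), comp_comp_of_eq (inrShift_fstShift τ n p),
      comp_comp_of_eq (inrShift_sndShift τ n p)]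

lemma inlShift_shiftXIso_hom (p : ℤ) : inlShift τ K n p ≫ (shiftXIso τ K n p).hom =
    n.negOnePow • inl τ K (p + n) (p + 1 + n) (by omega) := by
  simp [shiftXIso, comp_comp_of_eq (inlShift_fstShift τ n p),
      comp_comp_of_eq (inlShift_sndShift τ n p)]

lemma inrShift_shiftXIso_hom (p : ℤ) : inrShift τ K n p ≫ (shiftXIso τ K n p).hom =
    inr τ K (p + n) := by
  simp [shiftXIso, comp_comp_of_eq (inrShift_fstShift τ n p),
      comp_comp_of_eq (inrShift_sndShift τ n p)]

lemma shiftXIso_hom_d (p : ℤ) :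
    (shiftXIso τ K n p).hom ≫ (n.negOnePow • ((coneComplex τ).obj K).d (p + n) (p + 1 + n)) =
      ((coneComplex τ).obj (K⟦n⟧)).d p (p + 1) ≫ (shiftXIso τ K n (p + 1)).hom := by
  apply ext_fromShift
  · rw [comp_comp_of_eq (inlShift_shiftXIso_hom τ n p), comp_comp_of_eq (inlShift_d τ n p),
      Linear.comp_units_smul, Linear.units_smul_comp, smul_smul, Int.units_mul_self, one_smul,
      inl_d τ _ _ (p + 1 + 1 + n) _ (by omega), sub_comp, Category.assoc, Linear.units_smul_comp,
      Category.assoc, inlShift_shiftXIso_hom, inrShift_shiftXIso_hom, Linear.comp_units_smul,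
      smul_smul, Int.units_mul_self, one_smul]
  · rw [comp_comp_of_eq (inrShift_shiftXIso_hom τ n p), comp_comp_of_eq (inrShift_d τ n p),
      Linear.comp_units_smul, Linear.units_smul_comp, inr_d, Category.assoc,
      inrShift_shiftXIso_hom]

/-- The isomorphism between the cone on a shift and the shift of the cone. -/
def shiftObjIso (K : CochainComplex C ℤ) (n : ℤ) :
    (coneComplex τ).obj (K⟦n⟧) ≅ ((coneComplex τ).obj K)⟦n⟧ :=
  HomologicalComplex.Hom.isoOfComponents (fun p => shiftXIso τ K n p) (by
    intro p q h
    obtain rfl : p + 1 = q := h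
    exact shiftXIso_hom_d τ n p)

variable {L : CochainComplex C ℤ} (f : K ⟶ L)

lemma inlShift_map (p : ℤ) : inlShift τ K n p ≫ ((coneComplex τ).map (f⟦n⟧')).f p =
    F.map (f.f (p + 1 + n)) ≫ inlShift τ L n p := inl_map _ _ _ _ _

lemma inrShift_map (p : ℤ) : inrShift τ K n p ≫ ((coneComplex τ).map (f⟦n⟧')).f p =
    G.map (f.f (p + n)) ≫ inrShift τ L n p := inr_map _ _ _

/-- The cone commutes with shifts. -/
def shiftNatIso (n : ℤ) : CategoryTheory.shiftFunctor (CochainComplex C ℤ) n ⋙ coneComplex τ ≅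
    coneComplex τ ⋙ CategoryTheory.shiftFunctor (CochainComplex C ℤ) n :=
  NatIso.ofComponents (fun K => shiftObjIso τ K n) fun {K L} f => by
    ext p
    change ((coneComplex τ).map (f⟦n⟧')).f p ≫ (shiftXIso τ L n p).hom =
      (shiftXIso τ K n p).hom ≫ ((coneComplex τ).map f).f (p + n)
    apply ext_fromShift
    · rw [comp_comp_of_eq (inlShift_map τ n f p), comp_comp_of_eq (inlShift_shiftXIso_hom τ n p),
        Category.assoc, inlShift_shiftXIso_hom, Linear.comp_units_smul, Linear.units_smul_comp,
        inl_map]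
    · rw [comp_comp_of_eq (inrShift_map τ n f p), comp_comp_of_eq (inrShift_shiftXIso_hom τ n p),
        Category.assoc, inrShift_shiftXIso_hom, inr_map]

/-- Degrees such as `p + n + 1` and `p + 1 + n` are only propositionally equal, and the coherence
conditions for shifts involve the resulting transports. -/
lemma inl_XIsoOfEq {p p' q q' : ℤ} (h : p + 1 = q) (h' : p' + 1 = q') (hp : p = p') :
    inl τ K p q h ≫ (((coneComplex τ).obj K).XIsoOfEq hp).hom =
      F.map (K.XIsoOfEq (show q = q' by omega)).hom ≫ inl τ K p' q' h' := by
  subst hp h h'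
  simp

lemma inr_XIsoOfEq {p p' : ℤ} (hp : p = p') :
    inr τ K p ≫ (((coneComplex τ).obj K).XIsoOfEq hp).hom =
      G.map (K.XIsoOfEq hp).hom ≫ inr τ K p' := by
  subst hp
  simp

lemma inlShift_zero (p : ℤ) : inlShift τ K 0 p ≫
    ((coneComplex τ).map ((CategoryTheory.shiftFunctorZero (CochainComplex C ℤ) ℤ).hom.app K)).f p =
      F.map (K.XIsoOfEq (add_zero (p + 1))).hom ≫ inl τ K p (p + 1) rfl := by
  rw [← CochainComplex.shiftFunctorZero_hom_app_f]
  exact inl_map _ _ _ _ _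

lemma inrShift_zero (p : ℤ) : inrShift τ K 0 p ≫
    ((coneComplex τ).map ((CategoryTheory.shiftFunctorZero (CochainComplex C ℤ) ℤ).hom.app K)).f p =
      G.map (K.XIsoOfEq (add_zero p)).hom ≫ inr τ K p := by
  rw [← CochainComplex.shiftFunctorZero_hom_app_f]
  exact inr_map _ _ _

variable (K) in
/-- The first inclusion into the cone on a twofold shift. -/
def inlShiftShift (a b p : ℤ) :
    F.obj (K.X (p + 1 + b + a)) ⟶ ((coneComplex τ).obj (K⟦a⟧⟦b⟧)).X p :=
  inlShift τ (K⟦a⟧) b p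

variable (K) in
/-- The second inclusion into the cone on a twofold shift. -/
def inrShiftShift (a b p : ℤ) :
    G.obj (K.X (p + b + a)) ⟶ ((coneComplex τ).obj (K⟦a⟧⟦b⟧)).X p :=
  inrShift τ (K⟦a⟧) b p

lemma inlShift_add (a b p : ℤ) : inlShift τ K (a + b) p ≫ ((coneComplex τ).map
    ((CategoryTheory.shiftFunctorAdd (CochainComplex C ℤ) a b).hom.app K)).f p =
      F.map (K.XIsoOfEq (show p + 1 + (a + b) = p + 1 + b + a by omega)).hom ≫
        inlShiftShift τ K a b p :=
  (inl_map τ _ _ _ _).trans (congrArg (fun t => F.map t ≫ inlShiftShift τ K a b p)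
    (CochainComplex.shiftFunctorAdd_hom_app_f K a b (p + 1)))

lemma inrShift_add (a b p : ℤ) : inrShift τ K (a + b) p ≫ ((coneComplex τ).map
    ((CategoryTheory.shiftFunctorAdd (CochainComplex C ℤ) a b).hom.app K)).f p =
      G.map (K.XIsoOfEq (show p + (a + b) = p + b + a by omega)).hom ≫
        inrShiftShift τ K a b p :=
  (inr_map τ _ _).trans (congrArg (fun t => G.map t ≫ inrShiftShift τ K a b p)
    (CochainComplex.shiftFunctorAdd_hom_app_f K a b p))

lemma inlShiftShift_shiftXIso (a b p : ℤ) :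
    inlShiftShift τ K a b p ≫ (shiftXIso τ (K⟦a⟧) b p).hom =
      b.negOnePow • (F.map (K.XIsoOfEq (show p + 1 + b + a = p + b + 1 + a by omega)).hom ≫
        inlShift τ K a (p + b)) := by
  refine (inlShift_shiftXIso_hom τ (K := K⟦a⟧) b p).trans (congrArg _ ?_)
  have h' := inl_XIsoOfEq τ (K := K⟦a⟧) (show p + b + 1 = p + 1 + b by omega) (q' := p + b + 1)
    rfl (rfl : p + b = p + b)
  simp only [HomologicalComplex.XIsoOfEq_rfl, Iso.refl_hom, Category.comp_id] at h'
  exact h'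

lemma inrShiftShift_shiftXIso (a b p : ℤ) :
    inrShiftShift τ K a b p ≫ (shiftXIso τ (K⟦a⟧) b p).hom = inrShift τ K a (p + b) :=
  inrShift_shiftXIso_hom τ (K := K⟦a⟧) b p

variable (K) in
/-- The component of the isomorphism between the cone on a twofold shift and the twofold shift of
the cone. -/
def shiftShiftX (a b p : ℤ) : ((coneComplex τ).obj (K⟦a⟧⟦b⟧)).X p ⟶
    ((coneComplex τ).obj K).X (p + b + a) :=
  (shiftXIso τ (K⟦a⟧) b p).hom ≫ (shiftXIso τ K a (p + b)).hom

lemma inlShiftShift_shiftShiftX (a b p : ℤ) :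
    inlShiftShift τ K a b p ≫ shiftShiftX τ K a b p =
      (a + b).negOnePow • (F.map
        (K.XIsoOfEq (show p + 1 + b + a = p + b + 1 + a by omega)).hom ≫
        inl τ K (p + b + a) (p + b + 1 + a) (by omega)) := by
  rw [shiftShiftX, comp_comp_of_eq (inlShiftShift_shiftXIso τ a b p), Linear.units_smul_comp,
    Category.assoc, inlShift_shiftXIso_hom, Linear.comp_units_smul, smul_smul, Int.negOnePow_add,
    mul_comm]

lemma inrShiftShift_shiftShiftX (a b p : ℤ) :
    inrShiftShift τ K a b p ≫ shiftShiftX τ K a b p = inr τ K (p + b + a) := by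
  rw [shiftShiftX, comp_comp_of_eq (inrShiftShift_shiftXIso τ a b p), inrShift_shiftXIso_hom]

lemma shiftXIso_zero_hom (p : ℤ) : (shiftXIso τ K 0 p).hom = ((coneComplex τ).map
    ((CategoryTheory.shiftFunctorZero (CochainComplex C ℤ) ℤ).hom.app K)).f p ≫
      (((coneComplex τ).obj K).XIsoOfEq (show p = p + 0 by omega)).hom := by
  apply ext_fromShift
  · rw [inlShift_shiftXIso_hom, comp_comp_of_eq (inlShift_zero τ p), Category.assoc,
      inl_XIsoOfEq τ _ (by omega : p + 0 + 1 = p + 1 + 0), ← Category.assoc, ← F.map_comp]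
    simp
  · rw [inrShift_shiftXIso_hom, comp_comp_of_eq (inrShift_zero τ p), Category.assoc,
      inr_XIsoOfEq τ _, ← Category.assoc, ← G.map_comp]
    simp

/-- Since `(-1)^(a+b)` is the product of `(-1)^a` and `(-1)^b`, both sides carry the same sign on
the summand of `F`; what remains is transport along the associativity of addition of degrees. -/
lemma shiftXIso_add_hom (a b p : ℤ) : (shiftXIso τ K (a + b) p).hom = ((coneComplex τ).map
    ((CategoryTheory.shiftFunctorAdd (CochainComplex C ℤ) a b).hom.app K)).f p ≫
      shiftShiftX τ K a b p ≫
      (((coneComplex τ).obj K).XIsoOfEq (show p + b + a = p + (a + b) by omega)).hom := by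
  apply ext_fromShift
  · rw [inlShift_shiftXIso_hom, comp_comp_of_eq (inlShift_add τ a b p), Category.assoc,
      comp_comp_of_eq (inlShiftShift_shiftShiftX τ (K := K) a b p),
      Linear.units_smul_comp, Category.assoc,
      inl_XIsoOfEq τ _ (by omega : p + (a + b) + 1 = p + 1 + (a + b)), Linear.comp_units_smul,
      ← Category.assoc (F.map _) (F.map _), ← F.map_comp, ← Category.assoc (F.map _) (F.map _),
      ← F.map_comp]
    simp
  · rw [inrShift_shiftXIso_hom, comp_comp_of_eq (inrShift_add τ a b p), Category.assoc,
      comp_comp_of_eq (inrShiftShift_shiftShiftX τ (K := K) a b p),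
      inr_XIsoOfEq τ _, ← Category.assoc (G.map _) (G.map _), ← G.map_comp]
    simp

instance commShift : (coneComplex τ).CommShift ℤ where
  commShiftIso n := shiftNatIso τ n
  commShiftIso_zero := by
    ext K p
    rw [Functor.CommShift.isoZero_hom_app]
    refine (shiftXIso_zero_hom τ p).trans ?_
    exact congrArg (fun t => ((coneComplex τ).map _).f p ≫ t)
      (CochainComplex.shiftFunctorZero_inv_app_f _ p).symm
  commShiftIso_add a b := by
    ext K p
    rw [Functor.CommShift.isoAdd_hom_app]
    refine (shiftXIso_add_hom τ a b p).trans ?_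
    refine (congrArg _ (Category.assoc _ _ _)).trans ?_
    exact congrArg (fun t => ((coneComplex τ).map _).f p ≫ (shiftXIso τ (K⟦a⟧) b p).hom ≫
      (shiftXIso τ K a (p + b)).hom ≫ t)
      (CochainComplex.shiftFunctorAdd_inv_app_f _ a b p).symm

end coneComplex
end ConeShift

/-! ### The cone of a natural transformation is a linear triangulated functor -/

section ConeTriangle

open Preadditive

variable {C : Type*} [Category C] [Preadditive C] [HasBinaryBiproducts C]
  {F G : C ⥤ C} [F.Additive] [G.Additive] (τ : F ⟶ G)

namespace coneComplex

variable {K L : CochainComplex C ℤ} (φ : K ⟶ L)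

/-- The component of degree `-1` of the comparison between the cone of a mapping cone and the
mapping cone of the map of cones. -/
def mappingConeInl (p q : ℤ) (h : q + 1 = p) :
    ((coneComplex τ).obj K).X p ⟶ ((coneComplex τ).obj (mappingCone φ)).X q :=
  -- The summand of `F` is shifted twice, once by each cone, and exchanging the two shifts costs a
  -- sign; the summand of `G` is shifted only once.
  snd τ K p ≫ G.map ((mappingCone.inl φ).v p q (by omega)) ≫ inr τ (mappingCone φ) q -
    fst τ K p (p + 1) rfl ≫ F.map ((mappingCone.inl φ).v (p + 1) p (by omega)) ≫
      inl τ (mappingCone φ) q p h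

lemma inl_mappingConeInl (p q r : ℤ) (h : q + 1 = p) (h' : p + 1 = r) :
    inl τ K p r h' ≫ mappingConeInl τ φ p q h =
      -(F.map ((mappingCone.inl φ).v r p (by omega)) ≫ inl τ (mappingCone φ) q p h) := by
  subst h'
  simp [mappingConeInl]

lemma inr_mappingConeInl (p q : ℤ) (h : q + 1 = p) :
    inr τ K p ≫ mappingConeInl τ φ p q h =
      G.map ((mappingCone.inl φ).v p q (by omega)) ≫ inr τ (mappingCone φ) q := by
  simp [mappingConeInl]

/-- The condition under which a cochain of degree `-1` on the source and a morphism on the target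
descend to the mapping cone. -/
lemma mappingConeInl_d (p q r : ℤ) (h : q + 1 = p) (h' : p + 1 = r) :
    mappingConeInl τ φ p q h ≫ ((coneComplex τ).obj (mappingCone φ)).d q p +
      ((coneComplex τ).obj K).d p r ≫ mappingConeInl τ φ r p h' =
    ((coneComplex τ).map φ).f p ≫ ((coneComplex τ).map (mappingCone.inr φ)).f p := by
  apply ext_from τ p r h'
  · rw [comp_add, comp_comp_of_eq (inl_mappingConeInl τ φ p q r h h'),
      comp_comp_of_eq (inl_d τ p r (r + 1) h' rfl), sub_comp, Category.assoc, Category.assoc,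
      inr_mappingConeInl, inl_mappingConeInl, neg_comp, Category.assoc, inl_d τ q p r h h', inl_map_assoc, inl_map,
      ← Category.assoc (F.map _) (F.map _) (inl _ _ _ _ _), ← F.map_comp,
      comp_sub, ← Category.assoc (F.map _) (F.map _) (inl _ _ _ _ _), ← F.map_comp,
      mappingCone.inl_v_d φ r p (r + 1) (by omega) (by omega), F.map_sub, sub_comp,
      ← Category.assoc (F.map _) (τ.app _), τ.naturality, Category.assoc, comp_neg, F.map_comp,
      F.map_comp, Category.assoc, Category.assoc]
    abel
  · rw [comp_add, comp_comp_of_eq (inr_mappingConeInl τ φ p q h),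
      comp_comp_of_eq (inr_d τ p r), Category.assoc, Category.assoc,
      inr_mappingConeInl, inr_d, inr_map_assoc, inr_map, 
      ← Category.assoc (G.map _) (G.map _), ← G.map_comp, 
      mappingCone.inl_v_d φ p q r (by omega) (by omega), G.map_sub, sub_comp, G.map_comp,
      G.map_comp, Category.assoc, Category.assoc, sub_add_cancel]

/-- The comparison between the mapping cone of the map of cones and the cone of a mapping cone. -/
def mappingConeHom :
    mappingCone ((coneComplex τ).map φ) ⟶ (coneComplex τ).obj (mappingCone φ) :=
  mappingCone.desc _ (Cochain.mk fun p q h => mappingConeInl τ φ p q (by omega))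
    ((coneComplex τ).map (mappingCone.inr φ)) (by
      ext p
      rw [δ_v (-1) 0 (by omega) _ p p (by omega) (p - 1) (p + 1) (by omega) (by omega)]
      simpa using mappingConeInl_d τ φ p (p - 1) (p + 1) (by omega) rfl)

lemma inl_mappingConeHom (p q : ℤ) (h : q + 1 = p) :
    (mappingCone.inl ((coneComplex τ).map φ)).v p q (by omega) ≫ (mappingConeHom τ φ).f q =
      mappingConeInl τ φ p q h := by
  rw [mappingConeHom, mappingCone.inl_v_desc_f]
  rfl

lemma inr_mappingConeHom : mappingCone.inr ((coneComplex τ).map φ) ≫ mappingConeHom τ φ =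
    (coneComplex τ).map (mappingCone.inr φ) := by
  simp [mappingConeHom]

lemma inr_f_mappingConeHom (p : ℤ) :
    (mappingCone.inr ((coneComplex τ).map φ)).f p ≫ (mappingConeHom τ φ).f p =
    ((coneComplex τ).map (mappingCone.inr φ)).f p := by
  simp [mappingConeHom]

/-- The components of the inverse of `mappingConeHom`. -/
def mappingConeInv (p : ℤ) : ((coneComplex τ).obj (mappingCone φ)).X p ⟶
    (mappingCone ((coneComplex τ).map φ)).X p :=
  fst τ (mappingCone φ) p (p + 1) rfl ≫
    (F.map ((mappingCone.snd φ).v (p + 1) (p + 1) (by omega)) ≫ inl τ L p (p + 1) rfl ≫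
      (mappingCone.inr ((coneComplex τ).map φ)).f p -
    F.map ((mappingCone.fst φ).1.v (p + 1) (p + 1 + 1) rfl) ≫ inl τ K (p + 1) (p + 1 + 1) rfl ≫
      (mappingCone.inl ((coneComplex τ).map φ)).v (p + 1) p (by omega)) +
  snd τ (mappingCone φ) p ≫
    (G.map ((mappingCone.snd φ).v p p (by omega)) ≫ inr τ L p ≫
      (mappingCone.inr ((coneComplex τ).map φ)).f p +
    G.map ((mappingCone.fst φ).1.v p (p + 1) rfl) ≫ inr τ K (p + 1) ≫
      (mappingCone.inl ((coneComplex τ).map φ)).v (p + 1) p (by omega))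

lemma map_comp_eq {X Y Z : C} {f : X ⟶ Y} {g : Y ⟶ Z} {l : X ⟶ Z} (h : f ≫ g = l) {A : C}
    (H : C ⥤ C) (k : H.obj Z ⟶ A) : H.map f ≫ H.map g ≫ k = H.map l ≫ k := by
  rw [← h, H.map_comp, Category.assoc]

lemma inl_mappingConeInv (p : ℤ) : inl τ (mappingCone φ) p (p + 1) rfl ≫ mappingConeInv τ φ p =
    F.map ((mappingCone.snd φ).v (p + 1) (p + 1) (by omega)) ≫ inl τ L p (p + 1) rfl ≫
      (mappingCone.inr ((coneComplex τ).map φ)).f p -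
    F.map ((mappingCone.fst φ).1.v (p + 1) (p + 1 + 1) rfl) ≫ inl τ K (p + 1) (p + 1 + 1) rfl ≫
      (mappingCone.inl ((coneComplex τ).map φ)).v (p + 1) p (by omega) := by
  simp [mappingConeInv]

lemma inr_mappingConeInv (p : ℤ) : inr τ (mappingCone φ) p ≫ mappingConeInv τ φ p =
    G.map ((mappingCone.snd φ).v p p (by omega)) ≫ inr τ L p ≫
      (mappingCone.inr ((coneComplex τ).map φ)).f p +
    G.map ((mappingCone.fst φ).1.v p (p + 1) rfl) ≫ inr τ K (p + 1) ≫
      (mappingCone.inl ((coneComplex τ).map φ)).v (p + 1) p (by omega) := by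
  simp [mappingConeInv]

instance isIso_mappingConeHom_f (p : ℤ) : IsIso ((mappingConeHom τ φ).f p) := by
  refine ⟨mappingConeInv τ φ p, ?_, ?_⟩
  · apply mappingCone.ext_from _ (p + 1) p rfl
    · rw [comp_comp_of_eq (inl_mappingConeHom τ φ (p + 1) p rfl)]
      apply ext_from τ (p + 1) (p + 1 + 1) rfl
      · rw [comp_comp_of_eq (inl_mappingConeInl τ φ _ _ _ _ _), neg_comp, Category.assoc,
          inl_mappingConeInv, comp_sub, map_comp_eq (mappingCone.inl_v_snd_v φ _ _ _),
          map_comp_eq (mappingCone.inl_v_fst_v φ _ _ _)]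
        simp
      · rw [comp_comp_of_eq (inr_mappingConeInl τ φ _ _ _), Category.assoc,
          inr_mappingConeInv, comp_add, map_comp_eq (mappingCone.inl_v_snd_v φ _ _ _),
          map_comp_eq (mappingCone.inl_v_fst_v φ _ _ _)]
        simp
    · rw [comp_comp_of_eq (inr_f_mappingConeHom τ φ p)]
      apply ext_from τ p (p + 1) rfl
      · rw [comp_comp_of_eq (inl_map τ _ _ _ _), Category.assoc,
          inl_mappingConeInv, comp_sub, map_comp_eq (mappingCone.inr_f_snd_v φ _),
          map_comp_eq (mappingCone.inr_f_fst_v φ _ _ _)]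
        simp
      · rw [comp_comp_of_eq (inr_map τ _ _), Category.assoc,
          inr_mappingConeInv, comp_add, map_comp_eq (mappingCone.inr_f_snd_v φ _),
          map_comp_eq (mappingCone.inr_f_fst_v φ _ _ _)]
        simp
  · apply ext_from τ p (p + 1) rfl
    · rw [comp_comp_of_eq (inl_mappingConeInv τ φ p)]
      simp only [sub_comp, Category.assoc]
      rw [inl_mappingConeHom τ φ (p + 1) p rfl, inr_f_mappingConeHom, inl_mappingConeInl, inl_map,
        comp_neg, sub_neg_eq_add, ← Category.assoc, ← Category.assoc, ← F.map_comp, ← F.map_comp,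
        ← add_comp, ← F.map_add]
      rw [(add_comm _ _).trans (mappingCone.id_X φ (p + 1) (p + 1 + 1) rfl)]
      simp
    · rw [comp_comp_of_eq (inr_mappingConeInv τ φ p)]
      simp only [add_comp, Category.assoc]
      rw [inl_mappingConeHom τ φ (p + 1) p rfl, inr_f_mappingConeHom, inr_mappingConeInl, inr_map,
        ← Category.assoc, ← Category.assoc, ← G.map_comp, ← G.map_comp,
        ← add_comp, ← G.map_add]
      rw [(add_comm _ _).trans (mappingCone.id_X φ p (p + 1) rfl)]
      simp

instance isIso_mappingConeHom : IsIso (mappingConeHom τ φ) :=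
  HomologicalComplex.Hom.isIso_of_components _

/-- The map `mappingCone φ ⟶ K⟦1⟧` of the standard triangle, in components. -/
def triangleδ (p : ℤ) : (mappingCone φ).X p ⟶ K.X (p + 1) :=
  -(mappingCone.fst φ).1.v p (p + 1) rfl

/-- The map `mappingCone φ ⟶ K⟦1⟧` of the standard triangle. -/
def connecting : mappingCone φ ⟶ K⟦(1 : ℤ)⟧ := (mappingCone.triangle φ).mor₃

lemma connecting_f (p : ℤ) : (connecting φ).f p = triangleδ φ p := by
  apply mappingCone.ext_from _ (p + 1) p rfl
  · refine (mappingCone.inl_v_triangle_mor₃_f φ (p + 1) p (by omega)).trans ?_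
    refine Eq.trans ?_ ((comp_neg _ _).trans
      (congrArg _ (mappingCone.inl_v_fst_v φ (p + 1) p rfl))).symm
    simp [CochainComplex.shiftFunctorObjXIso]
    rfl
  · exact (mappingCone.inr_f_triangle_mor₃_f φ p).trans ((comp_neg _ _).trans
      ((congrArg _ (mappingCone.inr_f_fst_v φ p (p + 1) rfl)).trans neg_zero)).symm

lemma inl_map_connecting (p : ℤ) : inl τ (mappingCone φ) p (p + 1) rfl ≫
    ((coneComplex τ).map (connecting φ)).f p = F.map (triangleδ φ (p + 1)) ≫
      inlShift τ K 1 p :=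
  (inl_map τ _ _ _ _).trans (congrArg (fun t => F.map t ≫ inlShift τ K 1 p)
    (connecting_f φ (p + 1)))

lemma inr_map_connecting (p : ℤ) : inr τ (mappingCone φ) p ≫
    ((coneComplex τ).map (connecting φ)).f p = G.map (triangleδ φ p) ≫
      inrShift τ K 1 p :=
  (inr_map τ _ _).trans (congrArg (fun t => G.map t ≫ inrShift τ K 1 p) (connecting_f φ p))

lemma inl_triangleδ (p : ℤ) : (mappingCone.inl φ).v (p + 1) p (by omega) ≫ triangleδ φ p =
    -𝟙 _ := by
  rw [triangleδ, comp_neg, mappingCone.inl_v_fst_v]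

lemma inr_triangleδ (p : ℤ) : (mappingCone.inr φ).f p ≫ triangleδ φ p = 0 := by
  rw [triangleδ, comp_neg, mappingCone.inr_f_fst_v, neg_zero]

lemma mappingConeHom_connecting_f (p : ℤ) : (mappingConeHom τ φ).f p ≫
    ((coneComplex τ).map (connecting φ)).f p ≫ (shiftXIso τ K 1 p).hom =
      triangleδ ((coneComplex τ).map φ) p := by
  apply mappingCone.ext_from _ (p + 1) p rfl
  · rw [comp_comp_of_eq (inl_mappingConeHom τ φ (p + 1) p rfl), inl_triangleδ]
    apply ext_from τ (p + 1) (p + 1 + 1) rfl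
    · rw [comp_comp_of_eq (inl_mappingConeInl τ φ _ _ _ _ _), neg_comp, Category.assoc,
        comp_comp_of_eq (inl_map_connecting τ φ p), Category.assoc, inlShift_shiftXIso_hom,
        map_comp_eq (inl_triangleδ φ (p + 1))]
      simp
    · rw [comp_comp_of_eq (inr_mappingConeInl τ φ _ _ _), Category.assoc,
        comp_comp_of_eq (inr_map_connecting τ φ p), Category.assoc, inrShift_shiftXIso_hom,
        map_comp_eq (inl_triangleδ φ p)]
      simp
  · rw [comp_comp_of_eq (inr_f_mappingConeHom τ φ p), inr_triangleδ]
    apply ext_from τ p (p + 1) rfl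
    · rw [comp_comp_of_eq (inl_map τ _ _ _ _), Category.assoc,
        comp_comp_of_eq (inl_map_connecting τ φ p), Category.assoc,
        map_comp_eq (inr_triangleδ φ (p + 1))]
      simp
    · rw [comp_comp_of_eq (inr_map τ _ _), Category.assoc,
        comp_comp_of_eq (inr_map_connecting τ φ p), Category.assoc,
        map_comp_eq (inr_triangleδ φ p)]
      simp

/-- The sign in `mappingConeInl` on the summand of `F` cancels against the sign of `shiftXIso` for
`n = 1`. This is the third square of a morphism of triangles. -/
lemma mappingConeHom_connecting : mappingConeHom τ φ ≫
    (coneComplex τ).map (connecting φ) ≫ ((coneComplex τ).commShiftIso (1 : ℤ)).hom.app K =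
      connecting ((coneComplex τ).map φ) := by
  ext p
  refine Eq.trans ?_ (connecting_f _ p).symm
  exact mappingConeHom_connecting_f τ φ p

/-- The cone functor maps the standard triangle of `φ` to the standard triangle of the image. -/
def mapTriangleIso : mappingCone.triangle ((coneComplex τ).map φ) ≅
    (coneComplex τ).mapTriangle.obj (mappingCone.triangle φ) :=
  Pretriangulated.Triangle.isoMk _ _ (Iso.refl _) (Iso.refl _) 
    (@asIso _ _ _ _ (mappingConeHom τ φ) (isIso_mappingConeHom τ φ))
    ((Category.comp_id _).trans (Category.id_comp _).symm)
    ((inr_mappingConeHom τ φ).trans (Category.id_comp _).symm)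
    ((congrArg _ (CategoryTheory.Functor.map_id _ _)).trans ((Category.comp_id _).trans
      (mappingConeHom_connecting τ φ).symm))

end coneComplex

/-- The isomorphism between the cone functors on complexes and on the homotopy category. -/
def coneHomotopyFactors : HomotopyCategory.quotient _ _ ⋙ coneHomotopy τ ≅
    coneComplex τ ⋙ HomotopyCategory.quotient _ _ :=
  CategoryTheory.Quotient.lift.isLift _ _ _

instance : (coneHomotopy τ).CommShift ℤ :=
  inferInstanceAs ((CategoryTheory.Quotient.lift _ _ _).CommShift ℤ)

instance : NatTrans.CommShift (coneHomotopyFactors τ).hom ℤ :=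
  inferInstanceAs (NatTrans.CommShift (CategoryTheory.Quotient.lift.isLift _ _ _).hom ℤ)

/-- The cone functor maps the standard triangle of `φ` to the standard triangle of the image. -/
def coneHomotopyTriangleIso {K L : CochainComplex C ℤ} (φ : K ⟶ L) :
    (coneHomotopy τ).mapTriangle.obj (mappingCone.triangleh φ) ≅
      mappingCone.triangleh ((coneComplex τ).map φ) :=
  (Functor.mapTriangleCompIso _ _).symm.app _ ≪≫
    (Functor.mapTriangleIso (coneHomotopyFactors τ)).app _ ≪≫
    (Functor.mapTriangleCompIso _ _).app _ ≪≫
    (HomotopyCategory.quotient C (ComplexShape.up ℤ)).mapTriangle.mapIso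
      (coneComplex.mapTriangleIso τ φ).symm

/-- Distinguished triangles are those isomorphic to a standard triangle of a morphism of complexes,
and `coneHomotopyTriangleIso` treats these. -/
instance [HasZeroObject C] : (coneHomotopy τ).IsTriangulated where
  map_distinguished := by
    rintro T ⟨K, L, f, ⟨e⟩⟩
    exact ⟨_, _, _, ⟨(coneHomotopy τ).mapTriangle.mapIso e ≪≫ coneHomotopyTriangleIso τ f⟩⟩

instance : (boundedCone τ).CommShift ℤ :=
  inferInstanceAs (((bounded C).lift ((bounded C).ι ⋙ coneHomotopy τ) _).CommShift ℤ)

instance [HasZeroObject C] : (boundedCone τ).IsTriangulated :=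
  inferInstanceAs (((bounded C).lift ((bounded C).ι ⋙ coneHomotopy τ) _).IsTriangulated)

section Linear

variable (R : Type*) [Semiring R] [CategoryTheory.Linear R C] [F.Linear R] [G.Linear R]

instance : (coneComplex τ).Additive where
  map_add {K L f g} := by
    ext p
    rw [HomologicalComplex.add_f_apply]
    apply coneComplex.ext_from τ p _ rfl <;> simp

instance : (coneComplex τ).Linear R where
  map_smul {K L} f r := by
    ext p
    rw [HomologicalComplex.smul_f_apply]
    apply coneComplex.ext_from τ p _ rfl <;> simp

instance : (coneHomotopy τ).Linear R where
  map_smul {K L} f r := by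
    obtain ⟨f, rfl⟩ := (HomotopyCategory.quotient _ _).map_surjective f
    refine (congrArg (coneHomotopy τ).map ((HomotopyCategory.quotient _ _).map_smul r f).symm).trans ?_
    change (HomotopyCategory.quotient _ _).map ((coneComplex τ).map (r • f)) =
      r • (HomotopyCategory.quotient _ _).map ((coneComplex τ).map f)
    rw [Functor.map_smul, Functor.map_smul]

instance : (boundedCone τ).Linear R where
  map_smul {K L} f r := by
    ext
    exact Functor.map_smul (coneHomotopy τ) r f.hom

end Linear
end ConeTriangle

/-! ### Coordinates on the projective modules -/

section Coefficients

variable (k : Type u) [Field k] {n : ℕ}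

/-- The space underlying the module `A e_i`: coefficients of `e_i`, of `z_i` and of the arrows
`arr c j i`. -/
abbrev ProjModel (k : Type u) (n : ℕ) := k × k × (Edge → Fin n → k)

/-- The action of the generators on `A e_i`. -/
def genAct (i : Fin n) : Gen n → ProjModel k n →ₗ[k] ProjModel k n
  | .e l =>
    { toFun := fun v => (if l = i then v.1 else 0, if l = i then v.2.1 else 0,
        fun c j => if l = j then v.2.2 c j else 0)
      map_add' := fun v v' => by
        refine Prod.ext ?_ (Prod.ext ?_ (funext fun c => funext fun j => ?_)) <;>
        simp <;> split_ifs <;> simp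
      map_smul' := fun r v => by
        refine Prod.ext ?_ (Prod.ext ?_ (funext fun c => funext fun j => ?_)) <;>
        simp }
  | .z l =>
    { toFun := fun v => (0, if l = i then v.1 else 0, 0)
      map_add' := fun v v' => by
        refine Prod.ext ?_ (Prod.ext ?_ (funext fun c => funext fun j => ?_)) <;>
        simp <;> split_ifs <;> simp
      map_smul' := fun r v => by
        refine Prod.ext ?_ (Prod.ext ?_ (funext fun c => funext fun j => ?_)) <;>
        simp }
  -- The coordinates with `j = i` belong to no arrow. They are harmless: since `p ≠ q`, this
  -- operator neither reads nor writes them, and they vanish on everything generated by `(1, 0, 0)`.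
  | .arr c p q _ =>
    { toFun := fun v => (0, if p = i then v.2.2 c q else 0,
        fun d j => if q = i ∧ d = c ∧ j = p then v.1 else 0)
      map_add' := fun v v' => by
        refine Prod.ext ?_ (Prod.ext ?_ (funext fun c => funext fun j => ?_)) <;>
        simp <;> split_ifs <;> simp
      map_smul' := fun r v => by
        refine Prod.ext ?_ (Prod.ext ?_ (funext fun c => funext fun j => ?_)) <;>
        simp }

lemma genAct_e (i l : Fin n) (v : ProjModel k n) : genAct k i (.e l) v =
    (if l = i then v.1 else 0, if l = i then v.2.1 else 0,
        fun c j => if l = j then v.2.2 c j else 0) := rfl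

lemma genAct_z (i l : Fin n) (v : ProjModel k n) : genAct k i (.z l) v =
    (0, if l = i then v.1 else 0, 0) := rfl

lemma genAct_arr (i : Fin n) (c : Edge) (p q : Fin n) (h : p ≠ q) (v : ProjModel k n) :
    genAct k i (.arr c p q h) v = (0, if p = i then v.2.2 c q else 0,
        fun d j => if q = i ∧ d = c ∧ j = p then v.1 else 0) := rfl

/-- The action of the zigzag algebra on `A e_i`, in coordinates. -/
def modelAct (i : Fin n) : Zigzag k n →ₐ[k] Module.End k (ProjModel k n) :=
  RingQuot.liftAlgHom k ⟨FreeAlgebra.lift k (genAct k i), by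
    intro a b h
    refine LinearMap.ext fun v => ?_
    cases h with
    | sum_e =>
      simp only [map_sum, FreeAlgebra.lift_ι_apply, map_one, Module.End.one_apply,
        LinearMap.sum_apply, genAct_e]
      refine Prod.ext ?_ (Prod.ext ?_ (funext fun c => funext fun j => ?_)) <;>
      simp [Prod.fst_sum, Prod.snd_sum]
    | _ =>
      simp only [map_mul, FreeAlgebra.lift_ι_apply, Module.End.mul_apply, genAct_e, genAct_z,
        genAct_arr, map_zero, LinearMap.zero_apply]
      refine Prod.ext ?_ (Prod.ext ?_ (funext fun c => funext fun j => ?_)) <;>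
      simp <;> grind⟩

lemma modelAct_gen (i : Fin n) (s : Gen n) : modelAct k i (gen k s) = genAct k i s := by
  have : modelAct k i (quot k (FreeAlgebra.ι k s)) =
      FreeAlgebra.lift k (genAct k i) (FreeAlgebra.ι k s) :=
    RingQuot.liftAlgHom_mkAlgHom_apply _ _ _ _
  rw [FreeAlgebra.lift_ι_apply] at this
  exact this

/-- The coefficient of `e_i`. -/
def coefE (i : Fin n) : Zigzag k n →ₗ[k] k where
  toFun a := (modelAct k i a (1, 0, 0)).1
  map_add' a b := by simp
  map_smul' r a := by simp

/-- The coefficient of `z_i`. -/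
def coefZ (i : Fin n) : Zigzag k n →ₗ[k] k where
  toFun a := (modelAct k i a (1, 0, 0)).2.1
  map_add' a b := by simp
  map_smul' r a := by simp

/-- The coefficient of the arrow `arr c j i`. -/
def coefArr (i : Fin n) (c : Edge) (j : Fin n) : Zigzag k n →ₗ[k] k where
  toFun a := (modelAct k i a (1, 0, 0)).2.2 c j
  map_add' a b := by simp
  map_smul' r a := by simp

/-- The vector `(1, 0, 0)` represents `e_i`, so acting on it reads off the coordinates of `a e_i`.
The model certifies that the presentation hides no further relation; in particular `z_i ≠ 0`. -/
lemma coefE_gen (i : Fin n) (s : Gen n) : coefE k i (gen k s) = (genAct k i s (1, 0, 0)).1 := by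
  rw [← modelAct_gen]; rfl

lemma coefZ_gen (i : Fin n) (s : Gen n) : coefZ k i (gen k s) = (genAct k i s (1, 0, 0)).2.1 := by
  rw [← modelAct_gen]; rfl

lemma coefArr_gen (i : Fin n) (c : Edge) (j : Fin n) (s : Gen n) :
    coefArr k i c j (gen k s) = (genAct k i s (1, 0, 0)).2.2 c j := by
  rw [← modelAct_gen]; rfl

@[simp] lemma coefE_idem (i : Fin n) : coefE k i (idem k i) = 1 := by simp [coefE_gen, genAct_e]
@[simp] lemma coefZ_idem (i : Fin n) (l : Fin n) : coefZ k i (idem k l) = 0 := by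
  simp [coefZ_gen, genAct_e]
@[simp] lemma coefZ_z (i : Fin n) : coefZ k i (gen k (.z i)) = 1 := by simp [coefZ_gen, genAct_z]
@[simp] lemma coefZ_arr (i : Fin n) (c : Edge) (p q : Fin n) (h : p ≠ q) :
    coefZ k i (gen k (.arr c p q h)) = 0 := by simp [coefZ_gen, genAct_arr]

/-- Linear maps out of the zigzag algebra are determined on generators. -/
lemma zigzag_linear_ext {V : Type*} [AddCommGroup V] [Module k V] {f g : Zigzag k n →ₗ[k] V}
    (h : ∀ s, f (gen k s) = g (gen k s)) : f = g :=
  LinearMap.ext_on_range (span_gen k) h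

/-- The space `e_i A e_i` has basis `e_i`, `z_i`. -/
lemma idem_mul_mul_idem (i : Fin n) (a : Zigzag k n) :
    idem k i * a * idem k i = coefE k i a • idem k i + coefZ k i a • gen k (.z i) := by
  have := LinearMap.congr_fun (zigzag_linear_ext k
    (f := LinearMap.mulRight k (idem k i) ∘ₗ LinearMap.mulLeft k (idem k i))
    (g := (coefE k i).smulRight (idem k i) + (coefZ k i).smulRight (gen k (.z i))) ?_) a
  · simpa using this
  intro s
  simp only [LinearMap.comp_apply, LinearMap.mulLeft_apply, LinearMap.mulRight_apply,
    LinearMap.add_apply, LinearMap.smulRight_apply, coefE_gen, coefZ_gen]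
  by_cases h₁ : i = s.src
  swap
  · rw [gen_mul_gen_of_ne k (s := .e i) (t := s) h₁, zero_mul]
    cases s <;> simp_all [genAct_e, genAct_z, genAct_arr, Gen.src] <;> grind
  by_cases h₂ : s.tgt = i
  swap
  · rw [mul_assoc, gen_mul_gen_of_ne k (s := s) (t := .e i) h₂, mul_zero]
    cases s <;> simp_all [genAct_e, genAct_z, genAct_arr, Gen.tgt] <;> grind
  have h₃ : idem k i * gen k s * idem k i = gen k s := by
    rw [h₁, idem_src_mul, ← h₁, ← h₂, mul_idem_tgt]
  rw [h₃]
  cases s with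
  | arr c p q h => exact absurd (h₁.symm.trans h₂.symm) h
  | _ => simp_all [genAct_e, genAct_z, Gen.src, Gen.tgt]

end Coefficients

/-! ### Splittings for the zigzag algebra, and the twists as equivalences -/

section Splittings

variable {n : ℕ} {G : Type} [AddCommGroup G] [DecidableEq G]
variable {k : Type u} [Field k] {w : Weight n G}

/-- The coefficient of `z_i` is a linear form of degree `deg z`: on generators it is compatible with
the coaction that records degrees. This is why the retraction below is a graded morphism. -/
lemma coefZ_of_mem_piece (i : Fin n) {g : G} {a : Zigzag k n} (ha : a ∈ w.piece k g)
    (hg : g ≠ w.z) : coefZ k i a = 0 := by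
  have key : Finsupp.mapRange.linearMap (coefZ k i) ∘ₗ GrProj.coactLin k w =
      Finsupp.lsingle w.z ∘ₗ coefZ k i := by
    refine zigzag_linear_ext k fun s => ?_
    have h : GrProj.coactLin k w (gen k s) = Finsupp.single (w.deg s) (gen k s) := by
      simp [GrProj.coactLin, coact_gen]
    rw [LinearMap.comp_apply, h, LinearMap.comp_apply, Finsupp.mapRange.linearMap_apply,
      Finsupp.mapRange_single, Finsupp.lsingle_apply]
    cases s with
    | z l => rfl
    | e l => simp
    | arr c p q h => simp
  have h : GrProj.coactLin k w a = Finsupp.single g a := by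
    simp [GrProj.coactLin, coact_of_mem w k ha]
  have := LinearMap.congr_fun key a
  rw [LinearMap.comp_apply, h, LinearMap.comp_apply, Finsupp.mapRange.linearMap_apply,
    Finsupp.mapRange_single, Finsupp.lsingle_apply] at this
  have h' := DFunLike.congr_fun this g
  rwa [Finsupp.single_eq_same, Finsupp.single_eq_of_ne hg] at h'

namespace GrProj

variable {M N : GrProj k w}

/-- The generator `e_i` of `A e_i`. -/
abbrev idemP (k : Type u) [Field k] (i : Fin n) : leftIdeal k i := inP k i (idem k i)

lemma coe_idemP (i : Fin n) : (idemP k i : Zigzag k n) = idem k i := idem_mul_idem k i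

lemma smul_idemP (i : Fin n) (p : leftIdeal k i) : (p : Zigzag k n) • idemP k i = p :=
  Subtype.ext (by
    rw [Submodule.coe_smul, coe_idemP, smul_eq_mul, mem_leftIdeal.1 p.2])

lemma inP_eq (i : Fin n) (a : Zigzag k n) : inP k i a = a • idemP k i :=
  Subtype.ext (by rw [coe_inP, Submodule.coe_smul, coe_idemP, smul_eq_mul])

/-- Homomorphisms out of `A e_i ⊗ V` are determined by their restriction to `e_i ⊗ V`. -/
lemma tensor_linear_ext (i : Fin n) {V W : Type*} [AddCommGroup V] [Module k V]
    [AddCommGroup W] [Module (Zigzag k n) W] {f g : leftIdeal k i ⊗[k] V →ₗ[Zigzag k n] W}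
    (h : ∀ v, f (idemP k i ⊗ₜ v) = g (idemP k i ⊗ₜ v)) : f = g := by
  refine LinearMap.ext fun t => ?_
  induction t using TensorProduct.induction_on with
  | zero => rw [map_zero, map_zero]
  | tmul p v => rw [← smul_idemP i p, ← smul_tmul', map_smul, map_smul, h]
  | add x y hx hy => rw [map_add, map_add, hx, hy]

/-- The coefficient of `z_i` on `A e_i ⊗ e_i M`. -/
def coefTensor (i : Fin n) (M : GrProj k w) : leftIdeal k i ⊗[k] M.corner i →ₗ[k] M.corner i :=
  TensorProduct.lift (LinearMap.lsmul k (M.corner i) ∘ₗ coefZ k i ∘ₗ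
    (leftIdeal k i).subtype.restrictScalars k)

@[simp] lemma coefTensor_tmul (i : Fin n) (p : leftIdeal k i) (v : M.corner i) :
    coefTensor i M (p ⊗ₜ v) = coefZ k i p • v := rfl

/-- Extracting the coefficient of `z_i` lowers degrees by `deg z`, which the shift in the target of
`g_i` absorbs. -/
lemma coefTensor_mem (i : Fin n) (g : G) :
    tensorPiece M i (g + w.z) ≤
      ((M.piece g).comap (M.corner i).subtype).comap (coefTensor i M) := by
  refine Submodule.span_le.2 ?_
  rintro _ ⟨c, d, p, v, h, hp, hv, rfl⟩
  change ((coefZ k i p • v : M.corner i) : M) ∈ M.piece g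
  by_cases hc : c = w.z
  · subst hc
    obtain rfl : d = g := by rw [add_comm] at h; exact add_right_cancel h
    exact Submodule.smul_mem _ _ hv
  · rw [coefZ_of_mem_piece i hp hc, zero_smul]
    exact Submodule.zero_mem _

/-- The inclusion `v ↦ e_i ⊗ v` of `e_i M` into `e_i (A e_i ⊗ e_i M)`. -/
def unitCorner (i : Fin n) (M : GrProj k w) : M.corner i →ₗ[k] (tensorObj i M).corner i :=
  LinearMap.codRestrict _ (TensorProduct.mk k (leftIdeal k i) (M.corner i) (idemP k i)) (by
    intro v
    rw [mem_corner]
    change idem k i • (idemP k i ⊗ₜ[k] v) = idemP k i ⊗ₜ v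
    rw [smul_tmul', ← inP_eq])

/-- The inclusion of `e_i (A e_i ⊗ e_i M)` into `A e_i ⊗ e_i M`. -/
def tensorCoe (i : Fin n) (M : GrProj k w) :
    (tensorObj i M).corner i →ₗ[k] leftIdeal k i ⊗[k] M.corner i :=
  ((tensorObj i M).corner i).subtype

/-- The projection of `A e_i ⊗ e_i M` to `e_i (A e_i ⊗ e_i M)`. -/
def inCTensor (i : Fin n) (M : GrProj k w) :
    leftIdeal k i ⊗[k] M.corner i →ₗ[k] (tensorObj i M).corner i :=
  inC (tensorObj i M) i

lemma tensorCoe_injective (i : Fin n) : Function.Injective (tensorCoe i M) :=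
  Subtype.val_injective

lemma tensorCoe_inCTensor (i : Fin n) (t : leftIdeal k i ⊗[k] M.corner i) :
    tensorCoe i M (inCTensor i M t) = idem k i • t := rfl

lemma tensorCoe_unitCorner (i : Fin n) (v : M.corner i) :
    tensorCoe i M (unitCorner i M v) = idemP k i ⊗ₜ v := rfl

lemma idem_smul_tensorCoe (i : Fin n) (t : (tensorObj i M).corner i) :
    idem k i • tensorCoe i M t = tensorCoe i M t := t.2

lemma unitCorner_mem (i : Fin n) {g : G} {v : M.corner i} (hv : (v : M) ∈ M.piece g) :
    tensorCoe i M (unitCorner i M v) ∈ tensorPiece M i g := by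
  have := tmul_mem_tensorPiece M i (gen_mem_piece w k (.e i)) hv
  rwa [inC_coe, show w.deg (.e i) = 0 from rfl, zero_add] at this

/-- The map `p ⊗ t ↦ p ⊗ coef_z(t)`. -/
def retractLin (i : Fin n) (M : GrProj k w) :
    leftIdeal k i ⊗[k] (tensorObj i M).corner i →ₗ[Zigzag k n] leftIdeal k i ⊗[k] M.corner i :=
  TensorProduct.AlgebraTensorModule.map LinearMap.id (coefTensor i M ∘ₗ tensorCoe i M)

/-- The map `p ⊗ v ↦ p ⊗ (e_i ⊗ v)`. -/
def sectionLin (i : Fin n) (M : GrProj k w) :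
    leftIdeal k i ⊗[k] M.corner i →ₗ[Zigzag k n] leftIdeal k i ⊗[k] (tensorObj i M).corner i :=
  TensorProduct.AlgebraTensorModule.map LinearMap.id (unitCorner i M)

lemma retractLin_tmul (i : Fin n) (p : leftIdeal k i) (t : (tensorObj i M).corner i) :
    retractLin i M (p ⊗ₜ t) = p ⊗ₜ coefTensor i M (tensorCoe i M t) := rfl

lemma sectionLin_tmul (i : Fin n) (p : leftIdeal k i) (v : M.corner i) :
    sectionLin i M (p ⊗ₜ v) = p ⊗ₜ unitCorner i M v := rfl

lemma evalLin_tmul (i : Fin n) (p : leftIdeal k i) (v : M.corner i) :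
    evalLin i M (p ⊗ₜ v) = (p : Zigzag k n) • (v : M) := rfl

lemma tensorLin_tmul (i : Fin n) (f : M ⟶ N) (p : leftIdeal k i) (v : M.corner i) :
    tensorLin i f (p ⊗ₜ v) = p ⊗ₜ cornerMap i f v := rfl

lemma coefTensor_unitCorner (i : Fin n) (v : M.corner i) :
    coefTensor i M (tensorCoe i M (unitCorner i M v)) = 0 := by
  rw [tensorCoe_unitCorner, coefTensor_tmul, coe_idemP, coefZ_idem, zero_smul]

lemma retract_section (i : Fin n) : retractLin i M ∘ₗ sectionLin i M = 0 :=
  tensor_linear_ext i fun v => by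
    rw [LinearMap.comp_apply, sectionLin_tmul, retractLin_tmul, coefTensor_unitCorner, tmul_zero]
    rfl

/-- The inclusion `v ↦ z_i ⊗ v` of `e_i M` into `e_i (A e_i ⊗ e_i M)`. -/
def zCorner (i : Fin n) (M : GrProj k w) : M.corner i →ₗ[k] (tensorObj i M).corner i :=
  inCTensor i M ∘ₗ TensorProduct.mk k (leftIdeal k i) (M.corner i) (inP k i (gen k (.z i)))

lemma tensorCoe_zCorner (i : Fin n) (v : M.corner i) :
    tensorCoe i M (zCorner i M v) = inP k i (gen k (.z i)) ⊗ₜ v := by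
  refine (tensorCoe_inCTensor i _).trans ?_
  rw [TensorProduct.mk_apply, smul_tmul', ← map_smul, smul_eq_mul, idem_mul_z]

/-- The space `e_i (A e_i ⊗ e_i M)` is the sum of `e_i ⊗ e_i M` and `z_i ⊗ e_i M`. -/
lemma corner_tensor_eq (i : Fin n) (t : (tensorObj i M).corner i) :
    ∃ u : M.corner i, t = unitCorner i M u + zCorner i M (coefTensor i M (tensorCoe i M t)) := by
  have key : ∀ t : leftIdeal k i ⊗[k] M.corner i, ∃ u : M.corner i,
      idem k i • t = idemP k i ⊗ₜ u + inP k i (gen k (.z i)) ⊗ₜ coefTensor i M t := by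
    intro t
    induction t using TensorProduct.induction_on with
    | zero => exact ⟨0, by simp⟩
    | tmul p v =>
      refine ⟨coefE k i p • v, ?_⟩
      have h := idem_mul_mul_idem k i (p : Zigzag k n)
      rw [mul_assoc, mem_leftIdeal.1 p.2] at h
      rw [coefTensor_tmul, smul_tmul', tmul_smul, tmul_smul, smul_tmul', smul_tmul', ← add_tmul]
      congr 1
      refine Subtype.ext ?_
      change idem k i * p = coefE k i p • (idem k i * idem k i) +
        coefZ k i p • (gen k (.z i) * idem k i)
      rw [h, idem_mul_idem, z_mul_idem]
    | add x y hx hy =>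
      obtain ⟨u, hu⟩ := hx
      obtain ⟨u', hu'⟩ := hy
      refine ⟨u + u', ?_⟩
      rw [smul_add, hu, hu', map_add, tmul_add, tmul_add]
      abel
  obtain ⟨u, hu⟩ := key (tensorCoe i M t)
  refine ⟨u, tensorCoe_injective i ?_⟩
  rw [map_add, tensorCoe_zCorner, tensorCoe_unitCorner, ← hu, idem_smul_tensorCoe]

/-- The value of `g_i` on `e_i M`. -/
lemma coevLin_of_corner (i : Fin n) (N : GrProj k w) (m : N) (hm : idem k i • m = m) :
    coevLin i N m =
      inP k i (gen k (.z i)) ⊗ₜ inC N i m + idemP k i ⊗ₜ inC N i (gen k (.z i) • m) := by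
  rw [coevLin_apply]
  refine (congrArg _ ?_).trans (add_zero _)
  refine Finset.sum_eq_zero fun c _ => Finset.sum_eq_zero fun j _ => ?_
  unfold arrow
  split_ifs with h h'
  · rw [← hm, smul_smul, gen_mul_gen_of_ne k (s := .arr c i j h') (t := .e i) h, zero_smul,
      map_zero, tmul_zero]
  · exact absurd h.symm h'
  · simp
  · simp

/-- Multiplication by `z_i` on `e_i M`. -/
def zMul (i : Fin n) (M : GrProj k w) : M.corner i →ₗ[k] M.corner i :=
  inC M i ∘ₗ Module.toModuleEnd k (S := Zigzag k n) M (gen k (.z i)) ∘ₗ (M.corner i).subtype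

lemma coe_zMul (i : Fin n) (v : M.corner i) : (zMul i M v : M) = gen k (.z i) • (v : M) := by
  change idem k i • gen k (.z i) • (v : M) = _
  rw [smul_smul, idem_mul_z]

lemma coevLin_corner (i : Fin n) (v : M.corner i) :
    coevLin i M v = inP k i (gen k (.z i)) ⊗ₜ v + idemP k i ⊗ₜ zMul i M v := by
  rw [coevLin_of_corner i M v v.2, inC_coe]
  rfl

/-- The unit on `A e_i ⊗ e_i M`. -/
def coevTensor (i : Fin n) (M : GrProj k w) :
    leftIdeal k i ⊗[k] M.corner i →ₗ[Zigzag k n] leftIdeal k i ⊗[k] (tensorObj i M).corner i :=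
  coevALin i (tensorObj i M)

lemma coevTensor_idemP (i : Fin n) (v : M.corner i) : coevTensor i M (idemP k i ⊗ₜ v) =
    inP k i (gen k (.z i)) ⊗ₜ unitCorner i M v + idemP k i ⊗ₜ zCorner i M v := by
  refine (coevLin_corner i (unitCorner i M v)).trans ?_
  congr 2
  refine tensorCoe_injective i ?_
  rw [tensorCoe_zCorner]
  refine (coe_zMul i (unitCorner i M v)).trans ?_
  change gen k (.z i) • (idemP k i ⊗ₜ[k] v : leftIdeal k i ⊗[k] M.corner i) = _
  rw [smul_tmul', ← inP_eq]

/-- The map `e_i (A e_i ⊗ e_i M) ⟶ e_i M` induced by the counit. -/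
def evalCorner (i : Fin n) (M : GrProj k w) : (tensorObj i M).corner i →ₗ[k] M.corner i :=
  cornerMap i (evalHom i M)

lemma coe_evalCorner (i : Fin n) (t : (tensorObj i M).corner i) :
    (evalCorner i M t : M) = evalLin i M (tensorCoe i M t) := rfl

lemma evalCorner_unitCorner (i : Fin n) (v : M.corner i) :
    evalCorner i M (unitCorner i M v) = v := by
  refine Subtype.ext ?_
  rw [coe_evalCorner, tensorCoe_unitCorner, evalLin_tmul, coe_idemP]
  exact v.2

lemma evalCorner_zCorner (i : Fin n) (v : M.corner i) :
    evalCorner i M (zCorner i M v) = zMul i M v := by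
  refine Subtype.ext ?_
  rw [coe_evalCorner, tensorCoe_zCorner, evalLin_tmul, coe_zMul, coe_inP, z_mul_idem]

/-- The map `A e_i ⊗ e_i (A e_i ⊗ e_i M) ⟶ A e_i ⊗ e_i M` induced by the counit. -/
def mapEval (i : Fin n) (M : GrProj k w) :
    leftIdeal k i ⊗[k] (tensorObj i M).corner i →ₗ[Zigzag k n] leftIdeal k i ⊗[k] M.corner i :=
  tensorLin i (evalHom i M)

lemma mapEval_tmul (i : Fin n) (p : leftIdeal k i) (t : (tensorObj i M).corner i) :
    mapEval i M (p ⊗ₜ t) = p ⊗ₜ evalCorner i M t := rfl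

/-- The map `e_i M ⟶ e_i (A e_i ⊗ e_i M)` induced by the unit. -/
def coevCorner (i : Fin n) (M : GrProj k w) : M.corner i →ₗ[k] (tensorObj i M).corner i :=
  cornerMap (N := shiftObj w.z (tensorObj i M)) i (coevHom i M)

lemma coevCorner_apply (i : Fin n) (v : M.corner i) :
    coevCorner i M v = zCorner i M v + unitCorner i M (zMul i M v) := by
  refine tensorCoe_injective i ?_
  rw [map_add, tensorCoe_zCorner, tensorCoe_unitCorner]
  exact coevLin_corner i v

/-- The map `A e_i ⊗ e_i M ⟶ A e_i ⊗ e_i (A e_i ⊗ e_i M)` induced by the unit. -/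
def mapCoev (i : Fin n) (M : GrProj k w) :
    leftIdeal k i ⊗[k] M.corner i →ₗ[Zigzag k n] leftIdeal k i ⊗[k] (tensorObj i M).corner i :=
  tensorLin (N := shiftObj w.z (tensorObj i M)) i (coevHom i M)

lemma mapCoev_tmul (i : Fin n) (p : leftIdeal k i) (v : M.corner i) :
    mapCoev i M (p ⊗ₜ v) = p ⊗ₜ coevCorner i M v := rfl

/-- The counit on `A e_i ⊗ e_i M`. -/
def evalTensor (i : Fin n) (M : GrProj k w) :
    leftIdeal k i ⊗[k] (tensorObj i M).corner i →ₗ[Zigzag k n] leftIdeal k i ⊗[k] M.corner i :=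
  evalLin i (tensorObj i M)

lemma evalTensor_tmul (i : Fin n) (p : leftIdeal k i) (t : (tensorObj i M).corner i) :
    evalTensor i M (p ⊗ₜ t) = (p : Zigzag k n) • tensorCoe i M t := rfl

lemma coefTensor_zCorner (i : Fin n) (v : M.corner i) :
    coefTensor i M (tensorCoe i M (zCorner i M v)) = v := by
  rw [tensorCoe_zCorner, coefTensor_tmul, coe_inP, z_mul_idem, coefZ_z, one_smul]

lemma retract_coevTensor (i : Fin n) : retractLin i M ∘ₗ coevTensor i M = LinearMap.id :=
  tensor_linear_ext i fun v => by
    rw [LinearMap.comp_apply, coevTensor_idemP, map_add, retractLin_tmul, retractLin_tmul,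
      coefTensor_unitCorner, coefTensor_zCorner, tmul_zero, zero_add]
    rfl

lemma mapEval_section (i : Fin n) : mapEval i M ∘ₗ sectionLin i M = LinearMap.id :=
  tensor_linear_ext i fun v => by
    rw [LinearMap.comp_apply, sectionLin_tmul, mapEval_tmul, evalCorner_unitCorner]
    rfl

lemma retract_mapCoev (i : Fin n) : retractLin i M ∘ₗ mapCoev i M = LinearMap.id :=
  tensor_linear_ext i fun v => by
    rw [LinearMap.comp_apply, mapCoev_tmul, retractLin_tmul, coevCorner_apply, map_add, map_add,
      coefTensor_unitCorner, coefTensor_zCorner, add_zero]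
    rfl

lemma evalTensor_section (i : Fin n) : evalTensor i M ∘ₗ sectionLin i M = LinearMap.id :=
  tensor_linear_ext i fun v => by
    rw [LinearMap.comp_apply, sectionLin_tmul, evalTensor_tmul, tensorCoe_unitCorner, smul_tmul',
      smul_idemP]
    rfl

/-- The correction term of both splittings, evaluated on generators. -/
lemma section_coev_eval_retract (i : Fin n) (t : (tensorObj i M).corner i) :
    sectionLin i M (coevALin i M (evalLin i M (retractLin i M (idemP k i ⊗ₜ t)))) =
      inP k i (gen k (.z i)) ⊗ₜ unitCorner i M (coefTensor i M (tensorCoe i M t)) +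
      idemP k i ⊗ₜ unitCorner i M (zMul i M (coefTensor i M (tensorCoe i M t))) := by
  rw [retractLin_tmul, evalLin_tmul, coe_idemP, mem_corner.1 (Subtype.prop _)]
  change sectionLin i M (coevLin i M _) = _
  rw [coevLin_corner, map_add, sectionLin_tmul, sectionLin_tmul]

/-- Let `t = e_i ⊗ u + z_i ⊗ v`. The first term is `z_i ⊗ (e_i ⊗ v) + e_i ⊗ (z_i ⊗ v)`, the second
is `e_i ⊗ (e_i ⊗ (u + z_i v))`, and the correction removes `z_i ⊗ (e_i ⊗ v)` and `e_i ⊗ (e_i ⊗ z_i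
v)`. What is left is `e_i ⊗ t`. -/
lemma left_total (i : Fin n) : coevTensor i M ∘ₗ retractLin i M + sectionLin i M ∘ₗ mapEval i M -
    sectionLin i M ∘ₗ coevALin i M ∘ₗ evalLin i M ∘ₗ retractLin i M = LinearMap.id :=
  tensor_linear_ext i fun t => by
    obtain ⟨u, hu⟩ := corner_tensor_eq i t
    have h := section_coev_eval_retract i t
    simp only [LinearMap.sub_apply, LinearMap.add_apply, LinearMap.comp_apply]
    rw [h, retractLin_tmul, coevTensor_idemP, mapEval_tmul, sectionLin_tmul]
    set v := coefTensor i M (tensorCoe i M t)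
    rw [hu, map_add, evalCorner_unitCorner, evalCorner_zCorner, map_add, tmul_add]
    refine Eq.trans ?_ (tmul_add _ _ _).symm
    abel

/-- The same cancellation, except that now `e_i ⊗ (e_i ⊗ z_i v)` comes from the first term and `z_i
⊗ (e_i ⊗ v)` from the second. -/
lemma right_total (i : Fin n) : mapCoev i M ∘ₗ retractLin i M + sectionLin i M ∘ₗ evalTensor i M -
    sectionLin i M ∘ₗ coevALin i M ∘ₗ evalLin i M ∘ₗ retractLin i M = LinearMap.id :=
  tensor_linear_ext i fun t => by
    obtain ⟨u, hu⟩ := corner_tensor_eq i t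
    have h := section_coev_eval_retract i t
    simp only [LinearMap.sub_apply, LinearMap.add_apply, LinearMap.comp_apply]
    rw [h, retractLin_tmul, mapCoev_tmul, evalTensor_tmul, coe_idemP, idem_smul_tensorCoe,
      coevCorner_apply]
    set v := coefTensor i M (tensorCoe i M t)
    rw [hu, map_add, tensorCoe_unitCorner, tensorCoe_zCorner, map_add, sectionLin_tmul,
      sectionLin_tmul, tmul_add]
    refine Eq.trans ?_ (tmul_add _ _ _).symm
    abel

lemma coefTensor_natural (i : Fin n) (f : M ⟶ N) (t : leftIdeal k i ⊗[k] M.corner i) :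
    coefTensor i N (tensorLin i f t) = cornerMap i f (coefTensor i M t) := by
  induction t using TensorProduct.induction_on with
  | zero => simp
  | tmul p v => rw [tensorLin_tmul, coefTensor_tmul, coefTensor_tmul, map_smul]
  | add x y hx hy => rw [map_add, map_add, hx, hy, map_add, map_add]

/-- The map on `e_i (A e_i ⊗ e_i M)` induced by a morphism. -/
def tensorCornerMap (i : Fin n) (f : M ⟶ N) :
    (tensorObj i M).corner i →ₗ[k] (tensorObj i N).corner i :=
  cornerMap i (tensorMap i f)

lemma tensorCoe_tensorCornerMap (i : Fin n) (f : M ⟶ N) (t : (tensorObj i M).corner i) :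
    tensorCoe i N (tensorCornerMap i f t) = tensorLin i f (tensorCoe i M t) := rfl

/-- The map on `A e_i ⊗ e_i (A e_i ⊗ e_i M)` induced by a morphism. -/
def tensorTensorLin (i : Fin n) (f : M ⟶ N) :
    leftIdeal k i ⊗[k] (tensorObj i M).corner i →ₗ[Zigzag k n]
      leftIdeal k i ⊗[k] (tensorObj i N).corner i :=
  tensorLin i (tensorMap i f)

lemma tensorTensorLin_tmul (i : Fin n) (f : M ⟶ N) (p : leftIdeal k i)
    (t : (tensorObj i M).corner i) :
    tensorTensorLin i f (p ⊗ₜ t) = p ⊗ₜ tensorCornerMap i f t := rfl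

lemma retract_natural (i : Fin n) (f : M ⟶ N) :
    retractLin i N ∘ₗ tensorTensorLin i f = tensorLin i f ∘ₗ retractLin i M :=
  tensor_linear_ext i fun t => by
    rw [LinearMap.comp_apply, LinearMap.comp_apply, tensorTensorLin_tmul, retractLin_tmul,
      tensorCoe_tensorCornerMap, coefTensor_natural, retractLin_tmul, tensorLin_tmul]

lemma section_natural (i : Fin n) (f : M ⟶ N) :
    sectionLin i N ∘ₗ tensorLin i f = tensorTensorLin i f ∘ₗ sectionLin i M :=
  tensor_linear_ext i fun v => by
    rw [LinearMap.comp_apply, LinearMap.comp_apply, sectionLin_tmul, tensorLin_tmul,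
      tensorTensorLin_tmul, sectionLin_tmul]
    rfl

/-- Left and right composites have the same underlying linear maps. They differ only in whether the
shift by `deg z` is applied outside or inside the outer tensor product, so only the degree
bookkeeping is done twice. -/
lemma retractLin_mem_left (i : Fin n) (g : G) : tensorPiece (tensorObj i M) i (g + w.z) ≤
    (tensorPiece M i g).comap ((retractLin i M).restrictScalars k) := by
  refine Submodule.span_le.2 ?_
  rintro _ ⟨c, d, p, v, h, hp, hv, rfl⟩
  refine Submodule.subset_span ⟨c, d - w.z, p, _, ?_, hp, coefTensor_mem i _ (?_ : _ ∈ _), rfl⟩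
  · rw [← add_sub_assoc, h, add_sub_cancel_right]
  · rw [sub_add_cancel]; exact hv

lemma retractLin_mem_right (i : Fin n) (g : G) :
    tensorPiece (shiftObj w.z (tensorObj i M)) i g ≤
    (tensorPiece M i g).comap ((retractLin i M).restrictScalars k) := by
  refine Submodule.span_le.2 ?_
  rintro _ ⟨c, d, p, v, h, hp, hv, rfl⟩
  exact Submodule.subset_span ⟨c, d, p, _, h, hp, coefTensor_mem i _ hv, rfl⟩

lemma sectionLin_mem_left (i : Fin n) (g : G) : tensorPiece M i g ≤
    (tensorPiece (tensorObj i M) i g).comap ((sectionLin i M).restrictScalars k) := by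
  refine Submodule.span_le.2 ?_
  rintro _ ⟨c, d, p, v, h, hp, hv, rfl⟩
  exact Submodule.subset_span ⟨c, d, p, _, h, hp, unitCorner_mem i hv, rfl⟩

lemma sectionLin_mem_right (i : Fin n) (g : G) : tensorPiece M i (g + w.z) ≤
    (tensorPiece (shiftObj w.z (tensorObj i M)) i g).comap
      ((sectionLin i M).restrictScalars k) := by
  refine Submodule.span_le.2 ?_
  rintro _ ⟨c, d, p, v, h, hp, hv, rfl⟩
  refine Submodule.subset_span ⟨c, d - w.z, p, unitCorner i M v, ?_, hp, ?_, rfl⟩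
  · rw [← add_sub_assoc, h, add_sub_cancel_right]
  · change tensorCoe i M (unitCorner i M v) ∈ tensorPiece M i (d - w.z + w.z)
    rw [sub_add_cancel]; exact unitCorner_mem i hv

/-- The splitting for the composition of `Σ_i⁻¹` and `Σ_i`. -/
def leftSplitting (i : Fin n) : LeftSplitting (evalNat (k := k) (w := w) i) (coevNat i) where
  r M := ofLin (M := shiftObj w.z (tensorObj i (tensorObj i M))) (N := tensorObj i M)
    (retractLin i M) (fun {g _} hm => retractLin_mem_left i g hm)
  s M := ofLin (M := shiftObj w.z (tensorObj i M))
    (N := shiftObj w.z (tensorObj i (tensorObj i M)))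
    (sectionLin i M) (fun {g _} hm => sectionLin_mem_left i (g + w.z) hm)
  map_r f := toLin_injective (retract_natural i f)
  map_s f := toLin_injective (section_natural i f)
  unit_r M := toLin_injective (retract_coevTensor i)
  s_counit M := toLin_injective (mapEval_section i)
  s_r M := toLin_injective (retract_section i)
  total M := toLin_injective (left_total i)

/-- The splitting for the composition of `Σ_i` and `Σ_i⁻¹`. -/
def rightSplitting (i : Fin n) : RightSplitting (evalNat (k := k) (w := w) i) (coevNat i) where
  r M := ofLin (M := tensorObj i (shiftObj w.z (tensorObj i M))) (N := tensorObj i M)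
    (retractLin i M) (fun {g _} hm => retractLin_mem_right i g hm)
  s M := ofLin (M := shiftObj w.z (tensorObj i M))
    (N := tensorObj i (shiftObj w.z (tensorObj i M)))
    (sectionLin i M) (fun {g _} hm => sectionLin_mem_right i g hm)
  map_r f := toLin_injective (retract_natural i f)
  map_s f := toLin_injective (section_natural i f)
  unit_r M := toLin_injective (retract_mapCoev i)
  s_counit M := toLin_injective (evalTensor_section i)
  s_r M := toLin_injective (retract_section i)
  total M := toLin_injective (right_total i)

end GrProj

open GrProj

/-- The composition of `Σ_i⁻¹` and `Σ_i` is the identity. -/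
def twistInvTwistIso (i : Fin n) : twistInv (k := k) (w := w) i ⋙ twist i ≅ 𝟭 _ :=
  (Functor.associator _ _ _).symm ≪≫
    Functor.isoWhiskerRight (leftSplitting i).boundedConeIso _ ≪≫
    (shiftFunctorCompIsoId (DCat k w) (1 : ℤ) (-1) (by norm_num))

/-- The composition of `Σ_i` and `Σ_i⁻¹` is the identity. -/
def twistTwistInvIso (i : Fin n) : twist (k := k) (w := w) i ⋙ twistInv i ≅ 𝟭 _ :=
  Functor.associator _ _ _ ≪≫
    -- The shift by `-1` contained in `Σ_i` stands between the two cones and has to be moved past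
    -- the second one first.
    Functor.isoWhiskerLeft _ ((boundedCone (evalNat (k := k) (w := w) i)).commShiftIso (-1 : ℤ)) ≪≫
    (Functor.associator _ _ _).symm ≪≫
    Functor.isoWhiskerRight (rightSplitting i).boundedConeIso _ ≪≫
    (shiftFunctorCompIsoId (DCat k w) (1 : ℤ) (-1) (by norm_num))

/-- The auto-equivalence `Σ_i` of `𝒟`, with inverse `Σ_i⁻¹`. -/
def twistEquiv (i : Fin n) : DCat k w ≌ DCat k w :=
  CategoryTheory.Equivalence.mk (twist i) (twistInv i) (twistTwistInvIso i).symm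
    (twistInvTwistIso i)

end Splittings

/-! ### Ranks and dimensions in long exact sequences -/

section Ranks

variable {k : Type u} [Field k]

/-- The rank of a morphism of vector spaces. -/
def rank {A B : ModuleCat.{u} k} (f : A ⟶ B) : ℕ := Module.finrank k (LinearMap.range f.hom)

lemma rank_comp_of_isIso_left {A B C : ModuleCat.{u} k} (u : A ⟶ B) [IsIso u] (f : B ⟶ C) :
    rank (u ≫ f) = rank f := by
  rw [rank, rank, ModuleCat.hom_comp, LinearMap.range_comp_of_range_eq_top]
  exact LinearMap.range_eq_top.2 ((ModuleCat.epi_iff_surjective u).1 inferInstance)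

lemma rank_comp_of_isIso_right {A B C : ModuleCat.{u} k} (f : A ⟶ B) (u : B ⟶ C) [IsIso u] :
    rank (f ≫ u) = rank f := by
  rw [rank, rank, ModuleCat.hom_comp, LinearMap.range_comp]
  exact (asIso u).toLinearEquiv.finrank_map_eq _

lemma finrank_eq_of_iso {A B : ModuleCat.{u} k} (e : A ≅ B) :
    Module.finrank k A = Module.finrank k B := e.toLinearEquiv.finrank_eq

lemma rank_add_rank_le {A B C : ModuleCat.{u} k} [Module.Finite k B] (f : A ⟶ B) (g : B ⟶ C)
    (w : f ≫ g = 0) : rank f + rank g ≤ Module.finrank k B := by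
  rw [← LinearMap.finrank_range_add_finrank_ker g.hom, add_comm]
  refine Nat.add_le_add_left (Submodule.finrank_mono ?_) _
  rintro _ ⟨a, rfl⟩
  exact LinearMap.congr_fun (congrArg ModuleCat.Hom.hom w) a

lemma rank_add_rank_of_exact {A B C : ModuleCat.{u} k} [Module.Finite k B] (f : A ⟶ B) (g : B ⟶ C)
    (w : f ≫ g = 0) (h : (ShortComplex.mk f g w).Exact) :
    rank f + rank g = Module.finrank k B := by
  rw [← LinearMap.finrank_range_add_finrank_ker g.hom, add_comm, rank, rank,
    show LinearMap.range f.hom = LinearMap.ker g.hom from h.moduleCat_range_eq_ker]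

/-- The dimension of the middle term of an exact sequence with five terms. -/
lemma finrank_of_exact {A B C D E : ModuleCat.{u} k} [Module.Finite k B] [Module.Finite k C]
    [Module.Finite k D] (f : A ⟶ B) (g : B ⟶ C) (h : C ⟶ D) (l : D ⟶ E)
    (w₁ : f ≫ g = 0) (w₂ : g ≫ h = 0) (w₃ : h ≫ l = 0)
    (e₁ : (ShortComplex.mk f g w₁).Exact) (e₂ : (ShortComplex.mk g h w₂).Exact)
    (e₃ : (ShortComplex.mk h l w₃).Exact) :
    Module.finrank k C + rank f + rank l = Module.finrank k B + Module.finrank k D := by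
  have h₁ := rank_add_rank_of_exact f g w₁ e₁
  have h₂ := rank_add_rank_of_exact g h w₂ e₂
  have h₃ := rank_add_rank_of_exact h l w₃ e₃
  omega

instance finite_homology (K : CochainComplex (ModuleCat.{u} k) ℤ) [∀ m, Module.Finite k (K.X m)]
    (m : ℤ) : Module.Finite k (K.homology m) := by
  have : Module.Finite k (K.cycles m) :=
    Module.Finite.of_injective (K.iCycles m).hom ((ModuleCat.mono_iff_injective _).1 inferInstance)
  exact Module.Finite.of_surjective (K.homologyπ m).hom
    ((ModuleCat.epi_iff_surjective _).1 inferInstance)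

instance finite_mappingCone {K L : CochainComplex (ModuleCat.{u} k) ℤ} (φ : K ⟶ L)
    [∀ m, Module.Finite k (K.X m)] [∀ m, Module.Finite k (L.X m)] (m : ℤ) :
    Module.Finite k ((mappingCone φ).X m) := by
  refine Module.Finite.of_injective (((mappingCone.fst φ).1.v m (m + 1) rfl).hom.prod
    ((mappingCone.snd φ).v m m (add_zero m)).hom) ?_
  rw [injective_iff_map_eq_zero]
  intro x hx
  have hx₁ : ((mappingCone.fst φ).1.v m (m + 1) rfl).hom x = 0 := congrArg Prod.fst hx
  have hx₂ : ((mappingCone.snd φ).v m m (add_zero m)).hom x = 0 := congrArg Prod.snd hx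
  have := LinearMap.congr_fun (congrArg ModuleCat.Hom.hom (mappingCone.id_X φ m (m + 1) rfl)) x
  simpa [hx₁, hx₂] using this.symm

/-- The dimension of the cohomology of a mapping cone. -/
lemma finrank_homology_mappingCone {K L : CochainComplex (ModuleCat.{u} k) ℤ} (φ : K ⟶ L)
    [∀ m, Module.Finite k (K.X m)] [∀ m, Module.Finite k (L.X m)] (m : ℤ) :
    Module.finrank k ((mappingCone φ).homology m) + rank (HomologicalComplex.homologyMap φ m) +
      rank (HomologicalComplex.homologyMap φ (m + 1)) =
    Module.finrank k (L.homology m) + Module.finrank k (K.homology (m + 1)) := by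
  let H := HomotopyCategory.homologyFunctor (ModuleCat.{u} k) (ComplexShape.up ℤ)
  let Q := HomotopyCategory.quotient (ModuleCat.{u} k) (ComplexShape.up ℤ)
  let e := HomotopyCategory.homologyFunctorFactors (ModuleCat.{u} k) (ComplexShape.up ℤ)
  have hr (m : ℤ) : rank ((H m).map (Q.map φ)) = rank (HomologicalComplex.homologyMap φ m) := by
    have := (e m).hom.naturality φ
    exact (rank_comp_of_isIso_right _ ((e m).hom.app L)).symm.trans
      ((congrArg rank this).trans (rank_comp_of_isIso_left ((e m).hom.app K) _))
  have hd (K : CochainComplex (ModuleCat.{u} k) ℤ) (m : ℤ) :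
      Module.finrank k ((H m).obj (Q.obj K)) = Module.finrank k (K.homology m) :=
    finrank_eq_of_iso ((e m).app K)
  have hf (K : CochainComplex (ModuleCat.{u} k) ℤ) [∀ m, Module.Finite k (K.X m)] (m : ℤ) :
      Module.Finite k ((H m).obj (Q.obj K)) :=
    (finite_homology K m).equiv ((e m).app K).toLinearEquiv.symm
  have hT := HomotopyCategory.mappingCone_triangleh_distinguished φ
  rw [← hr, ← hr, ← hd, ← hd, ← hd]
  have := hf K (m + 1)
  have := hf L m
  have := hf (mappingCone φ) m
  exact finrank_of_exact (B := (H m).obj (Q.obj L)) (C := (H m).obj (Q.obj (mappingCone φ)))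
    (D := (H (m + 1)).obj (Q.obj K)) _ _ _ _ _ _ _ ((H 0).homologySequence_exact₂ _ hT m)
    ((H 0).homologySequence_exact₃ _ hT m (m + 1) rfl)
    ((H 0).homologySequence_exact₁ _ hT m (m + 1) rfl)

end Ranks

/-! ### Cohomology dimensions of additive functors applied to complexes -/

section Dimensions

variable {k : Type u} [Field k] {C : Type*} [Category C] [Preadditive C]
  (Z Z' Z'' : C ⥤ ModuleCat.{u} k) [Z.Additive] [Z'.Additive] [Z''.Additive]

/-- The dimension of the cohomology of the complex `Z(K)`. -/
def hdim (K : CochainComplex C ℤ) (m : ℤ) : ℕ :=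
  Module.finrank k (((Z.mapHomologicalComplex (ComplexShape.up ℤ)).obj K).homology m)

variable {Z Z' Z''}

/-- The map of complexes induced by a natural transformation. -/
abbrev natComplex (α : Z ⟶ Z') (K : CochainComplex C ℤ) :
    (Z.mapHomologicalComplex (ComplexShape.up ℤ)).obj K ⟶
      (Z'.mapHomologicalComplex (ComplexShape.up ℤ)).obj K :=
  (NatTrans.mapHomologicalComplex α (ComplexShape.up ℤ)).app K

/-- The rank of the map on cohomology induced by a natural transformation. -/
def hrank (α : Z ⟶ Z') (K : CochainComplex C ℤ) (m : ℤ) : ℕ :=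
  rank (HomologicalComplex.homologyMap (natComplex α K) m)

instance isIso_natComplex (α : Z ⟶ Z') [IsIso α] (K : CochainComplex C ℤ) :
    IsIso (natComplex α K) := by
  have : ∀ p, IsIso ((natComplex α K).f p) := fun p => by
    change IsIso (α.app _); infer_instance
  exact HomologicalComplex.Hom.isIso_of_components _

lemma natComplex_comp (α : Z ⟶ Z') (β : Z' ⟶ Z'') (K : CochainComplex C ℤ) :
    natComplex (α ≫ β) K = natComplex α K ≫ natComplex β K := rfl

lemma hdim_eq_of_iso (α : Z ≅ Z') (K : CochainComplex C ℤ) (m : ℤ) :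
    hdim Z K m = hdim Z' K m :=
  finrank_eq_of_iso (asIso (HomologicalComplex.homologyMap (natComplex α.hom K) m))

lemma hrank_comp_of_isIso_left (α : Z ⟶ Z') [IsIso α] (β : Z' ⟶ Z'') (K : CochainComplex C ℤ)
    (m : ℤ) : hrank (α ≫ β) K m = hrank β K m := by
  rw [hrank, natComplex_comp, HomologicalComplex.homologyMap_comp, rank_comp_of_isIso_left, hrank]

lemma hrank_comp_of_isIso_right (α : Z ⟶ Z') (β : Z' ⟶ Z'') [IsIso β] (K : CochainComplex C ℤ)
    (m : ℤ) : hrank (α ≫ β) K m = hrank α K m := by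
  rw [hrank, natComplex_comp, HomologicalComplex.homologyMap_comp, rank_comp_of_isIso_right, hrank]

variable [hZ : ∀ X, Module.Finite k (Z.obj X)] [hZ' : ∀ X, Module.Finite k (Z'.obj X)]
  [hZ'' : ∀ X, Module.Finite k (Z''.obj X)]

instance finite_mapComplex (K : CochainComplex C ℤ) (m : ℤ) :
    Module.Finite k (((Z.mapHomologicalComplex (ComplexShape.up ℤ)).obj K).X m) := hZ (K.X m)

lemma hrank_add_hrank_le (α : Z ⟶ Z') (β : Z' ⟶ Z'') (w : α ≫ β = 0) (K : CochainComplex C ℤ)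
    (m : ℤ) : hrank α K m + hrank β K m ≤ hdim Z' K m := by
  refine rank_add_rank_le _ _ ?_
  rw [← HomologicalComplex.homologyMap_comp, ← natComplex_comp, w]
  exact HomologicalComplex.homologyMap_zero _ _ _

/-- A pointwise short exact sequence of functors, evaluated on a complex. -/
lemma shortExact_natComplex (α : Z ⟶ Z') (β : Z' ⟶ Z'') (w : α ≫ β = 0)
    (h₁ : ∀ X, Function.Injective (α.app X).hom) (h₂ : ∀ X, Function.Surjective (β.app X).hom)
    (h₃ : ∀ X (x : Z'.obj X), (β.app X).hom x = 0 → ∃ y, (α.app X).hom y = x)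
    (K : CochainComplex C ℤ) :
    (ShortComplex.mk (natComplex α K) (natComplex β K)
      (by rw [← natComplex_comp, w]; rfl)).ShortExact := by
  refine HomologicalComplex.shortExact_of_degreewise_shortExact _ fun p => ?_
  have hf := (ModuleCat.mono_iff_injective (α.app (K.X p))).2 (h₁ _)
  have hg := (ModuleCat.epi_iff_surjective (β.app (K.X p))).2 (h₂ _)
  refine { exact := ?_, mono_f := hf, epi_g := hg }
  rw [ShortComplex.moduleCat_exact_iff]
  exact fun x hx => h₃ _ x hx

/-- The long exact cohomology sequence read around the first functor; the next lemma reads it around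
the third. Ranks are added rather than subtracted so that everything stays in `ℕ`. -/
lemma hdim_left_of_shortExact (α : Z ⟶ Z') (β : Z' ⟶ Z'') (w : α ≫ β = 0)
    (h₁ : ∀ X, Function.Injective (α.app X).hom) (h₂ : ∀ X, Function.Surjective (β.app X).hom)
    (h₃ : ∀ X (x : Z'.obj X), (β.app X).hom x = 0 → ∃ y, (α.app X).hom y = x)
    (K : CochainComplex C ℤ) (m : ℤ) :
    hdim Z K (m + 1) + hrank β K m + hrank β K (m + 1) =
      hdim Z'' K m + hdim Z' K (m + 1) := by
  have hS := shortExact_natComplex α β w h₁ h₂ h₃ K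
  exact finrank_of_exact _ _ _ _ _ _ _ (hS.homology_exact₃ m (m + 1) rfl)
    (hS.homology_exact₁ m (m + 1) rfl) (hS.homology_exact₂ (m + 1))

lemma hdim_right_of_shortExact (α : Z ⟶ Z') (β : Z' ⟶ Z'') (w : α ≫ β = 0)
    (h₁ : ∀ X, Function.Injective (α.app X).hom) (h₂ : ∀ X, Function.Surjective (β.app X).hom)
    (h₃ : ∀ X (x : Z'.obj X), (β.app X).hom x = 0 → ∃ y, (α.app X).hom y = x)
    (K : CochainComplex C ℤ) (m : ℤ) :
    hdim Z'' K m + hrank α K m + hrank α K (m + 1) =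
      hdim Z' K m + hdim Z K (m + 1) := by
  have hS := shortExact_natComplex α β w h₁ h₂ h₃ K
  exact finrank_of_exact _ _ _ _ _ _ _ (hS.homology_exact₂ m)
    (hS.homology_exact₃ m (m + 1) rfl) (hS.homology_exact₁ m (m + 1) rfl)

variable [HasBinaryBiproducts C] {F G : C ⥤ C} [F.Additive] [G.Additive]

/-- The dimension of the cohomology of the cone of a natural transformation. -/
lemma hdim_coneComplex (τ : F ⟶ G) (K : CochainComplex C ℤ) (m : ℤ) :
    hdim Z ((coneComplex τ).obj K) m + hrank (Functor.whiskerRight τ Z) K m +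
      hrank (Functor.whiskerRight τ Z) K (m + 1) =
    hdim (G ⋙ Z) K m + hdim (F ⋙ Z) K (m + 1) := by
  have e := (HomologicalComplex.homologyFunctor _ _ m).mapIso
    (mappingCone.mapHomologicalComplexIso (termwise τ K) Z)
  have h := finrank_homology_mappingCone
    ((Z.mapHomologicalComplex (ComplexShape.up ℤ)).map (termwise τ K)) m
  have h' := finrank_eq_of_iso e
  exact (congrArg (fun t => t + _ + _) h').trans h

end Dimensions

section DimensionLemmas

variable {k : Type u} [Field k] {C : Type*} [Category C] [Preadditive C]
  {Z Z' : C ⥤ ModuleCat.{u} k} [Z.Additive] [Z'.Additive]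

lemma hdim_eq_zero (K : CochainComplex C ℤ) (m : ℤ) (h : Subsingleton (Z.obj (K.X m))) :
    hdim Z K m = 0 := by
  let L := (Z.mapHomologicalComplex (ComplexShape.up ℤ)).obj K
  have : Subsingleton (L.X m) := h
  have : Subsingleton (L.cycles m) :=
    ((ModuleCat.mono_iff_injective (L.iCycles m)).1 inferInstance).subsingleton
  have : Subsingleton (L.homology m) :=
    ((ModuleCat.epi_iff_surjective (L.homologyπ m)).1 inferInstance).subsingleton
  exact Module.finrank_zero_of_subsingleton

/-- Cohomology preserves mutually orthogonal retracts, so the sum of their cohomologies embeds. The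
inequality alone is needed later. -/
lemma sum_hdim_le {I : Type} [Fintype I] [DecidableEq I] (Y : I → C ⥤ ModuleCat.{u} k)
    [∀ x, (Y x).Additive] [∀ x X, Module.Finite k ((Y x).obj X)]
    [hZ : ∀ X, Module.Finite k (Z.obj X)]
    (p : ∀ x, Z ⟶ Y x) (q : ∀ x, Y x ⟶ Z) (h₁ : ∀ x, q x ≫ p x = 𝟙 _)
    (h₂ : ∀ x y, x ≠ y → q x ≫ p y = 0) (K : CochainComplex C ℤ) (m : ℤ) :
    ∑ x, hdim (Y x) K m ≤ hdim Z K m := by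
  let H (x : I) := (((Y x).mapHomologicalComplex (ComplexShape.up ℤ)).obj K).homology m
  let P (x : I) := HomologicalComplex.homologyMap (natComplex (p x) K) m
  let Q (x : I) := HomologicalComplex.homologyMap (natComplex (q x) K) m
  have hQP (x y : I) : Q x ≫ P y =
      HomologicalComplex.homologyMap (natComplex (q x ≫ p y) K) m := by
    rw [natComplex_comp, HomologicalComplex.homologyMap_comp]
  have e₁ (x : I) : Q x ≫ P x = 𝟙 _ := by
    rw [hQP, h₁]; exact HomologicalComplex.homologyMap_id _ _
  have e₂ (x y : I) (h : x ≠ y) : Q x ≫ P y = 0 := by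
    rw [hQP, h₂ x y h]; exact HomologicalComplex.homologyMap_zero _ _ _
  let f : (∀ x, H x) →ₗ[k] ((Z.mapHomologicalComplex (ComplexShape.up ℤ)).obj K).homology m :=
    LinearMap.lsum k (fun x => H x) k fun x => (Q x).hom
  have hf : Function.Injective f := by
    rw [injective_iff_map_eq_zero]
    intro a ha
    funext y
    refine Eq.trans ?_ ((congrArg (P y).hom ha).trans (map_zero _))
    have hfa : f a = ∑ x, (Q x).hom (a x) := by
      simp [f, LinearMap.lsum_apply, LinearMap.sum_apply]
    rw [hfa, map_sum, Finset.sum_eq_single y]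
    · exact (LinearMap.congr_fun (congrArg ModuleCat.Hom.hom (e₁ y)) (a y)).symm
    · intro x _ hx
      exact LinearMap.congr_fun (congrArg ModuleCat.Hom.hom (e₂ x y hx)) (a x)
    · simp
  have := LinearMap.finrank_le_finrank_of_injective hf
  rw [Module.finrank_pi_fintype] at this
  exact this

end DimensionLemmas

/-! ### Subfunctors of the underlying vector space of a module -/

section NaturalSubspaces

variable {n : ℕ} {G : Type} [AddCommGroup G] [DecidableEq G]

open GrProj

/-- A subspace of every graded module, preserved by morphisms. -/
structure NatSub (k : Type u) [Field k] (w : Weight n G) where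
  /-- the subspace -/
  sub (M : GrProj k w) : Submodule k M
  map_mem {M N : GrProj k w} (f : M ⟶ N) {m : M} : m ∈ sub M → toLin f m ∈ sub N

variable {k : Type u} [Field k] {w : Weight n G}

namespace NatSub

variable (S S' S'' : NatSub k w)

/-- The restriction of a morphism to a natural subspace. -/
def mapLin {M N : GrProj k w} (f : M ⟶ N) : S.sub M →ₗ[k] S.sub N :=
  ((toLin f).restrictScalars k).restrict fun _ hm => S.map_mem f hm

/-- A natural subspace as a functor. -/
def functor : GrProj k w ⥤ ModuleCat.{u} k where
  obj M := ModuleCat.of k (S.sub M)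
  map f := ModuleCat.ofHom (S.mapLin f)

instance : S.functor.Additive where
  map_add := rfl

instance (M : GrProj k w) : Module.Finite k (S.functor.obj M) :=
  inferInstanceAs (Module.Finite k (S.sub M))

variable {S S' S''}

/-- Multiplication by an element of the algebra, as a natural transformation. -/
def mulNat (a : Zigzag k n) (h : ∀ (M : GrProj k w) (m : M), m ∈ S.sub M → a • m ∈ S'.sub M) :
    S.functor ⟶ S'.functor where
  app M := ModuleCat.ofHom (((Module.toModuleEnd k (S := Zigzag k n) M a)).restrict (h M))
  naturality M N f := by
    ext m
    exact Subtype.ext (map_smul (toLin f) a m.1).symm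

lemma nat_ext {Z : GrProj k w ⥤ ModuleCat.{u} k} {α β : Z ⟶ S.functor}
    (h : ∀ (M : GrProj k w) (m : Z.obj M), ((α.app M).hom m : S.sub M).1 =
      ((β.app M).hom m : S.sub M).1) : α = β := by
  ext M m
  exact Subtype.ext (h M m)

variable {I : Type} (Y : I → NatSub k w)

/-- A product of natural subspaces, as a functor. -/
def piFunctor : GrProj k w ⥤ ModuleCat.{u} k where
  obj M := ModuleCat.of k (∀ x, (Y x).sub M)
  map f := ModuleCat.ofHom (LinearMap.pi fun x =>
    (Y x).mapLin f ∘ₗ LinearMap.proj x)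

instance : (piFunctor Y).Additive where
  map_add := rfl

instance [Finite I] (M : GrProj k w) : Module.Finite k ((piFunctor Y).obj M) :=
  inferInstanceAs (Module.Finite k (∀ x, (Y x).sub M))

/-- The projections of a product. -/
def piProj (x : I) : piFunctor Y ⟶ (Y x).functor where
  app M := ModuleCat.ofHom (LinearMap.proj x)

/-- The map to a product with given components. -/
def piLift (α : ∀ x, S.functor ⟶ (Y x).functor) : S.functor ⟶ piFunctor Y where
  app M := ModuleCat.ofHom (LinearMap.pi fun x => ((α x).app M).hom)
  naturality M N f := by
    ext m
    funext x
    exact LinearMap.congr_fun (congrArg ModuleCat.Hom.hom ((α x).naturality f)) m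

/-- The inclusions into a product. -/
def piSingle [DecidableEq I] (x : I) : (Y x).functor ⟶ piFunctor Y where
  app M := ModuleCat.ofHom (LinearMap.single k (fun x => (Y x).sub M) x)
  naturality M N f := by
    ext m
    funext y
    exact (Pi.apply_single (fun x => (Y x).mapLin f) (fun x => map_zero _) x m y).symm

lemma sum_hdim_le_piFunctor [Fintype I] [DecidableEq I] (K : CochainComplex (GrProj k w) ℤ)
    (m : ℤ) : ∑ x, hdim (Y x).functor K m ≤ hdim (piFunctor Y) K m := by
  refine sum_hdim_le (fun x => (Y x).functor) (piProj Y) (piSingle Y) (fun x => ?_)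
    (fun x y h => ?_) K m
  · refine nat_ext fun M v => ?_
    exact congrArg Subtype.val (Pi.single_eq_same (M := fun x => (Y x).sub M) x v)
  · refine nat_ext fun M v => ?_
    exact congrArg Subtype.val (Pi.single_eq_of_ne (M := fun x => (Y x).sub M) (Ne.symm h) v)

end NatSub

variable (k w)

/-- The subspaces `z_j M`. -/
def zSub (j : Fin n) : NatSub k w where
  sub M := LinearMap.range (Module.toModuleEnd k (S := Zigzag k n) M (gen k (.z j)))
  map_mem f := by
    rintro _ ⟨m, rfl⟩
    exact ⟨toLin f m, (map_smul (toLin f) _ _).symm⟩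

/-- The subspaces `e_i M`. -/
def cornerSub (i : Fin n) : NatSub k w where
  sub M := M.corner i
  map_mem f _ hm := (cornerMap i f ⟨_, hm⟩).2

/-- The kernel of `z_i` in `e_i M`. -/
def kerSub (i : Fin n) : NatSub k w where
  sub M := M.corner i ⊓ LinearMap.ker (Module.toModuleEnd k (S := Zigzag k n) M (gen k (.z i)))
  map_mem f m hm := ⟨(cornerMap i f ⟨_, hm.1⟩).2, by
    have h : gen k (.z i) • m = 0 := hm.2
    change gen k (.z i) • toLin f m = 0
    rw [← map_smul, h, map_zero]⟩

variable {k w}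

lemma mem_kerSub {i : Fin n} {M : GrProj k w} {m : M} :
    m ∈ (kerSub k w i).sub M ↔ idem k i • m = m ∧ gen k (.z i) • m = 0 := Iff.rfl

end NaturalSubspaces

/-! ### The right ideals of `z_j` and `e_i` -/

section RightIdeals

variable (k : Type u) [Field k] {n : ℕ}

/-- The loop lies in the socle: every generator except `e_j` kills it from the right. -/
lemma z_mul_eq (j : Fin n) (a : Zigzag k n) : gen k (.z j) * a = coefE k j a • gen k (.z j) := by
  refine LinearMap.congr_fun (zigzag_linear_ext k (f := LinearMap.mulLeft k (gen k (.z j)))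
    (g := (coefE k j).smulRight (gen k (.z j))) fun s => ?_) a
  rw [LinearMap.mulLeft_apply, LinearMap.smulRight_apply, coefE_gen]
  cases s with
  | e l =>
    by_cases h : l = j
    · subst h; simp [genAct_e, z_mul_idem]
    · rw [gen_mul_gen_of_ne k (s := .z j) (t := .e l) (Ne.symm h)]; simp [genAct_e, h]
  | z l =>
    by_cases h : l = j
    · subst h; simp [genAct_z, z_mul_z]
    · rw [gen_mul_gen_of_ne k (s := .z j) (t := .z l) (Ne.symm h)]; simp [genAct_z]
  | arr c p q h =>
    by_cases h' : p = j
    · subst h'; simp [genAct_arr, z_mul_arr]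
    · rw [gen_mul_gen_of_ne k (s := .z j) (t := .arr c p q h) (Ne.symm h')]; simp [genAct_arr]

lemma z_mul_of_mem_leftIdeal {i j : Fin n} (h : j ≠ i) {a : Zigzag k n}
    (ha : a * idem k i = a) : gen k (.z j) * a = 0 := by
  rw [← ha, ← mul_assoc, z_mul_eq, smul_mul_assoc, gen_mul_gen_of_ne k (s := .z j) (t := .e i) h,
    smul_zero]

/-- The right ideal `e_i A` is spanned by `e_i`, `z_i` and the arrows out of `i`. -/
lemma idem_mul_eq (i : Fin n) (a : Zigzag k n) : idem k i * a =
    coefE k i a • idem k i + coefZ k i a • gen k (.z i) +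
      ∑ c : Edge, ∑ j : Fin n, coefArr k j c i a • GrProj.arrow k c i j := by
  have := LinearMap.congr_fun (zigzag_linear_ext k
    (f := LinearMap.mulLeft k (idem k i))
    (g := (coefE k i).smulRight (idem k i) + (coefZ k i).smulRight (gen k (.z i)) +
      ∑ c : Edge, ∑ j : Fin n, (coefArr k j c i).smulRight (GrProj.arrow k c i j)) ?_) a
  · simpa [LinearMap.sum_apply] using this
  intro s
  simp only [LinearMap.mulLeft_apply, LinearMap.add_apply, LinearMap.smulRight_apply,
    LinearMap.sum_apply, coefE_gen, coefZ_gen, coefArr_gen]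
  cases s with
  | e l =>
    by_cases h : l = i
    · subst h; simp [genAct_e, idem_mul_idem]
    · rw [idem_mul_idem_ne k (Ne.symm h)]; simp [genAct_e, h]
  | z l =>
    by_cases h : l = i
    · subst h; simp [genAct_z, idem_mul_z]
    · rw [gen_mul_gen_of_ne k (s := .e i) (t := .z l) (Ne.symm h)]; simp [genAct_z, h]
  | arr d p q h =>
    simp only [genAct_arr, zero_smul, zero_add]
    by_cases h' : p = i
    · subst h'
      rw [Finset.sum_eq_single d, Finset.sum_eq_single q]
      · simp [GrProj.arrow, h, idem_mul_arr]
      · intro j _ hj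
        simp [hj.symm]
      · simp
      · intro c _ hc
        simp [hc]
      · simp
    · rw [gen_mul_gen_of_ne k (s := .e i) (t := .arr d p q h) (Ne.symm h')]
      simp [h', Ne.symm h']

end RightIdeals

/-! ### Divisibility by loops in projective modules -/

section Projective

variable {n : ℕ} {k : Type u} [Field k]

/-- In a projective module `M`, the equation `a m = b m'` can be solved for `m'` if it can be solved
for the values of `m` under linear functionals, linearly and with scalars `m'`. -/
lemma exists_smul_eq_of_projective {M : Type*} [AddCommGroup M] [Module (Zigzag k n) M]
    [Module.Projective (Zigzag k n) M] (m : M) (a b : Zigzag k n) (γ : Zigzag k n →ₗ[k] k)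
    (h : ∀ f : M →ₗ[Zigzag k n] Zigzag k n, a * f m = γ (f m) • b) : ∃ m', a • m = b • m' := by
  -- The section `s` is a dual basis: `m` is the sum of the `s(m)_x • x`. Hence `a • m` is `b` times
  -- the sum of the `γ(s(m)_x) • x`, and this last sum serves as `m'`.
  obtain ⟨s, hs⟩ := Module.Projective.out (R := Zigzag k n) (P := M)
  refine ⟨Finsupp.linearCombination (Zigzag k n) id
    (Finsupp.mapRange (fun x => algebraMap k (Zigzag k n) (γ x)) (by simp) (s m)), ?_⟩
  rw [← map_smul]
  conv_lhs => rw [← hs m, ← map_smul]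
  congr 1
  ext x
  have := h (Finsupp.lapply x ∘ₗ s)
  rw [LinearMap.comp_apply, Finsupp.lapply_apply] at this
  rw [Finsupp.smul_apply, smul_eq_mul, this, Finsupp.smul_apply, Finsupp.mapRange_apply,
    smul_eq_mul, Algebra.smul_def, Algebra.commutes]

variable {M : Type*} [AddCommGroup M] [Module (Zigzag k n) M] [Module.Projective (Zigzag k n) M]

/-- An element of `e_i A` killed by `z_i`. -/
lemma eq_of_z_mul_eq_zero {i : Fin n} {b : Zigzag k n} (hb : idem k i * b = b)
    (hz : gen k (.z i) * b = 0) : b = coefZ k i b • gen k (.z i) +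
      ∑ c : Edge, ∑ j : Fin n, coefArr k j c i b • GrProj.arrow k c i j := by
  have h := idem_mul_eq k i b
  rw [z_mul_eq] at hz
  have h0 : coefE k i b = 0 := by
    have := congrArg (coefZ k i) hz
    simpa using this
  rw [hb, h0, zero_smul, zero_add] at h
  exact h

lemma arrow_mul_arrow (c d : Edge) (i j l : Fin n) (h : j ≠ i) :
    GrProj.arrow k c j i * GrProj.arrow k d i l =
      if c = d ∧ j = l then gen k (.z j) else 0 := by
  unfold GrProj.arrow
  rw [dif_pos h]
  by_cases hil : i = l
  · subst hil
    rw [dif_neg (by simp), mul_zero, if_neg (fun h' => h h'.2)]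
  · rw [dif_pos hil]
    by_cases hjl : j = l
    · subst hjl
      by_cases hcd : c = d
      · subst hcd; simp [arr_mul_star]
      · rw [if_neg (by tauto)]
        exact arr_mul_star_ne k h hcd
    · rw [if_neg (by tauto)]
      exact arr_mul_arr_ne k c d h hil hjl

/-- Such a `b` is a combination of `z_i` and arrows out of `i`, and an arrow into `i` has a non-zero
product only with its dual arrow. Multiplying by arrows thus extracts the arrow coefficients of `b`.
-/
lemma arrow_mul_of_z_mul_eq_zero {i j : Fin n} (h : j ≠ i) (c : Edge) {b : Zigzag k n}
    (hb : idem k i * b = b) (hz : gen k (.z i) * b = 0) :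
    GrProj.arrow k c j i * b = coefArr k j c i b • gen k (.z j) := by
  have hb' := eq_of_z_mul_eq_zero hb hz
  have h₁ : GrProj.arrow k c j i * gen k (.z i) = 0 := by
    unfold GrProj.arrow
    rw [dif_pos h]
    exact arr_mul_z k c h
  calc GrProj.arrow k c j i * b = GrProj.arrow k c j i * (coefZ k i b • gen k (.z i) +
      ∑ c : Edge, ∑ j : Fin n, coefArr k j c i b • GrProj.arrow k c i j) := by rw [← hb']
    _ = _ := by
      rw [mul_add, mul_smul_comm, h₁, smul_zero, zero_add, Finset.mul_sum, Finset.sum_eq_single c,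
        Finset.mul_sum, Finset.sum_eq_single j]
      · rw [mul_smul_comm, arrow_mul_arrow c c i j j h, if_pos ⟨rfl, rfl⟩]
      · intro l _ hl
        rw [mul_smul_comm, arrow_mul_arrow c c i j l h, if_neg (by tauto), smul_zero]
      · simp
      · intro d _ hd
        rw [Finset.mul_sum]
        refine Finset.sum_eq_zero fun l _ => ?_
        rw [mul_smul_comm, arrow_mul_arrow c d i j l h, if_neg (by tauto), smul_zero]
      · simp

/-- Holds in `A` by the previous lemma and passes to projective modules through their linear
functionals. -/
lemma arrow_smul_mem {i j : Fin n} (h : j ≠ i) (c : Edge) {m : M} (hm : idem k i • m = m)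
    (hz : gen k (.z i) • m = 0) : ∃ m', GrProj.arrow k c j i • m = gen k (.z j) • m' := by
  refine exists_smul_eq_of_projective m _ _ (coefArr k j c i) fun f => ?_
  refine arrow_mul_of_z_mul_eq_zero h c ?_ ?_
  · rw [← smul_eq_mul, ← map_smul, hm]
  · rw [← smul_eq_mul, ← map_smul, hz, map_zero]

/-- In `A`, an element of `e_i A` killed by `z_i` has no `e_i` coefficient. If all arrows into `i`
kill it as well, it has no arrow coefficients, so only a multiple of `z_i` remains. -/
lemma mem_of_arrow_smul_eq_zero {i : Fin n} {m : M} (hm : idem k i • m = m)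
    (hz : gen k (.z i) • m = 0) (ha : ∀ (c : Edge) (j : Fin n), GrProj.arrow k c j i • m = 0) :
    ∃ m', m = gen k (.z i) • m' := by
  obtain ⟨m', h⟩ := exists_smul_eq_of_projective m 1 (gen k (.z i)) (coefZ k i) fun f => by
    have h₁ : idem k i * f m = f m := by rw [← smul_eq_mul, ← map_smul, hm]
    have h₂ : gen k (.z i) * f m = 0 := by rw [← smul_eq_mul, ← map_smul, hz, map_zero]
    have h₃ := eq_of_z_mul_eq_zero h₁ h₂
    have h₄ : ∑ c : Edge, ∑ j : Fin n, coefArr k j c i (f m) • GrProj.arrow k c i j = 0 := by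
      refine Finset.sum_eq_zero fun c _ => Finset.sum_eq_zero fun j _ => ?_
      by_cases hj : j = i
      · subst hj
        simp [GrProj.arrow]
      · have h₅ := arrow_mul_of_z_mul_eq_zero hj c h₁ h₂
        rw [← smul_eq_mul, ← map_smul, ha, map_zero] at h₅
        have h₆ := congrArg (coefZ k j) h₅
        rw [map_smul, coefZ_z, map_zero, smul_eq_mul, mul_one] at h₆
        rw [← h₆, zero_smul]
    rw [h₄, add_zero] at h₃
    rw [one_mul]
    exact h₃
  exact ⟨m', by rw [← h, one_smul]⟩

end Projective

/-! ### Two exact sequences for the kernel of `z_i` -/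

section Sequences

variable {n : ℕ} {G : Type} [AddCommGroup G] [DecidableEq G]
variable {k : Type u} [Field k] {w : Weight n G}

open GrProj NatSub

variable (k w)

/-- The map `z_i : e_i M ⟶ z_i M`. -/
def cornerToZ (i : Fin n) : (cornerSub k w i).functor ⟶ (zSub k w i).functor :=
  mulNat (gen k (.z i)) fun _ m _ => ⟨m, rfl⟩

/-- The inclusion of `z_i M` in `e_i M`. -/
def zToCorner (i : Fin n) : (zSub k w i).functor ⟶ (cornerSub k w i).functor :=
  mulNat 1 fun M m hm => by
    obtain ⟨m, rfl⟩ := hm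
    rw [one_smul]
    change idem k i • gen k (.z i) • m = gen k (.z i) • m
    rw [smul_smul, idem_mul_z]

lemma zToCorner_cornerToZ (i : Fin n) : zToCorner k w i ≫ cornerToZ k w i = 0 := by
  refine nat_ext fun M m => ?_
  obtain ⟨_, ⟨m, rfl⟩⟩ := m
  change gen k (.z i) • (1 : Zigzag k n) • gen k (.z i) • m = 0
  rw [one_smul, smul_smul, z_mul_z, zero_smul]

/-- The inclusion of the kernel of `z_i` in `e_i M`. -/
def kerToCorner (i : Fin n) : (kerSub k w i).functor ⟶ (cornerSub k w i).functor :=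
  mulNat 1 fun M m hm => by rw [one_smul]; exact hm.1

/-- The inclusion of `z_i M` in the kernel of `z_i`. -/
def zToKer (i : Fin n) : (zSub k w i).functor ⟶ (kerSub k w i).functor :=
  mulNat 1 fun M m hm => by
    obtain ⟨m, rfl⟩ := hm
    rw [one_smul, mem_kerSub]
    change idem k i • gen k (.z i) • m = gen k (.z i) • m ∧ gen k (.z i) • gen k (.z i) • m = 0
    rw [smul_smul, idem_mul_z, smul_smul, z_mul_z, zero_smul]
    exact ⟨rfl, rfl⟩

/-- From the exact sequence `0 ⟶ ker z_i ⟶ e_i M ⟶ z_i M ⟶ 0`. -/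
lemma hdim_kerSub (i : Fin n) (K : CochainComplex (GrProj k w) ℤ) (m : ℤ) :
    hdim (kerSub k w i).functor K (m + 1) + hrank (cornerToZ k w i) K m +
      hrank (cornerToZ k w i) K (m + 1) =
    hdim (zSub k w i).functor K m + hdim (cornerSub k w i).functor K (m + 1) := by
  refine hdim_left_of_shortExact (kerToCorner k w i) (cornerToZ k w i) ?_ ?_ ?_ ?_ K m
  · refine nat_ext fun M m => ?_
    change gen k (.z i) • (1 : Zigzag k n) • m.1 = 0
    rw [one_smul]
    exact m.2.2
  · intro M m m' h
    refine Subtype.ext ?_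
    have : (1 : Zigzag k n) • m.1 = (1 : Zigzag k n) • m'.1 := congrArg Subtype.val h
    rwa [one_smul, one_smul] at this
  · rintro M ⟨_, ⟨m, rfl⟩⟩
    refine ⟨inC M i m, Subtype.ext ?_⟩
    change gen k (.z i) • idem k i • m = gen k (.z i) • m
    rw [smul_smul, z_mul_idem]
  · intro M m hm
    refine ⟨⟨m.1, m.2, congrArg Subtype.val hm⟩, Subtype.ext (one_smul _ _)⟩

/-- The pairs of an edge and a vertex different from `i`. -/
abbrev Neighbor (i : Fin n) := Edge × {j : Fin n // j ≠ i}

/-- The map from the kernel of `z_i` to the sum of the spaces `z_j M` given by the arrows. -/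
def kerToPi (i : Fin n) :
    (kerSub k w i).functor ⟶ piFunctor fun x : Neighbor i => zSub k w x.2.1 :=
  piLift _ fun x => mulNat (arrow k x.1 x.2.1 i) fun M m hm => by
    obtain ⟨m', h⟩ := arrow_smul_mem x.2.2 x.1 hm.1 hm.2
    exact ⟨m', h.symm⟩

lemma arrow_mul_z (c : Edge) (i j : Fin n) : arrow k c j i * gen k (.z i) = 0 := by
  unfold arrow
  split_ifs with h
  · exact arr_mul_z k c h
  · exact zero_mul _

lemma z_mul_arrow (c : Edge) (i j : Fin n) : gen k (.z i) * arrow k c i j = 0 := by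
  unfold arrow
  split_ifs with h
  · exact z_mul_arr k c h
  · exact mul_zero _

lemma idem_mul_arrow (c : Edge) (i j : Fin n) : idem k i * arrow k c i j = arrow k c i j := by
  unfold arrow
  split_ifs with h
  · exact idem_mul_arr k c h
  · exact mul_zero _

lemma zToKer_kerToPi (i : Fin n) : zToKer k w i ≫ kerToPi k w i = 0 := by
  ext M m
  funext x
  obtain ⟨_, ⟨m, rfl⟩⟩ := m
  refine Subtype.ext ?_
  change arrow k x.1 x.2.1 i • (1 : Zigzag k n) • gen k (.z i) • m = 0
  rw [one_smul, smul_smul, arrow_mul_z, zero_smul]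

/-- Dual arrows give preimages: an arrow times its dual is a loop `z_j`, and the other products that
occur vanish. -/
lemma kerToPi_surjective (i : Fin n) (M : GrProj k w) :
    Function.Surjective ((kerToPi k w i).app M).hom := by
  intro v
  change ∀ x : Neighbor i, (zSub k w x.2.1).sub M at v
  choose m hm using fun x => (v x).2
  let t : M := ∑ x : Neighbor i, arrow k x.1 i x.2.1 • m x
  have ht : t ∈ (kerSub k w i).sub M := by
    rw [mem_kerSub]
    constructor
    · simp only [t, Finset.smul_sum, smul_smul, idem_mul_arrow]
    · simp only [t, Finset.smul_sum, smul_smul, z_mul_arrow, zero_smul, Finset.sum_const_zero]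
  refine ⟨⟨t, ht⟩, ?_⟩
  funext x
  refine Subtype.ext ?_
  change arrow k x.1 x.2.1 i • t = (v x).1
  rw [← hm x]
  change arrow k x.1 x.2.1 i • t = gen k (.z x.2.1) • m x
  rw [Finset.smul_sum, Finset.sum_eq_single x]
  · rw [smul_smul, arrow_mul_arrow _ _ _ _ _ x.2.2, if_pos ⟨rfl, rfl⟩]
  · intro y _ hy
    rw [smul_smul, arrow_mul_arrow _ _ _ _ _ x.2.2, if_neg, zero_smul]
    rintro ⟨h₁, h₂⟩
    exact hy (Prod.ext h₁.symm (Subtype.ext h₂.symm))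
  · simp

/-- From `0 ⟶ z_i M ⟶ ker z_i ⟶ ∏ z_j M ⟶ 0`, the product being over the edges from `i` to other
vertices `j`. Projectivity of `M` enters twice: the last map lands in `z_j M` by `arrow_smul_mem`,
and exactness in the middle is `mem_of_arrow_smul_eq_zero`. -/
lemma hdim_pi (i : Fin n) (K : CochainComplex (GrProj k w) ℤ) (m : ℤ) :
    hdim (piFunctor fun x : Neighbor i => zSub k w x.2.1) K m + hrank (zToKer k w i) K m +
      hrank (zToKer k w i) K (m + 1) =
    hdim (kerSub k w i).functor K m + hdim (zSub k w i).functor K (m + 1) := by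
  refine hdim_right_of_shortExact (zToKer k w i) (kerToPi k w i) (zToKer_kerToPi k w i) ?_
    (kerToPi_surjective k w i) ?_ K m
  · intro M m m' h
    refine Subtype.ext ?_
    have : (1 : Zigzag k n) • m.1 = (1 : Zigzag k n) • m'.1 := congrArg Subtype.val h
    rwa [one_smul, one_smul] at this
  · intro M m hm
    change (kerSub k w i).sub M at m
    obtain ⟨m', hm'⟩ := mem_of_arrow_smul_eq_zero m.2.1 m.2.2 fun c j => by
      by_cases hj : j = i
      · subst hj; simp [arrow]
      · exact congrArg Subtype.val (congrFun hm (c, ⟨j, hj⟩))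
    exact ⟨⟨m.1, ⟨m', hm'.symm⟩⟩, Subtype.ext (one_smul _ _)⟩

end Sequences

/-! ### Effect of the two cones on the cohomology of `z_j X` -/

section Tensor

variable {n : ℕ} {G : Type} [AddCommGroup G] [DecidableEq G]
variable {k : Type u} [Field k] {w : Weight n G}

open GrProj NatSub

lemma z_smul_tensor (i : Fin n) {V : Type*} [AddCommGroup V] [Module k V]
    (t : leftIdeal k i ⊗[k] V) : ∃ v : V, gen k (.z i) • t = inP k i (gen k (.z i)) ⊗ₜ v := by
  induction t using TensorProduct.induction_on with
  | zero => exact ⟨0, by simp⟩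
  | tmul p v =>
    refine ⟨coefE k i p • v, ?_⟩
    rw [smul_tmul', tmul_smul, smul_tmul']
    congr 1
    refine Subtype.ext ?_
    rw [Submodule.coe_smul, smul_eq_mul, z_mul_eq]
    change _ = coefE k i p • (gen k (.z i) * idem k i)
    rw [z_mul_idem]
  | add x y hx hy =>
    obtain ⟨v, hv⟩ := hx
    obtain ⟨v', hv'⟩ := hy
    exact ⟨v + v', by rw [smul_add, hv, hv', tmul_add]⟩

lemma z_smul_tensor_eq_zero {i j : Fin n} (h : j ≠ i) {V : Type*} [AddCommGroup V] [Module k V]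
    (t : leftIdeal k i ⊗[k] V) : gen k (.z j) • t = 0 := by
  induction t using TensorProduct.induction_on with
  | zero => rw [smul_zero]
  | tmul p v =>
    rw [smul_tmul', show gen k (.z j) • p = 0 from
      Subtype.ext (z_mul_of_mem_leftIdeal k h (mem_leftIdeal.1 p.2)), zero_tmul]
  | add x y hx hy => rw [smul_add, hx, hy, add_zero]

lemma z_tmul_eq (i : Fin n) {V : Type*} [AddCommGroup V] [Module k V] (v : V) :
    gen k (.z i) • (idemP k i ⊗ₜ v : leftIdeal k i ⊗[k] V) = inP k i (gen k (.z i)) ⊗ₜ v := by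
  rw [smul_tmul', ← inP_eq]

/-- The linear map `e_i M ⟶ z_i (A e_i ⊗ e_i M)`, `v ↦ z_i ⊗ v`. -/
def zTensorLin (i : Fin n) (M : GrProj k w) :
    M.corner i →ₗ[k] (zSub k w i).sub (tensorObj i M) :=
  LinearMap.codRestrict _
    (TensorProduct.mk k (leftIdeal k i) (M.corner i) (inP k i (gen k (.z i))))
    fun v => ⟨(idemP k i ⊗ₜ v : leftIdeal k i ⊗[k] M.corner i), z_tmul_eq i v⟩

/-- The image of `z_i` on `A e_i` is the line through `z_i`, so multiplication by `z_i` on the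
tensor product remembers just a vector of `e_i M`; the coefficient of `z_i` recovers this vector. -/
lemma zTensorLin_bijective (i : Fin n) (M : GrProj k w) :
    Function.Bijective (zTensorLin i M) := by
  constructor
  · intro v v' h
    have h' : (inP k i (gen k (.z i)) ⊗ₜ v : leftIdeal k i ⊗[k] M.corner i) =
      inP k i (gen k (.z i)) ⊗ₜ v' := congrArg Subtype.val h
    have := congrArg (coefTensor i M) h'
    simpa [coe_inP, z_mul_idem] using this
  · rintro ⟨_, ⟨t, rfl⟩⟩
    obtain ⟨v, hv⟩ := z_smul_tensor i (t : leftIdeal k i ⊗[k] M.corner i)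
    exact ⟨v, Subtype.ext hv.symm⟩

instance finite_comp_functor (H : GrProj k w ⥤ GrProj k w) (S : NatSub k w) (X : GrProj k w) :
    Module.Finite k ((H ⋙ S.functor).obj X) :=
  inferInstanceAs (Module.Finite k (S.functor.obj (H.obj X)))

variable (k w)

/-- The natural map `e_i M ⟶ z_i (A e_i ⊗ e_i M)`. -/
def zTensor (i : Fin n) : (cornerSub k w i).functor ⟶ tensor i ⋙ (zSub k w i).functor where
  app M := ModuleCat.ofHom (zTensorLin i M)

/-- The natural map `e_i M ⟶ z_i (A e_i ⊗ e_i M)⟨s⟩`. -/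
def zTensorShift (i : Fin n) (s : G) :
    (cornerSub k w i).functor ⟶ (tensor i ⋙ shift s) ⋙ (zSub k w i).functor where
  app M := ModuleCat.ofHom (zTensorLin i M)

instance (i : Fin n) : IsIso (zTensor k w i) := by
  refine (NatTrans.isIso_iff_isIso_app _).2 fun M => ?_
  exact (LinearEquiv.ofBijective (zTensorLin i M) (zTensorLin_bijective i M)).toModuleIso.isIso_hom

instance (i : Fin n) (s : G) : IsIso (zTensorShift k w i s) := by
  refine (NatTrans.isIso_iff_isIso_app _).2 fun M => ?_
  exact (LinearEquiv.ofBijective (zTensorLin i M) (zTensorLin_bijective i M)).toModuleIso.isIso_hom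

lemma zTensor_eval (i : Fin n) :
    zTensor k w i ≫ Functor.whiskerRight (evalNat (k := k) (w := w) i) (zSub k w i).functor = cornerToZ k w i := by
  refine nat_ext fun M v => ?_
  change M.corner i at v
  change evalLin i M (inP k i (gen k (.z i)) ⊗ₜ v) = gen k (.z i) • v.1
  rw [evalLin_tmul, coe_inP, z_mul_idem]

/-- `z_i M`, as the value at `M` of a composition with the identity. -/
def zToCornerId (i : Fin n) :
    𝟭 (GrProj k w) ⋙ (zSub k w i).functor ⟶ (cornerSub k w i).functor := zToCorner k w i

/-- On `z_i M` only the term `z_i ⊗ m` of `g_i` survives: `z_i` squares to zero, and the arrow terms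
vanish on all of `e_i M`. -/
lemma coev_zTensor (i : Fin n) :
    Functor.whiskerRight (coevNat (k := k) (w := w) i) (zSub k w i).functor =
      zToCornerId k w i ≫ zTensorShift k w i w.z := by
  refine NatTrans.ext (funext fun M => ModuleCat.hom_ext (LinearMap.ext fun m => Subtype.ext ?_))
  change (zSub k w i).sub M at m
  obtain ⟨_, ⟨m, rfl⟩⟩ := m
  have h := coevLin_corner (M := M) i ⟨gen k (.z i) • m, by
    rw [mem_corner, smul_smul, idem_mul_z]⟩
  have h₂ : zMul i M ⟨gen k (.z i) • m, by rw [mem_corner, smul_smul, idem_mul_z]⟩ = 0 := by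
    refine Subtype.ext ?_
    rw [coe_zMul, smul_smul, z_mul_z, zero_smul]
    rfl
  rw [h₂, tmul_zero, add_zero] at h
  refine h.trans ?_
  change _ = inP k i (gen k (.z i)) ⊗ₜ[k] (⟨(1 : Zigzag k n) • gen k (.z i) • m, _⟩ : M.corner i)
  congr 1
  exact Subtype.ext (one_smul _ _).symm

variable (K : CochainComplex (GrProj k w) ℤ) (m : ℤ)

lemma hrank_eval (i : Fin n) :
    hrank (Functor.whiskerRight (evalNat (k := k) (w := w) i) (zSub k w i).functor) K m =
      hrank (cornerToZ k w i) K m := by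
  rw [← zTensor_eval, hrank_comp_of_isIso_left]

lemma hrank_coev (i : Fin n) :
    hrank (Functor.whiskerRight (coevNat (k := k) (w := w) i) (zSub k w i).functor) K m =
      hrank (zToCorner k w i) K m := by
  rw [coev_zTensor, hrank_comp_of_isIso_right]
  rfl

lemma hdim_tensor (i : Fin n) : hdim (tensor i ⋙ (zSub k w i).functor) K m =
    hdim (cornerSub k w i).functor K m :=
  (hdim_eq_of_iso (asIso (zTensor k w i)) K m).symm

lemma hdim_tensorShift (i : Fin n) : hdim ((tensor i ⋙ shift w.z) ⋙ (zSub k w i).functor) K m =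
    hdim (cornerSub k w i).functor K m :=
  (hdim_eq_of_iso (asIso (zTensorShift k w i w.z)) K m).symm

lemma hdim_tensor_of_ne {i j : Fin n} (h : j ≠ i) :
    hdim (tensor i ⋙ (zSub k w j).functor) K m = 0 := by
  refine hdim_eq_zero K m ⟨?_⟩
  rintro ⟨_, ⟨t, rfl⟩⟩ ⟨_, ⟨t', rfl⟩⟩
  refine Subtype.ext ?_
  exact (z_smul_tensor_eq_zero h (t : leftIdeal k i ⊗[k] (K.X m).corner i)).trans
    (z_smul_tensor_eq_zero h (t' : leftIdeal k i ⊗[k] (K.X m).corner i)).symm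

lemma hdim_tensorShift_of_ne {i j : Fin n} (h : j ≠ i) :
    hdim ((tensor i ⋙ shift w.z) ⋙ (zSub k w j).functor) K m = 0 := by
  refine hdim_eq_zero K m ⟨?_⟩
  rintro ⟨_, ⟨t, rfl⟩⟩ ⟨_, ⟨t', rfl⟩⟩
  refine Subtype.ext ?_
  exact (z_smul_tensor_eq_zero h (t : leftIdeal k i ⊗[k] (K.X m).corner i)).trans
    (z_smul_tensor_eq_zero h (t' : leftIdeal k i ⊗[k] (K.X m).corner i)).symm

lemma hrank_le_right {C : Type*} [Category C] [Preadditive C] {Z Z' : C ⥤ ModuleCat.{u} k}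
    [Z.Additive] [Z'.Additive] [∀ X, Module.Finite k (Z'.obj X)] (α : Z ⟶ Z')
    (K : CochainComplex C ℤ) (m : ℤ) : hrank α K m ≤ hdim Z' K m :=
  Submodule.finrank_le _

lemma hrank_le_left {C : Type*} [Category C] [Preadditive C] {Z Z' : C ⥤ ModuleCat.{u} k}
    [Z.Additive] [Z'.Additive] [∀ X, Module.Finite k (Z.obj X)] (α : Z ⟶ Z')
    (K : CochainComplex C ℤ) (m : ℤ) : hrank α K m ≤ hdim Z K m :=
  LinearMap.finrank_range_le _

/-- The dimension of the cohomology of `z_j K`. -/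
def zdim (j : Fin n) : ℕ := hdim (zSub k w j).functor K m

/-- The functor `F` contributes nothing to the cone, since `z_j` kills `A e_i`. -/
lemma zdim_eval_of_ne {i j : Fin n} (h : j ≠ i) :
    zdim k w ((coneComplex (evalNat i)).obj K) m j = zdim k w K m j := by
  have h₁ := hdim_coneComplex (Z := (zSub k w j).functor) (evalNat (k := k) (w := w) i) K m
  have h₂ := hrank_le_left k (Functor.whiskerRight (evalNat (k := k) (w := w) i) (zSub k w j).functor) K m
  have h₃ := hrank_le_left k (Functor.whiskerRight (evalNat (k := k) (w := w) i) (zSub k w j).functor) K (m + 1)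
  rw [hdim_tensor_of_ne k w K _ h] at h₁ h₂ h₃
  have h₄ : hdim (𝟭 (GrProj k w) ⋙ (zSub k w j).functor) K m = zdim k w K m j := rfl
  rw [h₄] at h₁
  unfold zdim at *
  omega

lemma zdim_coev_of_ne {i j : Fin n} (h : j ≠ i) :
    zdim k w ((coneComplex (coevNat i)).obj K) m j = zdim k w K (m + 1) j := by
  have h₁ := hdim_coneComplex (Z := (zSub k w j).functor) (coevNat (k := k) (w := w) i) K m
  have h₂ := hrank_le_right k (Functor.whiskerRight (coevNat (k := k) (w := w) i) (zSub k w j).functor) K m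
  have h₃ := hrank_le_right k (Functor.whiskerRight (coevNat (k := k) (w := w) i) (zSub k w j).functor) K (m + 1)
  rw [hdim_tensorShift_of_ne k w K _ h] at h₁ h₂ h₃
  have h₄ : hdim (𝟭 (GrProj k w) ⋙ (zSub k w j).functor) K (m + 1) = zdim k w K (m + 1) j := rfl
  rw [h₄] at h₁
  unfold zdim at *
  omega

lemma zdim_eval (i : Fin n) : zdim k w ((coneComplex (evalNat i)).obj K) m i +
    hrank (cornerToZ k w i) K m + hrank (cornerToZ k w i) K (m + 1) =
      zdim k w K m i + hdim (cornerSub k w i).functor K (m + 1) := by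
  have h₁ := hdim_coneComplex (Z := (zSub k w i).functor) (evalNat (k := k) (w := w) i) K m
  rw [hrank_eval, hrank_eval, hdim_tensor] at h₁
  exact h₁

lemma zdim_coev (i : Fin n) : zdim k w ((coneComplex (coevNat i)).obj K) m i +
    hrank (zToCorner k w i) K m + hrank (zToCorner k w i) K (m + 1) =
      hdim (cornerSub k w i).functor K m + zdim k w K (m + 1) i := by
  have h₁ := hdim_coneComplex (Z := (zSub k w i).functor) (coevNat (k := k) (w := w) i) K m
  rw [hrank_coev, hrank_coev, hdim_tensorShift] at h₁
  exact h₁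

/-- Under the identification of `z_i (A e_i ⊗ e_i M)` with `e_i M`, the cone of `f_i` becomes the
cone of `z_i : e_i X ⟶ z_i X`. This map is onto, and the two dimension counts contain the same
ranks. -/
lemma zdim_eval_eq (i : Fin n) : zdim k w ((coneComplex (evalNat i)).obj K) m i =
    hdim (kerSub k w i).functor K (m + 1) := by
  have h₁ := zdim_eval k w K m i
  have h₂ := hdim_kerSub k w i K m
  unfold zdim at *
  omega

/-- The two cones are built from `z_i X` and `e_i X`, corrected by the ranks on cohomology of `z_i X
⟶ e_i X` and `e_i X ⟶ z_i X`. The composite of these maps is zero, so in each degree the ranks add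
up to at most the dimension of the cohomology of `e_i X`. Summed over degrees, this becomes the
convexity inequality (a). -/
lemma zdim_add_zdim_le (i : Fin n) : zdim k w K m i + zdim k w K (m + 1) i ≤
    zdim k w ((coneComplex (evalNat i)).obj K) m i +
      zdim k w ((coneComplex (coevNat i)).obj K) m i := by
  have h₁ := zdim_eval k w K m i
  have h₂ := zdim_coev k w K m i
  have h₃ := hrank_add_hrank_le _ _ (zToCorner_cornerToZ k w i) K m
  have h₄ := hrank_add_hrank_le _ _ (zToCorner_cornerToZ k w i) K (m + 1)
  omega

/-- The factor 2 is the number of edges between two vertices. -/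
lemma sum_neighbor (i : Fin n) (f : Fin n → ℕ) :
    ∑ x : Neighbor i, f x.2.1 = 2 * ∑ j ∈ Finset.univ.erase i, f j := by
  rw [Fintype.sum_prod_type]
  have h : ∑ j : {j : Fin n // j ≠ i}, f j.1 = ∑ j ∈ Finset.univ.erase i, f j := by
    rw [Finset.sum_subtype (Finset.univ.erase i) (p := fun j => j ≠ i) (by simp)]
  refine (Finset.sum_congr rfl fun _ _ => h).trans ?_
  rw [Finset.sum_const]
  rfl

/-- The cohomology of the product of the `z_j X` is bounded by that of its neighbours in the long
exact sequence, and the kernel of `z_i` computes the new invariant at `i` by `zdim_eval_eq`. -/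
lemma sum_zdim_le (i : Fin n) : 2 * ∑ j ∈ Finset.univ.erase i, zdim k w K (m + 1) j ≤
    zdim k w ((coneComplex (evalNat i)).obj K) m i + zdim k w K (m + 1 + 1) i := by
  have h₁ := hdim_pi k w i K (m + 1)
  have h₂ := sum_hdim_le_piFunctor (fun x : Neighbor i => zSub k w x.2.1) K (m + 1)
  have h₃ := sum_neighbor i fun j => zdim k w K (m + 1) j
  rw [zdim_eval_eq, ← h₃]
  unfold zdim at *
  omega

/-- With a single vertex the product is empty, so the inclusion of `z_i X` in the kernel of `z_i`
has full rank on cohomology. Two consecutive degrees of `hdim_pi` are used to compare the two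
dimensions in degree `m + 1`. -/
lemma zdim_eval_of_isEmpty (i : Fin n) (h : ∀ j : Fin n, j = i) :
    zdim k w ((coneComplex (evalNat i)).obj K) m i = zdim k w K (m + 1) i := by
  have h₀ : IsEmpty (Neighbor i) := ⟨fun x => x.2.2 (h _)⟩
  have hpi (m : ℤ) : hdim (piFunctor fun x : Neighbor i => zSub k w x.2.1) K m = 0 :=
    hdim_eq_zero K m (inferInstanceAs (Subsingleton (∀ x : Neighbor i,
      (zSub k w x.2.1).sub (K.X m))))
  have h₁ := hdim_pi k w i K m
  have h₂ := hdim_pi k w i K (m + 1)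
  have h₃ := hrank_le_left k (zToKer k w i) K (m + 1)
  have h₄ := hrank_le_right k (zToKer k w i) K (m + 1)
  have h₅ := hrank_le_right k (zToKer k w i) K m
  have h₆ := hrank_le_left k (zToKer k w i) K (m + 1 + 1)
  rw [hpi] at h₁ h₂
  rw [zdim_eval_eq]
  unfold zdim
  omega

end Tensor

/-! ### The numerical invariants of objects -/

section Invariants

lemma finsum_le_finsum_nat {f g : ℤ → ℕ} (hg : (Function.support g).Finite) (h : ∀ m, f m ≤ g m) :
    ∑ᶠ m, f m ≤ ∑ᶠ m, g m := by
  have hf : Function.support f ⊆ hg.toFinset := fun m hm => by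
    rw [hg.coe_toFinset]
    exact (lt_of_lt_of_le (Nat.pos_of_ne_zero hm) (h m)).ne'
  rw [finsum_eq_sum_of_support_subset f hf, finsum_eq_sum_of_support_subset g hg.coe_toFinset.ge]
  exact Finset.sum_le_sum fun m _ => h m

lemma hdim_eq_of_homotopyEquiv {k : Type u} [Field k] {C : Type*} [Category C] [Preadditive C]
    (Z : C ⥤ ModuleCat.{u} k) [Z.Additive] {K L : CochainComplex C ℤ} (e : HomotopyEquiv K L)
    (m : ℤ) : hdim Z K m = hdim Z L m :=
  finrank_eq_of_iso ((Z.mapHomotopyEquiv e).toHomologyIso m)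

lemma hdim_shift {k : Type u} [Field k] {C : Type*} [Category C] [Preadditive C]
    (Z : C ⥤ ModuleCat.{u} k) [Z.Additive] (K : CochainComplex C ℤ) (a m m' : ℤ) (h : a + m = m') :
    hdim Z ((CategoryTheory.shiftFunctor _ a).obj K) m = hdim Z K m' :=
  finrank_eq_of_iso ((HomologicalComplex.homologyFunctor _ _ m).mapIso
      (((Z.mapHomologicalComplex (ComplexShape.up ℤ)).commShiftIso a).app K) ≪≫
    (ShiftSequence.shiftIso (ModuleCat.{u} k) a m m' h).app _)

variable {n : ℕ} {G : Type} [AddCommGroup G] [DecidableEq G]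
variable {k : Type u} [Field k] {w : Weight n G}

/-- The dimension of the cohomology of `z_j X` in degree `m`. -/
def zhom (j : Fin n) (m : ℤ) (X : DCat k w) : ℕ := zdim k w X.obj.as m j

lemma zhom_eq_of_obj_iso (j : Fin n) (m : ℤ) {X : DCat k w} {K : CochainComplex (GrProj k w) ℤ}
    (e : X.obj ≅ (HomotopyCategory.quotient _ _).obj K) : zhom j m X = zdim k w K m j :=
  hdim_eq_of_homotopyEquiv _ (HomotopyCategory.homotopyEquivOfIso e) m

lemma zhom_eq_of_iso (j : Fin n) (m : ℤ) {X Y : DCat k w} (e : X ≅ Y) : zhom j m X = zhom j m Y :=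
  zhom_eq_of_obj_iso j m ((bounded _).ι.mapIso e)

lemma zhom_shift (j : Fin n) (a m m' : ℤ) (h : a + m = m') (X : DCat k w) :
    zhom j m ((CategoryTheory.shiftFunctor (DCat k w) a).obj X) = zhom j m' X := by
  refine Eq.trans (zhom_eq_of_obj_iso j m
    (K := (CategoryTheory.shiftFunctor _ a).obj X.obj.as) ?_) (hdim_shift _ _ a m m' h)
  exact ((bounded _).ι.commShiftIso a).app X ≪≫
    (((HomotopyCategory.quotient _ _).commShiftIso a).app X.obj.as).symm

lemma zhom_twistInv_of_ne {i j : Fin n} (h : j ≠ i) (m : ℤ) (X : DCat k w) :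
    zhom j m ((twistInv i).obj X) = zhom j m X :=
  zdim_eval_of_ne k w X.obj.as m h

lemma zhom_twist (i j : Fin n) (m : ℤ) (X : DCat k w) : zhom j (m + 1) ((twist i).obj X) =
    zdim k w ((coneComplex (GrProj.coevNat i)).obj X.obj.as) m j :=
  zhom_shift j (-1) (m + 1) m (by omega) ((boundedCone (GrProj.coevNat i)).obj X)

lemma zhom_twist_of_ne {i j : Fin n} (h : j ≠ i) (m : ℤ) (X : DCat k w) :
    zhom j m ((twist i).obj X) = zhom j m X := by
  have h₁ := zhom_twist i j (m - 1) X
  rw [zdim_coev_of_ne k w X.obj.as (m - 1) h, sub_add_cancel] at h₁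
  exact h₁

lemma zhom_add_zhom_le (i : Fin n) (m : ℤ) (X : DCat k w) : zhom i m X + zhom i (m + 1) X ≤
    zhom i m ((twistInv i).obj X) + zhom i (m + 1) ((twist i).obj X) := by
  rw [zhom_twist]
  exact zdim_add_zdim_le k w X.obj.as m i

lemma sum_zhom_le (i : Fin n) (m : ℤ) (X : DCat k w) :
    2 * ∑ j ∈ Finset.univ.erase i, zhom j (m + 1) X ≤
      zhom i m ((twistInv i).obj X) + zhom i (m + 1 + 1) X :=
  sum_zdim_le k w X.obj.as m i

lemma zhom_twistInv_of_forall_eq (i : Fin n) (h : ∀ j : Fin n, j = i) (m : ℤ) (X : DCat k w) :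
    zhom i m ((twistInv i).obj X) = zhom i (m + 1) X :=
  zdim_eval_of_isEmpty k w X.obj.as m i h

lemma finite_support_zhom (j : Fin n) (X : DCat k w) :
    (Function.support fun m => zhom j m X).Finite := by
  obtain ⟨a, b, h⟩ := X.property
  refine (Set.finite_Icc a b).subset fun m hm => ?_
  by_contra hab
  refine hm (hdim_eq_zero _ _ ?_)
  have := ((zSub k w j).functor.map_isZero (h m (by rw [Set.mem_Icc] at hab; omega)))
  exact ModuleCat.subsingleton_of_isZero this

/-- The total dimension of the cohomology of `z_j X`. -/
def ztot (j : Fin n) (X : DCat k w) : ℕ := ∑ᶠ m, zhom j m X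

lemma ztot_eq_of_iso (j : Fin n) {X Y : DCat k w} (e : X ≅ Y) : ztot j X = ztot j Y :=
  finsum_congr fun m => zhom_eq_of_iso j m e

lemma ztot_twistInv_of_ne {i j : Fin n} (h : j ≠ i) (X : DCat k w) :
    ztot j ((twistInv i).obj X) = ztot j X :=
  finsum_congr fun m => zhom_twistInv_of_ne h m X

lemma ztot_twist_of_ne {i j : Fin n} (h : j ≠ i) (X : DCat k w) :
    ztot j ((twist i).obj X) = ztot j X :=
  finsum_congr fun m => zhom_twist_of_ne h m X

lemma finite_support_zhom_add (j : Fin n) (a : ℤ) (X : DCat k w) :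
    (Function.support fun m => zhom j (m + a) X).Finite :=
  (finite_support_zhom j X).preimage (add_left_injective a).injOn

lemma finsum_zhom_add (j : Fin n) (a : ℤ) (X : DCat k w) : ∑ᶠ m, zhom j (m + a) X = ztot j X :=
  finsum_comp_equiv (Equiv.addRight a) (f := fun m => zhom j m X)

lemma ztot_add_ztot_le (i : Fin n) (X : DCat k w) :
    2 * ztot i X ≤ ztot i ((twistInv i).obj X) + ztot i ((twist i).obj X) := by
  have h := finsum_le_finsum_nat (f := fun m => zhom i m X + zhom i (m + 1) X)
    (g := fun m => zhom i m ((twistInv i).obj X) + zhom i (m + 1) ((twist i).obj X))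
    (((finite_support_zhom i _).union (finite_support_zhom_add i 1 _)).subset
      (Function.support_add _ _)) fun m => zhom_add_zhom_le i m X
  rw [finsum_add_distrib (finite_support_zhom i X) (finite_support_zhom_add i 1 X),
    finsum_add_distrib (finite_support_zhom i _) (finite_support_zhom_add i 1 _),
    finsum_zhom_add, finsum_zhom_add] at h
  rw [two_mul]
  exact h

lemma sum_ztot_le_twistInv (i : Fin n) (X : DCat k w) :
    2 * ∑ j ∈ Finset.univ.erase i, ztot j X ≤ ztot i ((twistInv i).obj X) + ztot i X := by
  have hs : (Function.support fun m => ∑ j ∈ Finset.univ.erase i, zhom j (m + 1) X).Finite := by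
    refine (Set.finite_iUnion fun j : Fin n => finite_support_zhom_add j 1 X).subset ?_
    intro m hm
    obtain ⟨j, -, hj⟩ := Finset.exists_ne_zero_of_sum_ne_zero hm
    exact Set.mem_iUnion.2 ⟨j, hj⟩
  have h := finsum_le_finsum_nat (f := fun m => 2 * ∑ j ∈ Finset.univ.erase i, zhom j (m + 1) X)
    -- The terms of `sum_zhom_le` lie in the degrees `m`, `m + 1` and `m + 2`; summation over all
    -- degrees forgets these offsets.
    (g := fun m => zhom i m ((twistInv i).obj X) + zhom i (m + 2) X)
    (((finite_support_zhom i _).union (finite_support_zhom_add i 2 _)).subset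
      (Function.support_add _ _)) fun m => by
      have := sum_zhom_le i m X
      rwa [add_assoc m] at this
  rw [finsum_add_distrib (finite_support_zhom i _) (finite_support_zhom_add i 2 _),
    finsum_zhom_add, ← mul_finsum, finsum_sum_comm _ _
      fun j _ => finite_support_zhom_add j 1 X] at h
  simp only [finsum_zhom_add] at h
  exact h

/-- The inequality for `Σ_i⁻¹`, applied to `Σ_i X`: the object `Σ_i⁻¹ Σ_i X` is isomorphic to `X`,
and the invariants away from `i` do not change. -/
lemma sum_ztot_le_twist (i : Fin n) (X : DCat k w) :
    2 * ∑ j ∈ Finset.univ.erase i, ztot j X ≤ ztot i ((twist i).obj X) + ztot i X := by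
  have h := sum_ztot_le_twistInv i ((twist i).obj X)
  have e : ztot i ((twistInv i).obj ((twist i).obj X)) = ztot i X :=
    ztot_eq_of_iso i ((twistEquiv i).unitIso.symm.app X)
  rw [e, add_comm,
    Finset.sum_congr rfl fun j hj => ztot_twist_of_ne (Finset.ne_of_mem_erase hj) X] at h
  exact h

end Invariants

/-! ### The ping-pong game -/

section PingPong

variable {n : ℕ} {G : Type} [AddCommGroup G] [DecidableEq G]
variable {k : Type u} [Field k] {w : Weight n G}

/-- The functor of a letter: `Σ_i` for `σ_i` and `Σ_i⁻¹` for `σ_i⁻¹`. -/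
def letter (l : Fin n × Bool) : DCat k w ⥤ DCat k w :=
  if l.2 then twist l.1 else twistInv l.1

/-- The inverse of a letter. -/
abbrev invLetter (l : Fin n × Bool) : Fin n × Bool := (l.1, !l.2)

variable (k w) in
/-- The functor of the inverse of a letter is inverse to that of the letter. -/
lemma nonempty_letter_invLetter_iso (l : Fin n × Bool) (X : DCat k w) :
    Nonempty ((letter (invLetter l)).obj ((letter l).obj X) ≅ X) := by
  obtain ⟨i, b | b⟩ := l
  · exact ⟨(twistEquiv i).counitIso.app X⟩
  · exact ⟨(twistEquiv i).unitIso.symm.app X⟩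

/-- The sum of the invariants of the vertices `j ≠ i`. -/
def zrest (i : Fin n) (X : DCat k w) : ℕ := ∑ j ∈ Finset.univ.erase i, ztot j X

lemma ztot_letter_of_ne (l : Fin n × Bool) {j : Fin n} (h : j ≠ l.1) (X : DCat k w) :
    ztot j ((letter l).obj X) = ztot j X := by
  obtain ⟨i, b | b⟩ := l
  · exact ztot_twistInv_of_ne h X
  · exact ztot_twist_of_ne h X

lemma zrest_letter (l : Fin n × Bool) (X : DCat k w) :
    zrest l.1 ((letter l).obj X) = zrest l.1 X :=
  Finset.sum_congr rfl fun _ hj => ztot_letter_of_ne l (Finset.ne_of_mem_erase hj) X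

lemma zrest_le (l : Fin n × Bool) (X : DCat k w) :
    2 * zrest l.1 X ≤ ztot l.1 ((letter l).obj X) + ztot l.1 X := by
  obtain ⟨i, b | b⟩ := l
  · exact sum_ztot_le_twistInv i X
  · exact sum_ztot_le_twist i X

lemma ztot_le (l : Fin n × Bool) (X : DCat k w) :
    2 * ztot l.1 X ≤ ztot l.1 ((letter l).obj X) + ztot l.1 ((letter (invLetter l)).obj X) := by
  obtain ⟨i, b | b⟩ := l
  · exact ztot_add_ztot_le i X
  · rw [add_comm]
    exact ztot_add_ztot_le i X

lemma ztot_invLetter_letter (l : Fin n × Bool) (X : DCat k w) (j : Fin n) :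
    ztot j ((letter (invLetter l)).obj ((letter l).obj X)) = ztot j X :=
  ztot_eq_of_iso j (nonempty_letter_invLetter_iso k w l X).some

lemma ztot_le_zrest {i j : Fin n} (h : j ≠ i) (X : DCat k w) : ztot j X ≤ zrest i X :=
  Finset.single_le_sum (f := fun j => ztot j X) (fun _ _ => Nat.zero_le _)
    (Finset.mem_erase.2 ⟨h, Finset.mem_univ j⟩)

lemma sum_ztot (i : Fin n) (X : DCat k w) : ∑ j, ztot j X = ztot i X + zrest i X :=
  (Finset.add_sum_erase _ _ (Finset.mem_univ i)).symm

/-- The regions of the ping-pong game: `X` looks like a value of the functor of `l`. -/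
def Attracted (l : Fin n × Bool) (X : DCat k w) : Prop :=
  -- The first condition lets a letter at another vertex act next. The second, that undoing `l`
  -- lowers the number, lets `l` itself act again.
  zrest l.1 X < ztot l.1 X ∧ ztot l.1 ((letter (invLetter l)).obj X) < ztot l.1 X

/-- With `t` the number at the vertex of `l` and `R` the sum of the others, inequality (b) gives a
new number at least `2 * R - t`. As `t < R`, this exceeds `R`, hence also `t`. -/
lemma attracted_of_lt (l : Fin n × Bool) (X : DCat k w) (h : ztot l.1 X < zrest l.1 X) :
    Attracted l ((letter l).obj X) ∧ ∑ j, ztot j X < ∑ j, ztot j ((letter l).obj X) := by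
  rw [Attracted, zrest_letter, ztot_invLetter_letter, sum_ztot l.1, sum_ztot l.1, zrest_letter]
  have := zrest_le l X
  omega

/-- If the letter is repeated, convexity (a) continues the increase. If the vertex changes, the
number at the old vertex dominates the number at the new one, and `attracted_of_lt` applies. The
hypothesis `hl` excludes just the inverse letter. -/
lemma attracted_of_attracted {l l₀ : Fin n × Bool} (hl : l.1 = l₀.1 → l.2 = l₀.2) (X : DCat k w)
    (h : Attracted l₀ X) :
    Attracted l ((letter l).obj X) ∧ ∑ j, ztot j X < ∑ j, ztot j ((letter l).obj X) := by
  by_cases h₁ : l.1 = l₀.1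
  · obtain rfl : l = l₀ := Prod.ext h₁ (hl h₁)
    obtain ⟨h₂, h₃⟩ := h
    rw [Attracted, zrest_letter, ztot_invLetter_letter, sum_ztot l.1, sum_ztot l.1, zrest_letter]
    have := ztot_le l X
    omega
  · refine attracted_of_lt l X ?_
    have h₂ := ztot_le_zrest (Ne.symm h₁) X
    have h₃ := ztot_le_zrest h₁ X
    have := h.1
    omega

/-- The action of a word on an object. -/
def act (L : List (Fin n × Bool)) (X : DCat k w) : DCat k w :=
  L.foldr (fun l Y => (letter l).obj Y) X

/-- The last letter of a word acts first, so the hypothesis on the starting object concerns the end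
of the list. -/
lemma attracted_act (l : Fin n × Bool) (L : List (Fin n × Bool)) (h : FreeGroup.IsReduced (l :: L))
    (X : DCat k w)
    (hX : ∀ l' ∈ (l :: L).getLast?, ztot l'.1 X < zrest l'.1 X) :
    Attracted l (act (l :: L) X) ∧ ∑ j, ztot j X < ∑ j, ztot j (act (l :: L) X) := by
  induction L generalizing l with
  | nil => exact attracted_of_lt l X (hX l rfl)
  | cons l' L ih =>
    obtain ⟨h₁, h₂⟩ := FreeGroup.isReduced_cons_cons.1 h
    obtain ⟨h₃, h₄⟩ := ih l' h₂ fun m hm => hX m (by rwa [List.getLast?_cons_cons])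
    obtain ⟨h₅, h₆⟩ := attracted_of_attracted h₁ _ h₃
    exact ⟨h₅, h₄.trans h₆⟩

/-- The exponent sum of a word, with `σ_i` counted as `-1`. -/
def expSum (L : List (Fin n × Bool)) : ℤ := (L.map fun l => if l.2 then -1 else 1).sum

/-- The case of a single vertex, where the ping-pong inequalities are void and the position of the
cohomology serves as the invariant instead. -/
lemma zhom_letter (i : Fin n) (h : ∀ j : Fin n, j = i) (l : Fin n × Bool) (m : ℤ) (X : DCat k w) :
    zhom i m ((letter l).obj X) = zhom i (m + if l.2 then -1 else 1) X := by
  obtain ⟨j, b | b⟩ := l <;> obtain rfl := h j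
  · exact zhom_twistInv_of_forall_eq j h m X
  -- The statement for `Σ` follows from the one for `Σ⁻¹`, applied to `Σ X`.
  · have h₁ := zhom_twistInv_of_forall_eq j h (m - 1) ((twist j).obj X)
    have h₂ := zhom_eq_of_iso j (m - 1) ((twistEquiv (k := k) (w := w) j).unitIso.app X)
    rw [sub_add_cancel] at h₁
    exact (h₂.trans h₁).symm

lemma zhom_act (i : Fin n) (h : ∀ j : Fin n, j = i) (L : List (Fin n × Bool)) (m : ℤ)
    (X : DCat k w) : zhom i m (act L X) = zhom i (m + expSum L) X := by
  induction L generalizing m with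
  | nil => simp [act, expSum]
  | cons l L ih =>
    refine (zhom_letter i h l m _).trans ((ih _).trans ?_)
    rw [expSum, expSum, List.map_cons, List.sum_cons, add_assoc]

/-- A reduced word in one generator repeats a single letter. -/
lemma expSum_eq (i : Fin n) (h : ∀ j : Fin n, j = i) (l : Fin n × Bool) (L : List (Fin n × Bool))
    (hL : FreeGroup.IsReduced (l :: L)) :
    expSum (l :: L) = (if l.2 then -1 else 1) * (L.length + 1) := by
  induction L generalizing l with
  | nil => simp [expSum]
  | cons l' L ih =>
    obtain ⟨h₁, h₂⟩ := FreeGroup.isReduced_cons_cons.1 hL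
    have h₃ : l.2 = l'.2 := h₁ ((h _).trans (h _).symm)
    rw [expSum, List.map_cons, List.sum_cons]
    have := ih l' h₂
    rw [expSum] at this
    rw [this, h₃, List.length_cons]
    push_cast
    ring

lemma expSum_ne_zero (i : Fin n) (h : ∀ j : Fin n, j = i) (L : List (Fin n × Bool)) (hL : L ≠ [])
    (hr : FreeGroup.IsReduced L) : expSum L ≠ 0 := by
  obtain ⟨l, L, rfl⟩ := List.exists_cons_of_ne_nil hL
  rw [expSum_eq i h l L hr]
  split_ifs <;> omega

end PingPong

/-! ### Faithfulness of the action -/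

section Faithful

variable {n : ℕ} {G : Type} [AddCommGroup G] [DecidableEq G]
variable (k : Type u) [Field k] (w : Weight n G)

open GrProj

/-- The components of the projective module `P_i`. -/
def projPiece (i : Fin n) (g : G) : Submodule k (leftIdeal k i) :=
  (w.piece k g).comap ((leftIdeal k i).subtype.restrictScalars k)

lemma iSup_projPiece (i : Fin n) : ⨆ g, projPiece k w i g = ⊤ := by
  rw [eq_top_iff]
  rintro p -
  rw [← inP_coe i p]
  generalize (p : Zigzag k n) = a
  have ha : a ∈ ⨆ g, w.piece k g := by rw [ZigzagFree.iSup_piece]; trivial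
  induction ha using Submodule.iSup_induction' with
  | mem g a ha =>
    refine Submodule.mem_iSup_of_mem g ?_
    have := mul_mem_piece w k ha (gen_mem_piece w k (.e i))
    rwa [show w.deg (.e i) = 0 from rfl, add_zero] at this
  | zero => rw [map_zero]; exact Submodule.zero_mem _
  | add x y _ _ hx hy => rw [map_add]; exact Submodule.add_mem _ hx hy

/-- The graded projective module `P_i = A e_i`. -/
def proj (i : Fin n) : GrProj k w where
  carrier := leftIdeal k i
  piece := projPiece k w i
  isInternal := isInternal_of_coact k _ (iSup_projPiece k w i)
    (Finsupp.mapRange.linearMap ((inP k i).restrictScalars k) ∘ₗ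
      coactLin k w ∘ₗ (leftIdeal k i).subtype.restrictScalars k) fun g m hm => by
    have h : coactLin k w m = Finsupp.single g (m : Zigzag k n) := by
      simp [coactLin, coact_of_mem w k (show (m : Zigzag k n) ∈ w.piece k g from hm)]
    simp [h, inP_coe]
  smul_mem ha hm := mul_mem_piece w k ha hm

/-- A module, as a complex in degree `0`. -/
def singleObj (M : GrProj k w) : DCat k w where
  obj := (HomotopyCategory.quotient _ _).obj ((HomologicalComplex.single _ _ 0).obj M)
  property := ⟨0, 0, fun m hm =>
    HomologicalComplex.isZero_single_obj_X (ComplexShape.up ℤ) 0 M m (by omega)⟩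

lemma zhom_singleObj (M : GrProj k w) (j : Fin n) :
    zhom j 0 (singleObj k w M) = Module.finrank k ((zSub k w j).sub M) :=
  finrank_eq_of_iso ((HomologicalComplex.homologyFunctor _ _ 0).mapIso
    ((HomologicalComplex.singleMapHomologicalComplex (zSub k w j).functor
      (ComplexShape.up ℤ) 0).app M) ≪≫ HomologicalComplex.singleObjHomologySelfIso _ _ _)

lemma zhom_singleObj_of_ne (M : GrProj k w) (j : Fin n) {m : ℤ} (hm : m ≠ 0) :
    zhom j m (singleObj k w M) = 0 :=
  hdim_eq_zero _ _ (ModuleCat.subsingleton_of_isZero ((zSub k w j).functor.map_isZero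
    (HomologicalComplex.isZero_single_obj_X (ComplexShape.up ℤ) 0 M m hm)))

/-- The class of `z_i` in `z_i P_i` is non-zero because its coefficient is `1`. -/
lemma zhom_proj_self (i : Fin n) : zhom i 0 (singleObj k w (proj k w i)) ≠ 0 := by
  rw [zhom_singleObj]
  intro h
  have h₀ := Module.finrank_zero_iff.1 h
  have h₁ : (⟨inP k i (gen k (.z i)), ⟨idemP k i, (inP_eq i _).symm⟩⟩ :
    (zSub k w i).sub (proj k w i)) = 0 := Subsingleton.elim _ _
  have h₂ : gen k (.z i) * idem k i = 0 := congrArg (fun x => (x.1 : leftIdeal k i).1) h₁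
  have h₃ := congrArg (coefZ k i) h₂
  rw [z_mul_idem] at h₃
  simp at h₃

lemma zhom_proj_of_ne {i j : Fin n} (h : j ≠ i) (m : ℤ) :
    zhom j m (singleObj k w (proj k w i)) = 0 := by
  by_cases hm : m = 0
  · subst hm
    rw [zhom_singleObj]
    refine Module.finrank_zero_iff.2 ⟨?_⟩
    rintro ⟨_, ⟨t, rfl⟩⟩ ⟨_, ⟨t', rfl⟩⟩
    refine Subtype.ext (Subtype.ext ?_)
    exact (z_mul_of_mem_leftIdeal k h (mem_leftIdeal.1 t.2)).trans
      (z_mul_of_mem_leftIdeal k h (mem_leftIdeal.1 t'.2)).symm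
  · exact zhom_singleObj_of_ne k w _ _ hm

/-- `P_j` is a starting position for every word whose first acting letter sits at a vertex other
than `j`. -/
lemma ztot_lt_zrest {i j : Fin n} (h : j ≠ i) :
    ztot i (singleObj k w (proj k w j)) < zrest i (singleObj k w (proj k w j)) := by
  have h₁ : ztot i (singleObj k w (proj k w j)) = 0 :=
    finsum_eq_zero_of_forall_eq_zero fun m => zhom_proj_of_ne k w (Ne.symm h) m
  have h₂ : 0 < ztot j (singleObj k w (proj k w j)) := by
    have := finite_support_zhom j (singleObj k w (proj k w j))
    refine lt_of_lt_of_le (Nat.pos_of_ne_zero (zhom_proj_self k w j)) ?_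
    exact single_le_finsum 0 this fun _ => Nat.zero_le _
  rw [h₁]
  exact h₂.trans_le (ztot_le_zrest h _)

/-- The homomorphism from the free group given by the twists. -/
def actionHom : FreeGroup (Fin n) →* AutClass (DCat k w) :=
  FreeGroup.lift fun i => AutClass.mk (twistEquiv i)

/-- Isomorphisms object by object suffice, since the invariants depend only on objects. -/
lemma exists_actionHom_eq (L : List (Fin n × Bool)) : ∃ e : DCat k w ≌ DCat k w,
    AutClass.mk e = actionHom k w (FreeGroup.mk L) ∧
      ∀ X, Nonempty (e.functor.obj X ≅ act L X) := by
  induction L with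
  | nil => exact ⟨CategoryTheory.Equivalence.refl, (map_one (actionHom k w)).symm,
      fun X => ⟨Iso.refl _⟩⟩
  | cons l L ih =>
    obtain ⟨e, he, h⟩ := ih
    obtain ⟨f, hf, h'⟩ : ∃ f : DCat k w ≌ DCat k w,
        AutClass.mk f = actionHom k w (FreeGroup.mk [l]) ∧ f.functor = letter l := by
      obtain ⟨i, b | b⟩ := l
      · refine ⟨(twistEquiv i).symm, ?_, rfl⟩
        rw [actionHom, FreeGroup.lift_mk]
        simp
        rfl
      · refine ⟨twistEquiv i, ?_, rfl⟩
        rw [actionHom, FreeGroup.lift_mk]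
        simp
    refine ⟨e.trans f, ?_, fun X => ?_⟩
    · rw [show FreeGroup.mk (l :: L) = FreeGroup.mk [l] * FreeGroup.mk L from
        (FreeGroup.mul_mk (L₁ := [l]) (L₂ := L)).symm,
        map_mul, ← he, ← hf]
      rfl
    · exact ⟨f.functor.mapIso (h X).some ≪≫ eqToIso (by rw [h']; rfl)⟩

lemma actionHom_injective : Function.Injective (actionHom k w) := by
  rw [injective_iff_map_eq_one]
  intro g hg
  by_contra hne
  have hL : g.toWord ≠ [] := fun h => hne (FreeGroup.toWord_eq_nil_iff.1 h)
  have hr : FreeGroup.IsReduced g.toWord := FreeGroup.isReduced_toWord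
  have hX (X : DCat k w) : Nonempty (act g.toWord X ≅ X) := by
    obtain ⟨e, he, h⟩ := exists_actionHom_eq k w g.toWord
    rw [FreeGroup.mk_toWord, hg] at he
    obtain ⟨u⟩ : Nonempty (e.functor ≅ 𝟭 _) := Quotient.exact he
    exact ⟨(h X).some.symm ≪≫ u.app X⟩
  -- The vertex `i` of the letter that acts first; the starting object has to be a `P_j` with `j ≠
  -- i`.
  have hi := List.getLast?_eq_getLast_of_ne_nil hL
  set i := (g.toWord.getLast hL).1
  by_cases h : ∃ j, j ≠ i
  · obtain ⟨j, hj⟩ := h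
    obtain ⟨l, L, hl⟩ := List.exists_cons_of_ne_nil hL
    obtain ⟨e⟩ := hX (singleObj k w (proj k w j))
    have := (attracted_act l L (hl ▸ hr) (singleObj k w (proj k w j)) fun l' hl' => by
      rw [← hl, hi] at hl'
      obtain rfl := Option.mem_some_iff.1 hl'
      exact ztot_lt_zrest k w hj).2
    rw [← hl] at this
    exact this.ne (Finset.sum_congr rfl fun j _ => (ztot_eq_of_iso j e).symm)
  -- With a single vertex, the cohomology of `z_i P_i` is concentrated in degree `0`, and a non-zero
  -- exponent sum moves it away from there.
  · push Not at h
    obtain ⟨e⟩ := hX (singleObj k w (proj k w i))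
    have h₁ := zhom_eq_of_iso i 0 e
    rw [zhom_act i h, zero_add, zhom_singleObj_of_ne k w _ _ (expSum_ne_zero i h _ hL hr)] at h₁
    exact zhom_proj_self k w i h₁.symm

theorem actsFaithfully : ActsFaithfully k w := by
  refine ⟨actionHom k w, fun i => ⟨?_, ?_⟩, actionHom_injective k w⟩
  · exact ⟨twistEquiv i, FreeGroup.lift_apply_of.symm, ⟨Iso.refl _⟩⟩
  · refine ⟨(twistEquiv i).symm, ?_, ⟨Iso.refl _⟩⟩
    rw [map_inv, actionHom, FreeGroup.lift_apply_of]
    rfl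

end Faithful

/-! ### Classes of linear triangulated auto-equivalences form a subgroup -/

section LinearTriangulated

variable (k : Type u) [Field k] {D : Type*} [Category D] [Preadditive D] [CategoryTheory.Linear k D]
  [HasZeroObject D] [HasShift D ℤ] [∀ m : ℤ, (CategoryTheory.shiftFunctor D m).Additive]
  [Pretriangulated D]

/-- The class `c` contains a linear triangulated auto-equivalence. -/
def AutClass.IsLinearTriangulated (c : AutClass D) : Prop :=
  ∃ e : D ≌ D, AutClass.mk e = c ∧ e.functor.Linear k ∧
    ∃ _ : e.functor.CommShift ℤ, e.functor.IsTriangulated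

variable {k}

lemma AutClass.IsLinearTriangulated.one : (1 : AutClass D).IsLinearTriangulated k :=
  ⟨CategoryTheory.Equivalence.refl, rfl, inferInstanceAs ((𝟭 D).Linear k),
    inferInstanceAs ((𝟭 D).CommShift ℤ), inferInstanceAs ((𝟭 D).IsTriangulated)⟩

lemma AutClass.IsLinearTriangulated.mul {c d : AutClass D} (hc : c.IsLinearTriangulated k)
    (hd : d.IsLinearTriangulated k) : (c * d).IsLinearTriangulated k := by
  obtain ⟨e, rfl, h₁, h₂, h₃⟩ := hc
  obtain ⟨f, rfl, h₁', h₂', h₃'⟩ := hd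
  exact ⟨f.trans e, rfl, inferInstanceAs ((f.functor ⋙ e.functor).Linear k),
    inferInstanceAs ((f.functor ⋙ e.functor).CommShift ℤ),
    inferInstanceAs ((f.functor ⋙ e.functor).IsTriangulated)⟩

/-- Linearity, the commutation with shifts and exactness all pass from an equivalence to its
quasi-inverse. -/
lemma AutClass.IsLinearTriangulated.inv {c : AutClass D} (hc : c.IsLinearTriangulated k) :
    c⁻¹.IsLinearTriangulated k := by
  obtain ⟨e, rfl, h₁, h₂, h₃⟩ := hc
  have : e.functor.Additive := Functor.additive_of_preserves_binary_products _
  let := e.commShiftInverse ℤ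
  have := e.commShift_of_functor ℤ
  have := CategoryTheory.Equivalence.IsTriangulated.mk' e h₃
  exact ⟨e.symm, rfl, CategoryTheory.Equivalence.inverseLinear k e,
    inferInstanceAs (e.inverse.CommShift ℤ),
    inferInstanceAs (e.inverse.IsTriangulated)⟩

end LinearTriangulated

/-! ### Linearity of the action and finiteness of morphism spaces -/

section TwistLinear

variable {n : ℕ} {G : Type} [AddCommGroup G] [DecidableEq G]
variable (k : Type u) [Field k] (w : Weight n G)

open GrProj

instance (i : Fin n) : (tensor (k := k) (w := w) i).Linear k where
  map_smul {_ _} f r := tensor_hom_ext i fun p v =>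
    TensorProduct.tmul_smul r p (cornerMap i f v)

instance (m : ℤ) : (CategoryTheory.shiftFunctor (DCat k w) m).Linear k where
  map_smul {X Y} f r := by
    have : (CategoryTheory.shiftFunctor (DCat k w) m ⋙ (bounded (GrProj k w)).ι).Linear k :=
      Functor.linear_of_iso k ((bounded (GrProj k w)).ι.commShiftIso m).symm
    apply (bounded (GrProj k w)).ι.map_injective
    refine Eq.trans ?_ (Functor.map_smul (bounded (GrProj k w)).ι r _).symm
    exact Functor.map_smul
      (CategoryTheory.shiftFunctor (DCat k w) m ⋙ (bounded (GrProj k w)).ι) r f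

/-- The functor `Σ_i⁻¹` is a cone without further shift, so its structure is at hand. `Σ_i` is
treated as the inverse of `Σ_i⁻¹`, which avoids the signs involved in viewing a shift as a
triangulated functor. -/
lemma isLinearTriangulated_actionHom (g : FreeGroup (Fin n)) :
    (actionHom k w g).IsLinearTriangulated k := by
  have h (i : Fin n) : ((actionHom k w (FreeGroup.of i))⁻¹).IsLinearTriangulated k :=
    ⟨(twistEquiv i).symm, by rw [actionHom, FreeGroup.lift_apply_of]; rfl,
      inferInstanceAs ((boundedCone (evalNat i)).Linear k),
      inferInstanceAs ((boundedCone (evalNat i)).CommShift ℤ),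
      inferInstanceAs ((boundedCone (evalNat i)).IsTriangulated)⟩
  induction g using FreeGroup.induction_on with
  | C1 => rw [map_one]; exact .one
  | of i => rw [← inv_inv (actionHom k w _)]; exact (h i).inv
  | inv_of i => rw [map_inv]; exact h i
  | mul x y hx hy => rw [map_mul]; exact hx.mul hy

instance finite_hom (M N : GrProj k w) : Module.Finite k (M ⟶ N) := by
  let f : (M ⟶ N) →ₗ[k] (M →ₗ[k] N) :=
    { toFun := fun f => (toLin f).restrictScalars k
      map_add' := fun _ _ => rfl
      map_smul' := fun _ _ => rfl }
  refine Module.Finite.of_injective f fun a b h => hom_ext fun m => ?_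
  exact LinearMap.congr_fun h m

/-- A chain map from a bounded complex has finitely many non-zero components, each in a finite
dimensional space; homotopy classes form a quotient. -/
lemma finite_hom_DCat (X Y : DCat k w) : Module.Finite k (X ⟶ Y) := by
  obtain ⟨a, b, h⟩ := X.property
  let f : (X.obj.as ⟶ Y.obj.as) →ₗ[k]
      (∀ m : Set.Icc a b, (X.obj.as.X m.1 ⟶ Y.obj.as.X m.1)) :=
    { toFun := fun f m => f.f m.1
      map_add' := fun _ _ => rfl
      map_smul' := fun _ _ => rfl }
  have hf : Function.Injective f := fun α β hαβ => by
    ext m : 1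
    by_cases hm : m ∈ Set.Icc a b
    · exact congrFun hαβ ⟨m, hm⟩
    · exact (h m (by rw [Set.mem_Icc] at hm; omega)).eq_of_src _ _
  have : Module.Finite k (X.obj.as ⟶ Y.obj.as) := Module.Finite.of_injective f hf
  let q : (X.obj.as ⟶ Y.obj.as) →ₗ[k] (X ⟶ Y) :=
    { toFun := fun f => ⟨(HomotopyCategory.quotient _ _).map f⟩
      map_add' := fun _ _ => rfl
      map_smul' := fun _ _ => rfl }
  refine Module.Finite.of_surjective q fun g => ?_
  obtain ⟨f, hf⟩ := (HomotopyCategory.quotient _ _).map_surjective g.hom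
  exact ⟨f, by ext; exact hf⟩

end TwistLinear

/-! ### Brutal truncation of complexes -/

section Truncation

variable {C : Type*} [Category C] [Preadditive C] [HasZeroObject C]

/-- Provides each term of a truncation together with its inclusion and projection, so that no case
distinction occurs in the type of an object. -/
lemma exists_truncation_term (K : CochainComplex C ℤ) (p : ℤ → Prop) (m : ℤ) :
    ∃ (Y : C) (i : Y ⟶ K.X m) (r : K.X m ⟶ Y), i ≫ r = 𝟙 Y ∧ (p m → r ≫ i = 𝟙 _) ∧
      (¬p m → IsZero Y) := by
  by_cases h : p m
  · exact ⟨K.X m, 𝟙 _, 𝟙 _, by simp, by simp, fun h' => absurd h h'⟩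
  · exact ⟨0, 0, 0, (isZero_zero C).eq_of_src _ _, fun h' => absurd h' h, fun _ => isZero_zero C⟩

/-- A complex can be cut at `a`, into a degreewise split extension of the part in degrees `≤ a` by
the part in degrees `> a`. -/
lemma exists_truncation (K : CochainComplex C ℤ) (a : ℤ) :
    ∃ (S : ShortComplex (CochainComplex C ℤ))
      (_ : ∀ m, (S.map (HomologicalComplex.eval C _ m)).Splitting), S.X₂ = K ∧
      (∀ m, m ≤ a → IsZero (S.X₁.X m)) ∧ (∀ m, a < m → IsZero (S.X₃.X m)) ∧
      ∀ m, IsZero (K.X m) → IsZero (S.X₁.X m) ∧ IsZero (S.X₃.X m) := by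
  choose Y i r hir hri hY using exists_truncation_term K (fun m => a < m)
  choose Y' i' r' hir' hri' hY' using exists_truncation_term K (fun m => ¬ a < m)
  let K₁ : CochainComplex C ℤ :=
    { X := Y
      d := fun p q => i p ≫ K.d p q ≫ r q
      shape := fun p q h => by rw [K.shape p q h]; simp
      d_comp_d' := fun p q s hpq hqs => by
        obtain rfl : p + 1 = q := hpq
        by_cases hp : a < p
        · have := hri (p + 1) (by omega)
          simp [reassoc_of% this]
        · exact (hY p hp).eq_of_src _ _ }
  let K₃ : CochainComplex C ℤ :=
    { X := Y'
      d := fun p q => i' p ≫ K.d p q ≫ r' q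
      shape := fun p q h => by rw [K.shape p q h]; simp
      d_comp_d' := fun p q s hpq hqs => by
        by_cases hp : a < q
        · rw [(hY' q (by simpa using hp)).eq_of_tgt (i' p ≫ K.d p q ≫ r' q) 0, zero_comp]
        · have := hri' q hp
          simp [reassoc_of% this] }
  let f : K₁ ⟶ K :=
    { f := i
      comm' := fun p q hpq => by
        obtain rfl : p + 1 = q := hpq
        by_cases hp : a < p
        · have := hri (p + 1) (by omega)
          simp [K₁, this]
        · exact (hY p hp).eq_of_src _ _ }
  let g : K ⟶ K₃ :=
    { f := r'
      comm' := fun p q hpq => by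
        obtain rfl : p + 1 = q := hpq
        by_cases hp : a < p
        · exact (hY' (p + 1) (by simp; omega)).eq_of_tgt _ _
        · have := hri' p hp
          simp [K₃, reassoc_of% this] }
  have hfg : f ≫ g = 0 := by
    ext m
    by_cases hm : a < m
    · exact (hY' m (by simpa using hm)).eq_of_tgt _ _
    · exact (hY m hm).eq_of_src _ _
  refine ⟨ShortComplex.mk f g hfg, fun m =>
    { r := r m
      s := i' m
      f_r := hir m
      s_g := hir' m
      id := ?_ }, rfl, fun m hm => hY m (by omega), fun m hm => hY' m (by simpa using hm),
      fun m hm => ⟨?_, ?_⟩⟩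
  · change r m ≫ i m + r' m ≫ i' m = 𝟙 _
    by_cases hm : a < m
    · rw [hri m hm, (hY' m (by simpa using hm)).eq_of_tgt (r' m) 0, zero_comp, add_zero]
    · rw [hri' m hm, (hY m hm).eq_of_tgt (r m) 0, zero_comp, zero_add]
  · refine (IsZero.iff_id_eq_zero _).2 ?_
    exact (hir m).symm.trans (by rw [hm.eq_of_tgt (i m) 0, zero_comp])
  · refine (IsZero.iff_id_eq_zero _).2 ?_
    exact (hir' m).symm.trans (by rw [hm.eq_of_tgt (i' m) 0, zero_comp])

/-- A complex concentrated in degree `0` is its term of degree `0`. -/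
lemma nonempty_iso_single (K : CochainComplex C ℤ) (h : ∀ m, m ≠ 0 → IsZero (K.X m)) :
    Nonempty (K ≅ (HomologicalComplex.single C (ComplexShape.up ℤ) 0).obj (K.X 0)) := by
  let f : K ⟶ (HomologicalComplex.single C (ComplexShape.up ℤ) 0).obj (K.X 0) :=
    HomologicalComplex.mkHomToSingle (𝟙 _) fun i hi =>
      (h i (by change i + 1 = 0 at hi; omega)).eq_of_src _ _
  have : ∀ m, IsIso (f.f m) := fun m => by
    by_cases hm : m = 0
    · subst hm
      rw [HomologicalComplex.mkHomToSingle_f]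
      infer_instance
    · exact ⟨0, (h m hm).eq_of_src _ _, (HomologicalComplex.isZero_single_obj_X
        (ComplexShape.up ℤ) 0 (K.X 0) m hm).eq_of_src _ _⟩
  exact ⟨@asIso _ _ _ _ f (HomologicalComplex.Hom.isIso_of_components f)⟩

end Truncation

/-! ### Generation by complexes concentrated in degree `0` -/

section Generation

variable {C : Type*} [Category C] [Preadditive C] [HasZeroObject C] [HasBinaryBiproducts C]

/-- A bounded complex, as an object of the homotopy category. -/
abbrev ofBounded (K : CochainComplex C ℤ) (a b : ℤ) (h : ∀ m, (m < a ∨ b < m) → IsZero (K.X m)) :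
    BoundedHomotopy C :=
  ⟨(HomotopyCategory.quotient _ _).obj K, a, b, h⟩

variable (C) in
/-- An object of `C`, as a complex in degree `0`. -/
def singleFunctor : C ⥤ BoundedHomotopy C :=
  (bounded C).lift (HomologicalComplex.single C (ComplexShape.up ℤ) 0 ⋙
    HomotopyCategory.quotient _ _) fun X => ⟨0, 0, fun m hm =>
      HomologicalComplex.isZero_single_obj_X (ComplexShape.up ℤ) 0 X m (by omega)⟩

instance : (singleFunctor C).Additive where
  map_add {X Y f g} := by
    ext
    exact Functor.map_add (HomologicalComplex.single C (ComplexShape.up ℤ) 0 ⋙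
      HomotopyCategory.quotient _ _)

variable (P : ObjectProperty (BoundedHomotopy C)) [P.IsClosedUnderIsomorphisms] [P.IsTriangulated]

lemma prop_of_shift (a : ℤ) (X : BoundedHomotopy C)
    (h : P ((CategoryTheory.shiftFunctor _ a).obj X)) : P X :=
  P.prop_of_iso ((shiftEquiv (BoundedHomotopy C) a).unitIso.symm.app X) (P.le_shift (-a) _ h)

lemma prop_of_concentrated (hP : ∀ M : C, P ((singleFunctor C).obj M)) (a b m : ℤ)
    (K : CochainComplex C ℤ) (h : ∀ m, (m < a ∨ b < m) → IsZero (K.X m))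
    (hK : ∀ m', m' ≠ m → IsZero (K.X m')) : P (ofBounded K a b h) := by
  refine prop_of_shift P m _ ?_
  obtain ⟨e⟩ := nonempty_iso_single ((CategoryTheory.shiftFunctor _ m).obj K)
    fun m' hm' => hK (m' + m) (by omega)
  refine P.prop_of_iso ((bounded C).ι.preimageIso ?_) (hP (((CategoryTheory.shiftFunctor _ m).obj K).X 0))
  exact ((HomotopyCategory.quotient _ _).mapIso e.symm) ≪≫
    ((HomotopyCategory.quotient _ _).commShiftIso m).app K ≪≫
      (((bounded C).ι.commShiftIso m).app (ofBounded K a b h)).symm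

/-- A degreewise split extension gives a distinguished triangle in the full homotopy category. The
third object of a bounded triangle on the same first map is compared with it there, and full
faithfulness brings the isomorphism back. -/
lemma prop_of_degreewiseSplit (S : ShortComplex (CochainComplex C ℤ))
    (σ : ∀ m, (S.map (HomologicalComplex.eval C _ m)).Splitting) (X₁ X₂ X₃ : BoundedHomotopy C)
    (e₁ : X₁.obj = (HomotopyCategory.quotient _ _).obj S.X₁)
    (e₂ : X₂.obj = (HomotopyCategory.quotient _ _).obj S.X₂)
    (e₃ : X₃.obj = (HomotopyCategory.quotient _ _).obj S.X₃)
    (h₁ : P X₁) (h₃ : P X₃) : P X₂ := by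
  obtain ⟨X₁, p₁⟩ := X₁
  obtain ⟨X₂, p₂⟩ := X₂
  obtain ⟨X₃, p₃⟩ := X₃
  obtain rfl := e₁
  obtain rfl := e₂
  obtain rfl := e₃
  let f : (⟨_, p₁⟩ : BoundedHomotopy C) ⟶ ⟨_, p₂⟩ :=
    ObjectProperty.homMk ((HomotopyCategory.quotient _ _).map S.f)
  obtain ⟨Z, g, d, hT⟩ := Pretriangulated.distinguished_cocone_triangle f
  have hS : trianglehOfDegreewiseSplit S σ ∈ Pretriangulated.distinguishedTriangles :=
    (HomotopyCategory.distinguished_iff_iso_trianglehOfDegreewiseSplit _).2 ⟨S, σ, ⟨Iso.refl _⟩⟩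
  have hT' := (bounded C).ι.map_distinguished _ hT
  let e := Pretriangulated.isoTriangleOfIso₁₂ _ _ hT' hS (Iso.refl _) (Iso.refl _)
    ((Category.comp_id _).trans (Category.id_comp _).symm)
  have eZ : Z ≅ (⟨_, p₃⟩ : BoundedHomotopy C) := (bounded C).ι.preimageIso
    (Pretriangulated.Triangle.π₃.mapIso e)
  exact P.ext_of_isTriangulatedClosed₂ _ hT h₁ (P.prop_of_iso eZ.symm h₃)

/-- The complexes concentrated in degree `0` generate the homotopy category of bounded
complexes. -/
lemma prop_of_single (hP : ∀ M : C, P ((singleFunctor C).obj M)) (X : BoundedHomotopy C) : P X := by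
  obtain ⟨K, a, b, h⟩ := X
  obtain ⟨K : CochainComplex _ _, rfl⟩ := K.quotient_obj_surjective
  have key : ∀ (N : ℕ) (a b : ℤ) (_ : b - a < N) (K : CochainComplex C ℤ)
      (h : ∀ m, (m < a ∨ b < m) → IsZero (K.X m)), P (ofBounded K a b h) := by
    intro N
    induction N with
    | zero =>
      intro a b hab K h
      -- Here `b < a`, so all terms vanish and any degree may be taken as the degree of
      -- concentration.
      exact prop_of_concentrated P hP a b 0 K h fun m _ => h m (by omega)
    | succ N ih =>
      intro a b hab K h
      obtain ⟨S, σ, rfl, h₁, h₃, h₀⟩ := exists_truncation K a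
      have b₁ : ∀ m, (m < a + 1 ∨ b < m) → IsZero (S.X₁.X m) := fun m hm => by
        by_cases hma : m ≤ a
        · exact h₁ m hma
        · exact (h₀ m (h m (by omega))).1
      have b₃ : ∀ m, (m < a ∨ a < m) → IsZero (S.X₃.X m) := fun m hm => by
        by_cases hma : a < m
        · exact h₃ m hma
        · exact (h₀ m (h m (by omega))).2
      exact prop_of_degreewiseSplit P S σ (ofBounded S.X₁ (a + 1) b b₁) (ofBounded S.X₂ a b h)
        (ofBounded S.X₃ a a b₃) rfl rfl rfl (ih (a + 1) b (by omega) S.X₁ b₁)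
        (prop_of_concentrated P hP a a a S.X₃ b₃ fun m hm => b₃ m (by omega))
  exact key (b - a + 1).toNat a b (by omega) K h

end Generation

/-! ### Decomposition of projective modules and finite generation -/

section Decomposition

variable {n : ℕ} {k : Type u} [Field k]

open GrProj

/-- Some loop acts non-trivially on each non-zero projective module. -/
lemma exists_z_smul_ne_zero (M : Type*) [AddCommGroup M] [Module (Zigzag k n) M]
    [Module.Projective (Zigzag k n) M] [Nontrivial M] :
    ∃ (i : Fin n) (m : M), idem k i • m = m ∧ gen k (.z i) • m ≠ 0 := by
  by_contra! h
  have hz : ∀ (i : Fin n) (m : M), gen k (.z i) • m = 0 := fun i m => by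
    have := h i (idem k i • m) (by rw [smul_smul, idem_mul_idem])
    rwa [smul_smul, z_mul_idem] at this
  obtain ⟨m, hm⟩ := exists_ne (0 : M)
  refine hm ?_
  rw [← one_smul (Zigzag k n) m, ← sum_idem k, Finset.sum_smul]
  refine Finset.sum_eq_zero fun i _ => ?_
  have hi : idem k i • idem k i • m = idem k i • m := by rw [smul_smul, idem_mul_idem]
  -- If all loops act by zero, then each `e_i m` is killed by `z_i`, and by the arrows because these
  -- carry it into `z_j M = 0`. It therefore lies in `z_i M`, which is zero too.
  obtain ⟨m', h'⟩ := mem_of_arrow_smul_eq_zero hi (hz i _) fun c j => by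
    by_cases hj : j = i
    · subst hj
      simp [GrProj.arrow]
    · obtain ⟨m', h'⟩ := arrow_smul_mem hj c hi (hz i _)
      rw [h', hz]
  rw [h', hz]

/-- Each non-zero projective module has some `P_i` as a direct summand. -/
lemma exists_retraction {G : Type} [AddCommGroup G] [DecidableEq G] {w : Weight n G}
    (M : GrProj k w) [Nontrivial M] : ∃ (i : Fin n)
    (f : leftIdeal k i →ₗ[Zigzag k n] M) (r : M →ₗ[Zigzag k n] leftIdeal k i),
      r ∘ₗ f = LinearMap.id := by
  obtain ⟨i, m, hm, hz⟩ := exists_z_smul_ne_zero (k := k) (n := n) M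
  let v : M.corner i := ⟨m, hm⟩
  have hz' : zMul i M v ≠ 0 := fun h => hz ((coe_zMul i v).symm.trans (congrArg Subtype.val h))
  have hzz : zMul i M (zMul i M v) = 0 := Subtype.ext (by
    rw [coe_zMul, coe_zMul, smul_smul, z_mul_z, zero_smul]; rfl)
  obtain ⟨φ, hφ⟩ := Module.Projective.exists_dual_eq_one k hz'
  -- Normalises `φ(v') = 0` while keeping `φ(z_i v') = 1`; this is possible because `z_i` squares to
  -- zero.
  let v' : M.corner i := v - φ v • zMul i M v
  have h₁ : φ v' = 0 := by simp [v', hφ]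
  have h₂ : φ (zMul i M v') = 1 := by simp [v', hφ, hzz]
  -- The unit `g_i` turns a linear form on `e_i M` into an `A`-linear map to `A e_i`. On `v'` its
  -- value is `φ(v') z_i + φ(z_i v') e_i = e_i`.
  let r : M →ₗ[Zigzag k n] leftIdeal k i :=
    (AlgebraTensorModule.rid k (Zigzag k n) (leftIdeal k i)).toLinearMap ∘ₗ
      AlgebraTensorModule.map LinearMap.id φ ∘ₗ coevALin i M
  have hr : r v'.1 = idemP k i := by
    change AlgebraTensorModule.rid k (Zigzag k n) (leftIdeal k i)
      (AlgebraTensorModule.map LinearMap.id φ (coevLin i M v')) = _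
    rw [coevLin_corner, map_add, AlgebraTensorModule.map_tmul, AlgebraTensorModule.map_tmul, h₁, h₂]
    simp
  refine ⟨i, LinearMap.toSpanSingleton (Zigzag k n) M v'.1 ∘ₗ (leftIdeal k i).subtype, r,
    LinearMap.ext fun p => ?_⟩
  change r (p.1 • v'.1) = p
  rw [map_smul, hr, smul_idemP]

/-- A direct summand of a module, without grading. -/
def summand (M : GrProj k (Weight.ungraded n)) (N : Submodule (Zigzag k n) M)
    (r : M →ₗ[Zigzag k n] N) (hr : r ∘ₗ N.subtype = LinearMap.id) :
    GrProj k (Weight.ungraded n) where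
  carrier := N
  piece _ := ⊤
  isInternal := isInternal_of_coact k _ (by simp) (Finsupp.lsingle 0) fun g m _ => by
    rw [Subsingleton.elim g 0]; rfl
  smul_mem _ _ := trivial
  finite := Module.Finite.of_surjective r fun x => ⟨x, LinearMap.congr_fun hr x⟩
  projective := Module.Projective.of_split N.subtype r hr

/-- A homomorphism of modules, as a morphism of modules without grading. -/
def ofUngraded {M N : GrProj k (Weight.ungraded n)} (f : M →ₗ[Zigzag k n] N) : M ⟶ N :=
  ofLin f fun _ => by rw [N.piece_eq_top]; trivial

/-- Each non-zero module has some `P_i` as a direct summand. -/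
lemma exists_biprod_iso (M : GrProj k (Weight.ungraded n)) [Nontrivial M] :
    ∃ (i : Fin n) (N : GrProj k (Weight.ungraded n)),
      Nonempty (M ≅ proj k (Weight.ungraded n) i ⊞ N) ∧ Module.finrank k N < Module.finrank k M := by
  obtain ⟨i, f, r, hrf⟩ := exists_retraction M
  have hrf' : ∀ p, r (f p) = p := fun p => LinearMap.congr_fun hrf p
  let s : M →ₗ[Zigzag k n] LinearMap.ker r :=
    (LinearMap.id - f ∘ₗ r).codRestrict _ fun m => by simp [hrf']
  have hs : ∀ x, (s x : M) = x - f (r x) := fun x => rfl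
  let N := summand M (LinearMap.ker r) s (LinearMap.ext fun x => Subtype.ext (by
    change (s x.1 : M) = x
    rw [hs, x.2, map_zero, sub_zero]))
  let b : BinaryBicone (proj k (Weight.ungraded n) i) N :=
    { pt := M
      fst := ofUngraded (N := proj k (Weight.ungraded n) i) r
      snd := ofUngraded (N := N) s
      inl := ofUngraded (M := proj k (Weight.ungraded n) i) f
      inr := ofUngraded (M := N) (LinearMap.ker r).subtype
      inl_fst := hom_ext hrf'
      inl_snd := hom_ext fun p => Subtype.ext (by
        change f (p : leftIdeal k i) - f (r (f (p : leftIdeal k i))) = 0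
        exact sub_eq_zero.2 (congrArg f (hrf' p).symm))
      inr_fst := hom_ext fun x => x.2
      inr_snd := hom_ext fun x => Subtype.ext (by
        change x.1 - f (r x.1) = x.1
        rw [show r x.1 = 0 from x.2, map_zero, sub_zero]) }
  have hb : b.IsBilimit := isBinaryBilimitOfTotal b (hom_ext fun x => add_sub_cancel _ _)
  refine ⟨i, N, ⟨biprod.uniqueUpToIso _ _ hb⟩, ?_⟩
  refine Submodule.finrank_lt (s := (LinearMap.ker r).restrictScalars k) fun h => ?_
  have h₁ : f (idemP k i) ∈ (LinearMap.ker r).restrictScalars k := h ▸ Submodule.mem_top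
  have h₂ : idemP k i = 0 := (hrf' _).symm.trans h₁
  have h₃ := congrArg (fun p : leftIdeal k i => coefE k i p.1) h₂
  rw [coe_idemP] at h₃
  simp at h₃

lemma prop_biprod {D : Type*} [Category D] [Preadditive D] [HasZeroObject D] [HasShift D ℤ]
    [∀ m : ℤ, (CategoryTheory.shiftFunctor D m).Additive] [Pretriangulated D]
    (P : ObjectProperty D) [P.IsClosedUnderIsomorphisms] [P.IsTriangulated] [HasBinaryBiproducts D]
    {X Y : D} (hX : P X) (hY : P Y) : P (X ⊞ Y) :=
  P.ext_of_isTriangulatedClosed₂ _ (Pretriangulated.binaryBiproductTriangle_distinguished X Y) hX hY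

/-- Induction on the dimension: splitting off some `P_i` leaves a complement of smaller dimension.
-/
lemma prop_single (P : ObjectProperty (DCat k (Weight.ungraded n))) [P.IsClosedUnderIsomorphisms]
    [P.IsTriangulated] (hP : ∀ i, P ((singleFunctor _).obj (proj k (Weight.ungraded n) i)))
    (M : GrProj k (Weight.ungraded n)) : P ((singleFunctor _).obj M) := by
  have := preservesBinaryBiproducts_of_preservesBiproducts
    (singleFunctor (GrProj k (Weight.ungraded n)))
  induction hd : Module.finrank k M using Nat.strong_induction_on generalizing M with
  | _ d ih =>
    rcases subsingleton_or_nontrivial M with h | h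
    · exact P.prop_of_isZero ((singleFunctor _).map_isZero ((IsZero.iff_id_eq_zero _).2
        (hom_ext fun m => Subsingleton.elim _ _)))
    · obtain ⟨i, N, ⟨e⟩, hN⟩ := exists_biprod_iso M
      refine P.prop_of_iso ((singleFunctor _).mapIso e ≪≫ (singleFunctor _).mapBiprod _ _).symm ?_
      exact prop_biprod P (hP i) (ih _ (hd ▸ hN) N rfl)

/-- The trivial grading is essential to finiteness of the generating set: with a `ℤ`-grading, all
grading shifts of the `P_i` would be needed. -/
lemma isFinitelyGenerated_DCat : IsFinitelyGenerated (DCat k (Weight.ungraded n)) := by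
  refine ⟨Set.range fun i => (singleFunctor _).obj (proj k (Weight.ungraded n) i),
    Set.finite_range _, fun P _ _ hP => prop_of_single P (prop_single P fun i => hP _ ⟨i, rfl⟩)⟩

theorem isTwoLinear_freeGroup : IsTwoLinear k (FreeGroup (Fin n)) :=
  ⟨DCat k (Weight.ungraded n), inferInstance, inferInstance, inferInstance, inferInstance,
    inferInstance, inferInstance, inferInstance, inferInstance, inferInstance,
    finite_hom_DCat k _, isFinitelyGenerated_DCat, actionHom k _,
    isLinearTriangulated_actionHom k _, actionHom_injective k _⟩

end Decomposition

end ZigzagFree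

end

/-- The free group acts faithfully, through the spherical twists `Σ_i`, on the homotopy category of
bounded complexes of finitely generated projective modules over the zigzag algebra: for the grading
of the symmetric orientation, of any orientation, by path length, and without grading. Hence it is
2-linear. -/
theorem theorem1p2 (k : Type u) [Field k] [CharZero k] (n : ℕ) :
    ZigzagFree.ActsFaithfully k
      (ZigzagFree.Weight.ofOrientation (ZigzagFree.symmetricOrientation n)) ∧
    (∀ o : ZigzagFree.Orientation n,
      ZigzagFree.ActsFaithfully k (ZigzagFree.Weight.ofOrientation o)) ∧
    ZigzagFree.ActsFaithfully k (ZigzagFree.Weight.pathLength n) ∧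
    ZigzagFree.ActsFaithfully k (ZigzagFree.Weight.ungraded n) ∧
    ZigzagFree.IsTwoLinear k (FreeGroup (Fin n)) :=
  ⟨ZigzagFree.actsFaithfully k _, fun _ => ZigzagFree.actsFaithfully k _,
    ZigzagFree.actsFaithfully k _, ZigzagFree.actsFaithfully k _,
    ZigzagFree.isTwoLinear_freeGroup⟩
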